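/- **Definitions.** A *half-dilation* is a map $z\mapsto az+b$ of $\mathbb C$ with $a\in\mathbb R\setminus\{0\}$, $b\in\mathbb C$. For $k\ge 1$, a *half-dilation $k\pi$-cone* is obtained from $k$ closed upper half-planes $U_1,\dots,U_k$ by gluing the ray $(-\infty,0]$ of $U_n$ to the ray $[0,\infty)$ of $U_{n+1}$ (indices mod $k$) by $z\mapsto a_nz$, with $a_n<0$. A *half-dilation structure* on a surface $X$ with a finite set $\Sigma$ of singularities is an atlas of $X\setminus\Sigma$ whose transition maps are locally half-dilations, such that every $p\in\Sigma$ has a neighbourhood homeomorphic, by a map that sends $p$ to the apex and is a half-dilation in local coordinates away from $p$, to a neighbourhood of the apex of some half-dilation $k\pi$-cone. A *half-dilation pillowcase* is a half-dilation structure on the 2-sphere with exactly four singularities. A *triangulation* is a finite collection of subsets of $X$ (triangles) with pairwise disjoint interiors and union $X$; each is the image of a closed nondegenerate Euclidean triangle under a continuous map that is injective on the interior and a half-dilation in local coordinates off the vertices, and its points in $\Sigma$ are exactly its vertices. The angles of a triangle are those of the Euclidean triangle. A triangulation is *Delaunay* if for every edge the two angles opposite that edge have sum at most $\pi$. A triangulation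 of a pillowcase is *tetrahedral* if it has the combinatorics of the boundary of a tetrahedron with vertex set $\Sigma$, and is a *$\{2,2,4,4\}$-triangulation* if the numbers of triangles around the four singularities (counted with multiplicity) are $2,2,4,4$. **Proposition 4.3.** Let $X$ be a half-dilation pillowcase. 1. Let $T$ be a tetrahedral Delaunay triangulation of $X$, let $t$ be one of its triangles, with angles $\alpha',\beta',\gamma'$, and let $\alpha,\beta,\gamma$ be the angles, in the other three triangles, opposite the edges of $t$ that are opposite $\alpha',\beta',\gamma'$ respectively. If $$\alpha+\alpha'<\pi,\qquad \beta+\beta'<\pi,\qquad \gamma+\gamma'<\pi,$$ then $T$ is the unique Delaunay triangulation of $X$ (that is, every Delaunay triangulation of $X$ is the same collection of subsets of $X$). 2. A $\{2,2,4,4\}$-triangulation of $X$ is never the unique Delaunay triangulation of $X$. -/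

import Mathlib

open Topology

/-- A half-dilation of the complex plane: `z ↦ a z + b` with `a` real and nonzero, `b` complex. -/
def IsHalfDilation (h : ℂ → ℂ) : Prop :=
  ∃ (a : ℝ) (b : ℂ), a ≠ 0 ∧ ∀ z, h z = (a : ℂ) * z + b

/-- The gluing of `k` closed upper half-planes (indexed cyclically by `Fin k`): the point `x` of the
ray `(-∞, 0]` of the `n`-th half-plane is glued to the point `a n * x` of the ray `[0, ∞)` of the
`(n+1)`-st one.  In particular all the origins are glued together. -/
inductive HalfDilationCone.Glue (k : ℕ) [NeZero k] (a : Fin k → ℝ) :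
    Fin k × {z : ℂ // 0 ≤ z.im} → Fin k × {z : ℂ // 0 ≤ z.im} → Prop
  | glue (n : Fin k) (x y : {z : ℂ // 0 ≤ z.im}) (hx : (x : ℂ).im = 0) (hx' : (x : ℂ).re ≤ 0)
      (hy : (y : ℂ) = (a n : ℂ) * (x : ℂ)) : HalfDilationCone.Glue k a (n, x) (n + 1, y)

/-- The half-dilation `kπ`-cone with gluing factors `a n` (which are negative in every use below):
the quotient space of `k` closed upper half-planes by the gluing above. -/
def HalfDilationCone (k : ℕ) [NeZero k] (a : Fin k → ℝ) : Type :=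
  Quot (HalfDilationCone.Glue k a)

instance HalfDilationCone.instTopologicalSpace (k : ℕ) [NeZero k] (a : Fin k → ℝ) :
    TopologicalSpace (HalfDilationCone k a) :=
  inferInstanceAs (TopologicalSpace (Quot (HalfDilationCone.Glue k a)))

/-- The point of the cone given by the point `z` of the `n`-th half-plane. -/
def HalfDilationCone.mk {k : ℕ} [NeZero k] (a : Fin k → ℝ) (n : Fin k)
    (z : {z : ℂ // 0 ≤ z.im}) : HalfDilationCone k a :=
  Quot.mk _ (n, z)

/-- The apex of the cone (the common image of all the origins). -/
def HalfDilationCone.apex {k : ℕ} [NeZero k] (a : Fin k → ℝ) : HalfDilationCone k a :=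
  HalfDilationCone.mk a 0 ⟨0, le_rfl⟩

/-- Given a set `atlas` of charts of `X` with values in `ℂ`, a map `f` to `X` from a subspace of `ℂ`
(cut out by the predicate `D`) is a half-dilation in local coordinates near the point `z`. -/
def IsHalfDilationAt {X : Type*} [TopologicalSpace X] (atlas : Set (OpenPartialHomeomorph X ℂ))
    {D : ℂ → Prop} (f : {w : ℂ // D w} → X) (z : {w : ℂ // D w}) : Prop :=
  ∃ φ ∈ atlas, f z ∈ φ.source ∧ ∃ h : ℂ → ℂ, IsHalfDilation h ∧
    ∀ᶠ w in 𝓝 z, f w ∈ φ.source ∧ φ (f w) = h w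

/-- A half-dilation structure on a space `X` with a finite set of singularities: an atlas of the
complement of the singularities whose transition maps are locally half-dilations, such that each
singularity has a neighbourhood which is homeomorphic to a neighbourhood of the apex of some
half-dilation `kπ`-cone, `k ≥ 1`, by a map that is a half-dilation in local coordinates away from
the singularity. -/
structure HalfDilationStructure (X : Type*) [TopologicalSpace X] where
  /-- the singularities -/
  sing : Finset X
  /-- the charts of the complement of the singularities -/
  atlas : Set (OpenPartialHomeomorph X ℂ)
  source_subset : ∀ φ ∈ atlas, φ.source ⊆ {x | x ∉ sing}
  exists_chart : ∀ x, x ∉ sing → ∃ φ ∈ atlas, x ∈ φ.source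
  compatible : ∀ φ ∈ atlas, ∀ ψ ∈ atlas, ∀ x ∈ φ.source ∩ ψ.source,
    ∃ h : ℂ → ℂ, IsHalfDilation h ∧ ∀ᶠ y in 𝓝 x, ψ y = h (φ y)
  exists_cone : ∀ p ∈ sing, ∃ (k : ℕ) (_ : NeZero k) (a : Fin k → ℝ), (∀ n, a n < 0) ∧
    ∃ c : OpenPartialHomeomorph X (HalfDilationCone k a),
      p ∈ c.source ∧ c p = HalfDilationCone.apex a ∧
      ∀ (n : Fin k) (z : {z : ℂ // 0 ≤ z.im}), (z : ℂ) ≠ 0 →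
        HalfDilationCone.mk a n z ∈ c.target →
        IsHalfDilationAt atlas (fun w => c.symm (HalfDilationCone.mk a n w)) z

namespace HalfDilationStructure

variable {X : Type*} [TopologicalSpace X]

/-- A half-dilation pillowcase: a half-dilation structure on the 2-sphere with four singularities. -/
def IsPillowcase (S : HalfDilationStructure X) : Prop :=
  Nonempty (X ≃ₜ Metric.sphere (0 : EuclideanSpace ℝ (Fin 3)) 1) ∧ S.sing.card = 4

/-- A (geodesic) triangulation of a surface with a half-dilation structure: `n` triangles, the
`i`-th of which is the image in `X` of the closed nondegenerate plane triangle with vertices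
`vert i 0`, `vert i 1`, `vert i 2` under `map i`.  Only the values of `map i` on that plane triangle
matter. -/
structure Triangulation (S : HalfDilationStructure X) where
  /-- the number of triangles -/
  n : ℕ
  /-- the vertices of the plane triangles -/
  vert : Fin n → Fin 3 → ℂ
  /-- the parametrizations of the triangles of the surface by plane triangles -/
  map : Fin n → ℂ → X
  affineIndependent : ∀ i, AffineIndependent ℝ (vert i)
  continuousOn : ∀ i, ContinuousOn (map i) (convexHull ℝ (Set.range (vert i)))
  injOn_interior : ∀ i, Set.InjOn (map i) (interior (convexHull ℝ (Set.range (vert i))))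
  /-- away from the vertices the parametrization is a half-dilation in local coordinates -/
  isHalfDilationAt : ∀ i, ∀ z : {z : ℂ // z ∈ convexHull ℝ (Set.range (vert i))},
    (z : ℂ) ∉ Set.range (vert i) →
      IsHalfDilationAt S.atlas (fun w : {z : ℂ // z ∈ convexHull ℝ (Set.range (vert i))} =>
        map i w) z
  /-- all vertices are singularities -/
  map_vert_mem : ∀ i j, map i (vert i j) ∈ S.sing
  /-- a triangle contains no singularities off its vertices -/
  map_notMem : ∀ i, ∀ z ∈ convexHull ℝ (Set.range (vert i)), z ∉ Set.range (vert i) →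
    map i z ∉ S.sing
  /-- distinct triangles have disjoint interiors -/
  disjoint_interior : ∀ i i', i ≠ i' →
    Disjoint (interior (map i '' convexHull ℝ (Set.range (vert i))))
      (interior (map i' '' convexHull ℝ (Set.range (vert i'))))
  /-- the triangles cover the surface -/
  cover : ∀ x : X, ∃ i, x ∈ map i '' convexHull ℝ (Set.range (vert i))

namespace Triangulation

variable {S : HalfDilationStructure X}

/-- The `i`-th triangle, as a subset of the surface. -/
def face (T : S.Triangulation) (i : Fin T.n) : Set X :=
  T.map i '' convexHull ℝ (Set.range (T.vert i))

/-- The triangulation as a collection of subsets of the surface. -/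
def faces (T : S.Triangulation) : Set (Set X) := Set.range T.face

/-- A corner of a triangulation: a triangle together with one of its three vertices. -/
abbrev Corner (T : S.Triangulation) : Type := Fin T.n × Fin 3

/-- The singularity at which a corner sits. -/
def vertex (T : S.Triangulation) (c : T.Corner) : X := T.map c.1 (T.vert c.1 c.2)

/-- The (Euclidean, unoriented) angle at a corner. -/
noncomputable def angle (T : S.Triangulation) (c : T.Corner) : ℝ :=
  EuclideanGeometry.angle (T.vert c.1 (c.2 + 1)) (T.vert c.1 c.2) (T.vert c.1 (c.2 + 2))

/-- The edge opposite a corner in its triangle, as a subset of the surface. -/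
def edge (T : S.Triangulation) (c : T.Corner) : Set X :=
  T.map c.1 '' segment ℝ (T.vert c.1 (c.2 + 1)) (T.vert c.1 (c.2 + 2))

/-- `c` and `d` are the two corners opposite one and the same edge of the triangulation. -/
def AreOpposite (T : S.Triangulation) (c d : T.Corner) : Prop :=
  c ≠ d ∧ T.edge c = T.edge d

/-- A triangulation is Delaunay if each edge is locally Delaunay: the two angles opposite it add up
to at most `π`. -/
def IsDelaunay (T : S.Triangulation) : Prop :=
  ∀ c d : T.Corner, T.AreOpposite c d → T.angle c + T.angle d ≤ Real.pi

/-- `T` is the unique Delaunay triangulation (as a collection of subsets of the surface). -/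
def IsUniqueDelaunay (T : S.Triangulation) : Prop :=
  T.IsDelaunay ∧ ∀ T' : S.Triangulation, T'.IsDelaunay → T'.faces = T.faces

/-- A triangulation is tetrahedral if it has the combinatorics of the boundary of a tetrahedron whose
vertices are the singularities: the triangles correspond bijectively to the singularities, the
vertices of a triangle being all the singularities except the corresponding one. -/
def IsTetrahedral (T : S.Triangulation) : Prop :=
  ∃ e : Fin T.n ≃ {p : X // p ∈ S.sing}, ∀ i,
    Set.range (fun j => T.vertex (i, j)) = {p | p ∈ S.sing ∧ p ≠ e i}

/-- The number of triangles around a point, counted with multiplicity (that is, the number of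
corners sitting there). -/
noncomputable def valence (T : S.Triangulation) (p : X) : ℕ :=
  {c : T.Corner | T.vertex c = p}.ncard

/-- A `{2,2,4,4}`-triangulation: the numbers of triangles around the singularities are 2, 2, 4, 4. -/
def IsType2244 (T : S.Triangulation) : Prop :=
  S.sing.val.map T.valence = {2, 2, 4, 4}

end Triangulation

end HalfDilationStructure

/-!
Let `T` be a triangulation of the surface. On each triangle consider minus the power of a point
with respect to the circumcircle of the triangle, `negPower`; it is the affine interpolation of
`|z|²` from the vertices, minus `|z|²`. A half-dilation multiplies it by the square of its scale,
so the values on the triangles form a density `P_T` on the surface, which vanishes at the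
singularities. By the incircle criterion (`PlaneTriangle.exists_negPower_eq`) the triangulation is
Delaunay exactly when, across each edge, `P_T + |z|²` is in a local coordinate `z` the maximum of
the two affine functions that belong to the adjacent triangles; it has a kink along the edge
exactly when the angle sum is less than `π`. So for a Delaunay triangulation `T` and any
triangulation `T'`, the function `P_T + |z|²` is convex on each triangle of `T'` and agrees with
the affine function `P_T' + |z|²` at the vertices; hence `P_T ≤ P_T'` (`density_le`). By symmetry
all Delaunay triangulations have the same density (`density_eq_of_isDelaunay`). If all angle sums
of `T` are less than `π`, the kinks of the density are the edges of `T`, and these cannot meet an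
open triangle of another Delaunay triangulation, which therefore has the same triangles as `T`
(`isUniqueDelaunay_of_forall_lt`).

The convexity argument needs control of the density at the vertices, where there are no charts with
values in `ℂ`. In a half-dilation cone, a curve that starts at the apex and is locally a straight
segment of a fixed direction is a ray (`HalfDilationCone.exists_eq_scale`); so a segment from a
vertex of `T'` initially coincides with a segment from a vertex of `T` (`eventually_radial`).

The same fact shows that the directions at the corners around a singularity cover all directions
modulo half-turns, so that the total angle there is at least `π`. A tetrahedral or
`{2,2,4,4}`-triangulation has four triangles, with total angle `4π`, so the total angle at each of
the four singularities is exactly `π` (`sum_angle_eq_pi`). In a tetrahedral triangulation this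
forces opposite edges to have equal angle sums (`add_transpose_lt_pi`). The three edges of one
triangle represent all pairs of opposite edges, hence all six angle sums are less than `π`, which
gives the first part.

In a Delaunay `{2,2,4,4}`-triangulation each triangle has exactly one corner at one of the two
singularities of valence two. The edges opposite these four corners are two edges, each between a
triangle at one of these singularities and a triangle at the other one. Their angle sums are at
most `π` and add up to `2π`, so both are `π` (`IsType2244.exists_cocircular`). The two triangles at
such an edge have the same circumcircle, and their union can be cut along the other diagonal; by
the inscribed angle theorem the result is another Delaunay triangulation
(`IsFlippable.isDelaunay_flip`), which gives the second part.
-/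

/-! ### Affine functions and triangles in the plane -/

/-- A real-valued affine function on the plane. -/
def IsRealAffine (f : ℂ → ℝ) : Prop := ∃ p q r : ℝ, ∀ z, f z = p * z.re + q * z.im + r

namespace IsRealAffine

variable {f g : ℂ → ℝ}

theorem add (hf : IsRealAffine f) (hg : IsRealAffine g) : IsRealAffine fun z => f z + g z := by
  obtain ⟨p, q, r, hf⟩ := hf
  obtain ⟨p', q', r', hg⟩ := hg
  exact ⟨p + p', q + q', r + r', fun z => by simp only [hf, hg]; ring⟩

theorem const_mul (c : ℝ) (hf : IsRealAffine f) : IsRealAffine fun z => c * f z := by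
  obtain ⟨p, q, r, hf⟩ := hf
  exact ⟨c * p, c * q, c * r, fun z => by simp only [hf]; ring⟩

theorem sub (hf : IsRealAffine f) (hg : IsRealAffine g) : IsRealAffine fun z => f z - g z := by
  obtain ⟨p, q, r, hf⟩ := hf
  obtain ⟨p', q', r', hg⟩ := hg
  exact ⟨p - p', q - q', r - r', fun z => by simp only [hf, hg]; ring⟩

theorem comp_halfDilation (hf : IsRealAffine f) (a : ℝ) (b : ℂ) :
    IsRealAffine fun z => f ((a : ℂ) * z + b) := by
  obtain ⟨p, q, r, hf⟩ := hf
  refine ⟨p * a, q * a, p * b.re + q * b.im + r, fun z => ?_⟩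
  simp only [hf, Complex.add_re, Complex.add_im, Complex.re_ofReal_mul, Complex.im_ofReal_mul]
  ring

theorem of_affineMap (A : ℂ →ᵃ[ℝ] ℝ) : IsRealAffine A := by
  refine ⟨A.linear 1, A.linear Complex.I, A 0, fun z => ?_⟩
  have h1 : A z = A.linear z + A 0 := by
    have := A.map_vadd 0 z
    simpa using this
  have h2 : z = z.re • (1 : ℂ) + z.im • Complex.I := by
    apply Complex.ext <;> simp
  have h3 : A.linear z = z.re * A.linear 1 + z.im * A.linear Complex.I := by
    conv_lhs => rw [h2]
    rw [map_add, map_smul, map_smul, smul_eq_mul, smul_eq_mul]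
  rw [h1, h3]
  ring

theorem continuous (hf : IsRealAffine f) : Continuous f := by
  obtain ⟨p, q, r, hf⟩ := hf
  have : f = fun z => p * z.re + q * z.im + r := funext hf
  rw [this]
  fun_prop

theorem apply_combo (hf : IsRealAffine f) (x y : ℂ) (t : ℝ) :
    f ((1 - t : ℝ) * x + (t : ℝ) * y) = (1 - t) * f x + t * f y := by
  obtain ⟨p, q, r, hf⟩ := hf
  rw [hf, hf, hf]
  simp only [Complex.add_re, Complex.add_im, Complex.re_ofReal_mul, Complex.im_ofReal_mul]
  ring

theorem apply_eq_sum (hf : IsRealAffine f) (b : AffineBasis (Fin 3) ℝ ℂ) (z : ℂ) :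
    f z = ∑ j, b.coord j z * f (b j) := by
  obtain ⟨p, q, r, hf⟩ := hf
  have h1 := b.sum_coord_apply_eq_one z
  have h2 := b.linear_combination_coord_eq_self z
  rw [Fin.sum_univ_three] at *
  have h3 := congrArg Complex.re h2
  have h4 := congrArg Complex.im h2
  simp only [Complex.real_smul, Complex.add_re, Complex.add_im, Complex.re_ofReal_mul,
    Complex.im_ofReal_mul] at h3 h4
  simp only [hf]
  linear_combination -p * h3 - q * h4 - r * h1

/-- A function which is affine and has a local minimum with value zero vanishes. -/
theorem eq_zero_of_nonneg_near (hf : IsRealAffine f) {o : ℂ} (h0 : f o = 0)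
    (h : ∀ᶠ z in 𝓝 o, 0 ≤ f z) (z : ℂ) : f z = 0 := by
  have hlim : Filter.Tendsto (fun t : ℝ => (1 - t : ℝ) * o + (t : ℝ) * z) (𝓝 0) (𝓝 o) := by
    have : Continuous (fun t : ℝ => ((1 - t : ℝ) : ℂ) * o + (t : ℝ) * z) := by fun_prop
    simpa using this.tendsto 0
  obtain ⟨ε, hε, hb⟩ := Metric.eventually_nhds_iff.1 (hlim.eventually h)
  have h1 := hb (y := ε / 2) (by rw [Real.dist_eq, abs_lt]; constructor <;> linarith)
  have h2 := hb (y := -(ε / 2)) (by rw [Real.dist_eq, abs_lt]; constructor <;> linarith)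
  rw [hf.apply_combo, h0] at h1 h2
  nlinarith

/-- Two nonzero affine functions vanishing at a point which are nowhere near that point positive
simultaneously are negative multiples of each other. -/
theorem exists_eq_neg_mul (hf : IsRealAffine f) (hg : IsRealAffine g) {o : ℂ} (hfo : f o = 0)
    (hgo : g o = 0) (hf0 : ∃ z, f z ≠ 0) (hg0 : ∃ z, g z ≠ 0)
    (h : ∀ᶠ z in 𝓝 o, ¬ (0 < f z ∧ 0 < g z)) : ∃ κ : ℝ, 0 < κ ∧ ∀ z, g z = -κ * f z := by
  -- Both functions vanish at `o`, so their signs do not change along rays from `o`.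
  have key : ∀ z, ¬ (0 < f z ∧ 0 < g z) := by
    rintro z ⟨h1, h2⟩
    have hlim : Filter.Tendsto (fun t : ℝ => (1 - t : ℝ) * o + (t : ℝ) * z) (𝓝 0) (𝓝 o) := by
      have : Continuous (fun t : ℝ => ((1 - t : ℝ) : ℂ) * o + (t : ℝ) * z) := by fun_prop
      simpa using this.tendsto 0
    obtain ⟨ε, hε, hb⟩ := Metric.eventually_nhds_iff.1 (hlim.eventually h)
    have h3 := hb (y := ε / 2) (by rw [Real.dist_eq, abs_lt]; constructor <;> linarith)
    rw [hf.apply_combo, hg.apply_combo, hfo, hgo] at h3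
    apply h3
    constructor <;> nlinarith [mul_pos hε h1, mul_pos hε h2]
  obtain ⟨p, q, r, hf⟩ := hf
  obtain ⟨p', q', r', hg⟩ := hg
  have hf' : ∀ x y : ℝ, f (o + ⟨x, y⟩) = p * x + q * y := by
    intro x y
    rw [hf] at hfo ⊢
    simp only [Complex.add_re, Complex.add_im]
    linear_combination hfo
  have hg' : ∀ x y : ℝ, g (o + ⟨x, y⟩) = p' * x + q' * y := by
    intro x y
    rw [hg] at hgo ⊢
    simp only [Complex.add_re, Complex.add_im]
    linear_combination hgo
  have key' : ∀ x y : ℝ, ¬ (0 < p * x + q * y ∧ 0 < p' * x + q' * y) := by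
    intro x y
    rw [← hf', ← hg']
    exact key _
  have hz : ∀ z, f z = p * (z - o).re + q * (z - o).im := by
    intro z
    rw [← hf']
    congr 1
    apply Complex.ext <;> simp
  have hz' : ∀ z, g z = p' * (z - o).re + q' * (z - o).im := by
    intro z
    rw [← hg']
    congr 1
    apply Complex.ext <;> simp
  have hn : 0 < p ^ 2 + q ^ 2 := by
    obtain ⟨z, hz0⟩ := hf0
    by_contra hcon
    have h1 : p = 0 := by nlinarith [sq_nonneg p, sq_nonneg q]
    have h2 : q = 0 := by nlinarith [sq_nonneg p, sq_nonneg q]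
    apply hz0
    rw [hz, h1, h2]
    ring
  -- If the gradients were independent, both functions would be `1` at some point.
  have hc : p * q' - q * p' = 0 := by
    by_contra hc
    refine key' ((q' - q) / (p * q' - q * p')) ((p - p') / (p * q' - q * p')) ⟨?_, ?_⟩
    · have : p * ((q' - q) / (p * q' - q * p')) + q * ((p - p') / (p * q' - q * p')) = 1 := by
        rw [← mul_div_assoc, ← mul_div_assoc, ← add_div, div_eq_one_iff_eq hc]
        ring
      linarith
    · have : p' * ((q' - q) / (p * q' - q * p')) + q' * ((p - p') / (p * q' - q * p')) = 1 := by
        rw [← mul_div_assoc, ← mul_div_assoc, ← add_div, div_eq_one_iff_eq hc]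
        ring
      linarith
  -- Moving along the gradient of `f` shows that the factor is not positive.
  have hk : p * p' + q * q' ≤ 0 := by
    have := key' p q
    by_contra hcon
    exact this ⟨by nlinarith, by nlinarith⟩
  have e1 : p' = (p * p' + q * q') / (p ^ 2 + q ^ 2) * p := by
    field_simp
    linear_combination -q * hc
  have e2 : q' = (p * p' + q * q') / (p ^ 2 + q ^ 2) * q := by
    field_simp
    linear_combination p * hc
  have hk0 : p * p' + q * q' ≠ 0 := by
    intro h0
    rw [h0] at e1 e2
    obtain ⟨z, hz0⟩ := hg0
    apply hz0
    rw [hz', e1, e2]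
    ring
  refine ⟨-((p * p' + q * q') / (p ^ 2 + q ^ 2)), ?_, fun z => ?_⟩
  · have : p * p' + q * q' < 0 := lt_of_le_of_ne hk hk0
    rw [← neg_div]
    exact div_pos (by linarith) hn
  · rw [hz, hz']
    linear_combination (z - o).re * e1 + (z - o).im * e2

end IsRealAffine

namespace PlaneTriangle

variable (b : AffineBasis (Fin 3) ℝ ℂ)

theorem isRealAffine_coord (j : Fin 3) : IsRealAffine (b.coord j) := .of_affineMap _

theorem mem_iff {z : ℂ} : z ∈ convexHull ℝ (Set.range b) ↔ ∀ j, 0 ≤ b.coord j z := by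
  rw [b.convexHull_eq_nonneg_coord]
  rfl

theorem mem_interior_iff {z : ℂ} :
    z ∈ interior (convexHull ℝ (Set.range b)) ↔ ∀ j, 0 < b.coord j z := by
  rw [b.interior_convexHull]
  rfl

theorem coord_sum (k : Fin 3) (z : ℂ) :
    b.coord k z + b.coord (k + 1) z + b.coord (k + 2) z = 1 := by
  have := b.sum_coord_apply_eq_one z
  rw [Fin.sum_univ_three] at this
  fin_cases k <;> simp <;> linarith

theorem eq_combo (k : Fin 3) (z : ℂ) :
    z = (b.coord k z : ℂ) * b k + (b.coord (k + 1) z : ℂ) * b (k + 1)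
      + (b.coord (k + 2) z : ℂ) * b (k + 2) := by
  have := b.linear_combination_coord_eq_self z
  rw [Fin.sum_univ_three] at this
  simp only [Complex.real_smul] at this
  fin_cases k <;> simp <;> linear_combination -this

theorem coord_self (k : Fin 3) : b.coord k (b k) = 1 := b.coord_apply_eq k

theorem coord_vertex_ne {k l : Fin 3} (h : k ≠ l) : b.coord k (b l) = 0 := b.coord_apply_ne h

theorem vertex_mem (k : Fin 3) : b k ∈ convexHull ℝ (Set.range b) :=
  subset_convexHull _ _ ⟨k, rfl⟩

theorem fin3_cases (k l : Fin 3) : l = k ∨ l = k + 1 ∨ l = k + 2 := by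
  fin_cases k <;> fin_cases l <;> simp

theorem fin3_add_one_ne (k : Fin 3) : k + 1 ≠ k := by fin_cases k <;> simp

theorem fin3_add_two_ne (k : Fin 3) : k + 2 ≠ k := by fin_cases k <;> simp

theorem fin3_add_one_ne_add_two (k : Fin 3) : k + 1 ≠ k + 2 := by fin_cases k <;> simp

theorem mem_edge_iff (k : Fin 3) {z : ℂ} : z ∈ segment ℝ (b (k + 1)) (b (k + 2)) ↔
    z ∈ convexHull ℝ (Set.range b) ∧ b.coord k z = 0 := by
  constructor
  · rintro ⟨s, t, hs, ht, hst, rfl⟩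
    constructor
    · exact (convex_convexHull ℝ _) (vertex_mem b _) (vertex_mem b _) hs ht hst
    · have h := (isRealAffine_coord b k).apply_combo (b (k + 1)) (b (k + 2)) t
      rw [coord_vertex_ne b (fin3_add_one_ne k).symm,
        coord_vertex_ne b (fin3_add_two_ne k).symm] at h
      have hs' : s = 1 - t := by linarith
      rw [hs', Complex.real_smul, Complex.real_smul, h]
      ring
  · rintro ⟨hz, h0⟩
    rw [mem_iff] at hz
    have h1 := coord_sum b k z
    have h2 := eq_combo b k z
    rw [h0] at h1 h2
    refine ⟨b.coord (k + 1) z, b.coord (k + 2) z, hz _, hz _, by linarith, ?_⟩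
    rw [Complex.real_smul, Complex.real_smul]
    conv_rhs => rw [h2]
    simp

theorem eq_vertex_of_coord {k : Fin 3} {z : ℂ} (h1 : b.coord (k + 1) z = 0)
    (h2 : b.coord (k + 2) z = 0) : z = b k := by
  have h3 := coord_sum b k z
  have h4 := eq_combo b k z
  rw [h1, h2] at h3 h4
  have : b.coord k z = 1 := by linarith
  rw [this] at h4
  simpa using h4

/-- A point of a triangle which is not a vertex is interior or lies in the open edge opposite one
of the vertices. -/
theorem interior_or_edge {z : ℂ} (hz : z ∈ convexHull ℝ (Set.range b)) (hv : z ∉ Set.range b) :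
    z ∈ interior (convexHull ℝ (Set.range b)) ∨
      ∃ k, b.coord k z = 0 ∧ 0 < b.coord (k + 1) z ∧ 0 < b.coord (k + 2) z := by
  rw [mem_iff] at hz
  by_cases h : ∃ k, b.coord k z = 0
  · obtain ⟨k, hk⟩ := h
    right
    refine ⟨k, hk, lt_of_le_of_ne (hz _) fun h1 => hv ?_, lt_of_le_of_ne (hz _) fun h2 => hv ?_⟩
    · refine ⟨k + 2, (eq_vertex_of_coord b (k := k + 2) ?_ ?_).symm⟩
      · have : k + 2 + 1 = k := by fin_cases k <;> rfl
        rw [this, hk]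
      · have : k + 2 + 2 = k + 1 := by fin_cases k <;> rfl
        rw [this, ← h1]
    · refine ⟨k + 1, (eq_vertex_of_coord b (k := k + 1) ?_ ?_).symm⟩
      · have : k + 1 + 1 = k + 2 := by fin_cases k <;> rfl
        rw [this, ← h2]
      · have : k + 1 + 2 = k := by fin_cases k <;> rfl
        rw [this, hk]
  · left
    push Not at h
    rw [mem_interior_iff]
    exact fun j => lt_of_le_of_ne (hz j) (h j).symm

theorem notMem_range_of_coord {k : Fin 3} {z : ℂ} (h1 : 0 < b.coord (k + 1) z)
    (h2 : 0 < b.coord (k + 2) z) : z ∉ Set.range b := by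
  rintro ⟨l, rfl⟩
  rcases fin3_cases k l with rfl | rfl | rfl
  · rw [coord_vertex_ne b (fin3_add_one_ne _)] at h1
    exact lt_irrefl _ h1
  · rw [coord_vertex_ne b (fin3_add_one_ne_add_two _).symm] at h2
    exact lt_irrefl _ h2
  · rw [coord_vertex_ne b (fin3_add_one_ne_add_two _)] at h1
    exact lt_irrefl _ h1

theorem notMem_range_of_mem_interior {z : ℂ} (h : z ∈ interior (convexHull ℝ (Set.range b))) :
    z ∉ Set.range b := by
  rw [mem_interior_iff] at h
  exact notMem_range_of_coord b (k := 0) (h _) (h _)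

theorem continuous_coord (k : Fin 3) : Continuous (b.coord k) := (isRealAffine_coord b k).continuous

/-- Near a point of an open edge a triangle is a half-plane. -/
theorem eventually_mem_iff {k : Fin 3} {z : ℂ} (h1 : 0 < b.coord (k + 1) z)
    (h2 : 0 < b.coord (k + 2) z) :
    ∀ᶠ w in 𝓝 z, (w ∈ convexHull ℝ (Set.range b) ↔ 0 ≤ b.coord k w) ∧
      (w ∈ interior (convexHull ℝ (Set.range b)) ↔ 0 < b.coord k w) ∧
      0 < b.coord (k + 1) w ∧ 0 < b.coord (k + 2) w := by
  filter_upwards [(continuous_coord b _).continuousAt.eventually (lt_mem_nhds h1),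
    (continuous_coord b _).continuousAt.eventually (lt_mem_nhds h2)] with w hw1 hw2
  rw [mem_iff, mem_interior_iff]
  refine ⟨⟨fun h => h _, fun h l => ?_⟩, ⟨fun h => h _, fun h l => ?_⟩, hw1, hw2⟩
  · rcases fin3_cases k l with rfl | rfl | rfl
    exacts [h, hw1.le, hw2.le]
  · rcases fin3_cases k l with rfl | rfl | rfl
    exacts [h, hw1, hw2]

theorem isCompact : IsCompact (convexHull ℝ (Set.range b)) :=
  (Set.finite_range b).isCompact_convexHull ℝ

theorem closure_interior : closure (interior (convexHull ℝ (Set.range b)))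
    = convexHull ℝ (Set.range b) := by
  have h : (interior (convexHull ℝ (Set.range b))).Nonempty :=
    (interior_convexHull_nonempty_iff_affineSpan_eq_top).2 b.tot
  rw [(convex_convexHull ℝ _).closure_interior_eq_closure_of_nonempty_interior h]
  exact (isCompact b).isClosed.closure_eq

/-- The affine function with the same values at the vertices as `|z|²`, minus `|z|²`; that is, the
negative of the power of `z` with respect to the circumcircle. -/
noncomputable def negPower (z : ℂ) : ℝ := ∑ j, b.coord j z * Complex.normSq (b j) - Complex.normSq z

theorem negPower_vertex (k : Fin 3) : negPower b (b k) = 0 := by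
  rw [negPower, Finset.sum_eq_single k]
  · rw [coord_self]; ring
  · intro l _ h
    rw [coord_vertex_ne b h, zero_mul]
  · simp

theorem isRealAffine_negPower_add : IsRealAffine fun z => negPower b z + Complex.normSq z := by
  have : (fun z => negPower b z + Complex.normSq z) = fun z =>
      (Complex.normSq (b 0) * b.coord 0 z + Complex.normSq (b 1) * b.coord 1 z)
        + Complex.normSq (b 2) * b.coord 2 z := by
    funext z
    rw [negPower, Fin.sum_univ_three]
    ring
  rw [this]
  exact (((isRealAffine_coord b 0).const_mul _).add ((isRealAffine_coord b 1).const_mul _)).add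
    ((isRealAffine_coord b 2).const_mul _)

/-- The function `negPower`, pulled back by the half-dilation `z ↦ s z + t` and divided by the
square of its scale as befits a density, plus `|z|²`, which makes it affine. -/
noncomputable def pull (s : ℝ) (t : ℂ) (z : ℂ) : ℝ :=
  negPower b ((s : ℂ) * z + t) / s ^ 2 + Complex.normSq z

theorem isRealAffine_pull {s : ℝ} (hs : s ≠ 0) (t : ℂ) : IsRealAffine (pull b s t) := by
  have h := (isRealAffine_negPower_add b).comp_halfDilation s t
  obtain ⟨p, q, r, h⟩ := h
  refine ⟨p / s ^ 2 - 2 * t.re / s, q / s ^ 2 - 2 * t.im / s,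
    (r - Complex.normSq t) / s ^ 2, fun z => ?_⟩
  have h' : negPower b ((s : ℂ) * z + t) = p * z.re + q * z.im + r
      - Complex.normSq ((s : ℂ) * z + t) := by rw [← h]; ring
  rw [pull, h']
  simp only [Complex.normSq_apply, Complex.add_re, Complex.add_im, Complex.re_ofReal_mul,
    Complex.im_ofReal_mul]
  field_simp
  ring

end PlaneTriangle

/-! ### The incircle criterion -/

namespace PlaneTriangle

/-- The product of one side vector at the corner `p` of the triangle `u p v` with the conjugate of
the other one; its argument is, up to sign, the angle at `p`. -/
noncomputable def cornerProd (u p v : ℂ) : ℂ := (u - p) * (starRingEnd ℂ) (v - p)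

theorem cos_angle_mul (u p v : ℂ) :
    Real.cos (EuclideanGeometry.angle u p v) * (‖u - p‖ * ‖v - p‖) = (cornerProd u p v).re := by
  rw [EuclideanGeometry.angle, vsub_eq_sub, vsub_eq_sub,
    InnerProductGeometry.cos_angle_mul_norm_mul_norm, Complex.inner, cornerProd]
  simp
  ring

theorem sin_angle_mul (u p v : ℂ) :
    Real.sin (EuclideanGeometry.angle u p v) * (‖u - p‖ * ‖v - p‖) = |(cornerProd u p v).im| := by
  rw [EuclideanGeometry.angle, vsub_eq_sub, vsub_eq_sub,
    InnerProductGeometry.sin_angle_mul_norm_mul_norm, ← Real.sqrt_sq_eq_abs]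
  congr 1
  simp only [Complex.inner, cornerProd]
  simp
  ring

theorem angle_pos_of_im_ne_zero {u p v : ℂ} (h : (cornerProd u p v).im ≠ 0) :
    0 < EuclideanGeometry.angle u p v ∧ EuclideanGeometry.angle u p v < Real.pi := by
  have h1 := sin_angle_mul u p v
  have h2 : Real.sin (EuclideanGeometry.angle u p v) ≠ 0 := by
    intro h3
    rw [h3, zero_mul] at h1
    exact h (abs_eq_zero.1 h1.symm)
  refine ⟨lt_of_le_of_ne (EuclideanGeometry.angle_nonneg _ _ _) fun h3 => h2 ?_,
    lt_of_le_of_ne (EuclideanGeometry.angle_le_pi _ _ _) fun h3 => h2 ?_⟩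
  · rw [← h3, Real.sin_zero]
  · rw [h3, Real.sin_pi]

theorem norm_pos_of_im_ne_zero {u p v : ℂ} (h : (cornerProd u p v).im ≠ 0) :
    0 < ‖u - p‖ * ‖v - p‖ := by
  have h1 := sin_angle_mul u p v
  rcases (mul_nonneg (norm_nonneg (u - p)) (norm_nonneg (v - p))).eq_or_lt with h2 | h2
  · rw [← h2, mul_zero] at h1
    exact absurd (abs_eq_zero.1 h1.symm) h
  · exact h2

theorem sin_add_angle_mul {u v p q : ℂ} (h : (cornerProd u p v).im * (cornerProd u q v).im < 0) :
    Real.sin (EuclideanGeometry.angle u p v + EuclideanGeometry.angle u q v)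
      * ((‖u - p‖ * ‖v - p‖) * (‖u - q‖ * ‖v - q‖)) * |(cornerProd u q v).im|
      = - (cornerProd u q v).im *
        (cornerProd u p v * (starRingEnd ℂ) (cornerProd u q v)).im := by
  have e1 := cos_angle_mul u p v
  have e2 := sin_angle_mul u p v
  have e3 := cos_angle_mul u q v
  have e4 := sin_angle_mul u q v
  have : Real.sin (EuclideanGeometry.angle u p v + EuclideanGeometry.angle u q v)
      * ((‖u - p‖ * ‖v - p‖) * (‖u - q‖ * ‖v - q‖))
      = |(cornerProd u p v).im| * (cornerProd u q v).re
        + (cornerProd u p v).re * |(cornerProd u q v).im| := by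
    rw [Real.sin_add, ← e1, ← e2, ← e3, ← e4]
    ring
  rw [this, Complex.mul_im, Complex.conj_re, Complex.conj_im]
  rcases lt_trichotomy (cornerProd u q v).im 0 with h1 | h1 | h1
  · have h2 : 0 < (cornerProd u p v).im := by nlinarith
    rw [abs_of_neg h1, abs_of_pos h2]
    ring
  · rw [h1] at h
    simp at h
  · have h2 : (cornerProd u p v).im < 0 := by nlinarith
    rw [abs_of_pos h1, abs_of_neg h2]
    ring

theorem sin_sub_angle_mul {u v p q : ℂ} (h : 0 < (cornerProd u p v).im * (cornerProd u q v).im) :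
    Real.sin (EuclideanGeometry.angle u p v - EuclideanGeometry.angle u q v)
      * ((‖u - p‖ * ‖v - p‖) * (‖u - q‖ * ‖v - q‖)) * |(cornerProd u q v).im|
      = (cornerProd u q v).im *
        (cornerProd u p v * (starRingEnd ℂ) (cornerProd u q v)).im := by
  have e1 := cos_angle_mul u p v
  have e2 := sin_angle_mul u p v
  have e3 := cos_angle_mul u q v
  have e4 := sin_angle_mul u q v
  have : Real.sin (EuclideanGeometry.angle u p v - EuclideanGeometry.angle u q v)
      * ((‖u - p‖ * ‖v - p‖) * (‖u - q‖ * ‖v - q‖))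
      = |(cornerProd u p v).im| * (cornerProd u q v).re
        - (cornerProd u p v).re * |(cornerProd u q v).im| := by
    rw [Real.sin_sub, ← e1, ← e2, ← e3, ← e4]
    ring
  rw [this, Complex.mul_im, Complex.conj_re, Complex.conj_im]
  rcases lt_trichotomy (cornerProd u q v).im 0 with h1 | h1 | h1
  · have h2 : (cornerProd u p v).im < 0 := by nlinarith
    rw [abs_of_neg h1, abs_of_neg h2]
    ring
  · rw [h1] at h
    simp at h
  · have h2 : 0 < (cornerProd u p v).im := by nlinarith
    rw [abs_of_pos h1, abs_of_pos h2]
    ring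

variable (b : AffineBasis (Fin 3) ℝ ℂ)

theorem cornerProd_im (k : Fin 3) (p : ℂ) : (cornerProd (b (k + 1)) p (b (k + 2))).im
    = b.coord k p * (cornerProd (b (k + 1)) (b k) (b (k + 2))).im := by
  have h1 := coord_sum b k p
  have h2 := eq_combo b k p
  have h3 : b.coord k p = 1 - b.coord (k + 1) p - b.coord (k + 2) p := by linarith
  rw [h3] at h2 ⊢
  have h4 := congrArg Complex.re h2
  have h5 := congrArg Complex.im h2
  simp only [Complex.add_re, Complex.add_im, Complex.re_ofReal_mul, Complex.im_ofReal_mul] at h4 h5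
  simp only [cornerProd, Complex.mul_im, Complex.conj_re, Complex.conj_im, Complex.sub_re,
    Complex.sub_im]
  rw [h4, h5]
  ring

theorem negPower_mul_im (k : Fin 3) (p : ℂ) :
    negPower b p * (cornerProd (b (k + 1)) (b k) (b (k + 2))).im
      = (cornerProd (b (k + 1)) p (b (k + 2)) *
          (starRingEnd ℂ) (cornerProd (b (k + 1)) (b k) (b (k + 2)))).im := by
  have h0 : negPower b p = b.coord k p * Complex.normSq (b k)
      + b.coord (k + 1) p * Complex.normSq (b (k + 1))
      + b.coord (k + 2) p * Complex.normSq (b (k + 2)) - Complex.normSq p := by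
    rw [negPower, Fin.sum_univ_three]
    fin_cases k <;> simp <;> ring
  have h1 := coord_sum b k p
  have h2 := eq_combo b k p
  have h3 : b.coord k p = 1 - b.coord (k + 1) p - b.coord (k + 2) p := by linarith
  rw [h0]
  rw [h3] at h2 ⊢
  have h4 := congrArg Complex.re h2
  have h5 := congrArg Complex.im h2
  simp only [Complex.add_re, Complex.add_im, Complex.re_ofReal_mul, Complex.im_ofReal_mul] at h4 h5
  simp only [cornerProd, Complex.mul_im, Complex.mul_re, Complex.conj_re, Complex.conj_im,
    Complex.sub_re, Complex.sub_im, Complex.normSq_apply]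
  rw [h4, h5]
  ring

theorem cornerProd_vertex_im_ne_zero (k : Fin 3) :
    (cornerProd (b (k + 1)) (b k) (b (k + 2))).im ≠ 0 := by
  intro h
  have h1 : ∀ p, (cornerProd (b (k + 1)) p (b (k + 2))).im = 0 := by
    intro p
    rw [cornerProd_im, h, mul_zero]
  have h2 : b (k + 1) ≠ b (k + 2) := fun h => fin3_add_one_ne_add_two k (b.ind.injective h)
  apply h2
  have h3 := h1 (b (k + 1) - (b (k + 2) - b (k + 1)) * Complex.I)
  simp only [cornerProd, Complex.mul_im, Complex.mul_re, Complex.conj_re, Complex.conj_im,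
    Complex.sub_re, Complex.sub_im, Complex.I_re, Complex.I_im] at h3
  have h4 : ((b (k + 2)).re - (b (k + 1)).re) ^ 2 + ((b (k + 2)).im - (b (k + 1)).im) ^ 2 = 0 := by
    linear_combination h3
  have h5 := sq_nonneg ((b (k + 2)).re - (b (k + 1)).re)
  have h6 := sq_nonneg ((b (k + 2)).im - (b (k + 1)).im)
  apply Complex.ext
  · linarith [pow_eq_zero_iff (two_ne_zero) |>.1
      (by linarith : ((b (k + 2)).re - (b (k + 1)).re) ^ 2 = 0)]
  · linarith [pow_eq_zero_iff (two_ne_zero) |>.1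
      (by linarith : ((b (k + 2)).im - (b (k + 1)).im) ^ 2 = 0)]

/-- The incircle criterion: the sign of the power of a point `p` beyond an edge with respect to the
circumcircle is the sign of `sin` of the sum of the two angles opposite that edge. -/
theorem exists_negPower_eq (k : Fin 3) {p : ℂ} (hp : b.coord k p < 0) :
    ∃ K : ℝ, 0 < K ∧ negPower b p = -K * Real.sin (EuclideanGeometry.angle (b (k + 1)) p (b (k + 2))
      + EuclideanGeometry.angle (b (k + 1)) (b k) (b (k + 2))) := by
  have h1 := cornerProd_vertex_im_ne_zero b k
  have h2 := cornerProd_im b k p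
  have h3 := negPower_mul_im b k p
  set Q := cornerProd (b (k + 1)) (b k) (b (k + 2)) with hQ
  set P := cornerProd (b (k + 1)) p (b (k + 2)) with hP
  have h4 : 0 < Q.im ^ 2 := by positivity
  have h5 : P.im * Q.im < 0 := by rw [h2]; nlinarith
  have h6 := sin_add_angle_mul h5
  have h7 : P.im ≠ 0 := fun h => by rw [h] at h5; simp at h5
  have h8 := norm_pos_of_im_ne_zero h7
  have h9 := norm_pos_of_im_ne_zero h1
  rw [← hQ, ← hP, ← h3] at h6
  refine ⟨(‖b (k + 1) - p‖ * ‖b (k + 2) - p‖ * (‖b (k + 1) - b k‖ * ‖b (k + 2) - b k‖)) * |Q.im|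
    / Q.im ^ 2, div_pos (mul_pos (mul_pos h8 h9) (abs_pos.2 h1)) h4, ?_⟩
  field_simp
  linear_combination h6

theorem angle_lt_pi_of_coord_ne {k : Fin 3} {p : ℂ} (hp : b.coord k p ≠ 0) :
    0 < EuclideanGeometry.angle (b (k + 1)) p (b (k + 2)) ∧
    EuclideanGeometry.angle (b (k + 1)) p (b (k + 2)) < Real.pi := by
  apply angle_pos_of_im_ne_zero
  rw [cornerProd_im]
  exact mul_ne_zero hp (cornerProd_vertex_im_ne_zero b k)

theorem angle_vertex_pos_lt (k : Fin 3) :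
    0 < EuclideanGeometry.angle (b (k + 1)) (b k) (b (k + 2)) ∧
    EuclideanGeometry.angle (b (k + 1)) (b k) (b (k + 2)) < Real.pi :=
  angle_pos_of_im_ne_zero (cornerProd_vertex_im_ne_zero b k)

theorem negPower_nonpos (k : Fin 3) {p : ℂ} (hp : b.coord k p < 0)
    (h : EuclideanGeometry.angle (b (k + 1)) p (b (k + 2))
      + EuclideanGeometry.angle (b (k + 1)) (b k) (b (k + 2)) ≤ Real.pi) : negPower b p ≤ 0 := by
  obtain ⟨K, hK, he⟩ := exists_negPower_eq b k hp
  have := Real.sin_nonneg_of_nonneg_of_le_pi (add_nonneg (EuclideanGeometry.angle_nonneg _ _ _)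
    (EuclideanGeometry.angle_nonneg _ _ _)) h
  rw [he]
  nlinarith

theorem negPower_neg (k : Fin 3) {p : ℂ} (hp : b.coord k p < 0)
    (h : EuclideanGeometry.angle (b (k + 1)) p (b (k + 2))
      + EuclideanGeometry.angle (b (k + 1)) (b k) (b (k + 2)) < Real.pi) : negPower b p < 0 := by
  obtain ⟨K, hK, he⟩ := exists_negPower_eq b k hp
  have := Real.sin_pos_of_pos_of_lt_pi (add_pos (angle_lt_pi_of_coord_ne b hp.ne).1
    (angle_vertex_pos_lt b k).1) h
  rw [he]
  nlinarith

theorem negPower_eq_zero (k : Fin 3) {p : ℂ} (hp : b.coord k p < 0)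
    (h : EuclideanGeometry.angle (b (k + 1)) p (b (k + 2))
      + EuclideanGeometry.angle (b (k + 1)) (b k) (b (k + 2)) = Real.pi) : negPower b p = 0 := by
  obtain ⟨K, hK, he⟩ := exists_negPower_eq b k hp
  rw [he, h, Real.sin_pi, mul_zero]

/-- Inscribed angles over the same chord, on the same side of it, are equal. -/
theorem angle_eq_of_negPower_eq_zero (k : Fin 3) {p : ℂ} (hp : 0 < b.coord k p)
    (h : negPower b p = 0) : EuclideanGeometry.angle (b (k + 1)) p (b (k + 2))
      = EuclideanGeometry.angle (b (k + 1)) (b k) (b (k + 2)) := by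
  have h1 := cornerProd_vertex_im_ne_zero b k
  have h2 := cornerProd_im b k p
  have h3 := negPower_mul_im b k p
  rw [h, zero_mul] at h3
  have h4 : 0 < (cornerProd (b (k + 1)) (b k) (b (k + 2))).im ^ 2 := by positivity
  have h5 : 0 < (cornerProd (b (k + 1)) p (b (k + 2))).im *
      (cornerProd (b (k + 1)) (b k) (b (k + 2))).im := by rw [h2]; nlinarith
  have h6 := sin_sub_angle_mul h5
  have h7 : (cornerProd (b (k + 1)) p (b (k + 2))).im ≠ 0 := fun h => by rw [h] at h5; simp at h5
  rw [← h3, mul_zero] at h6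
  have h8 := (mul_pos (mul_pos (norm_pos_of_im_ne_zero h7) (norm_pos_of_im_ne_zero h1))
    (abs_pos.2 h1)).ne'
  rw [mul_assoc] at h6
  have h9 := (mul_eq_zero.1 h6).resolve_right h8
  have ha := angle_lt_pi_of_coord_ne b hp.ne'
  have hb := angle_vertex_pos_lt b k
  have := (Real.sin_eq_zero_iff_of_lt_of_lt (by linarith) (by linarith)).1 h9
  linarith

end PlaneTriangle

/-! ### Local structure of a triangulation near a regular point -/

namespace PlaneTriangle

variable (b : AffineBasis (Fin 3) ℝ ℂ)

/-- The edge opposite the vertex `k`, without its endpoints. -/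
def openEdge (k : Fin 3) : Set ℂ :=
  {z | b.coord k z = 0 ∧ 0 < b.coord (k + 1) z ∧ 0 < b.coord (k + 2) z}

theorem openEdge_subset (k : Fin 3) : openEdge b k ⊆ convexHull ℝ (Set.range b) := by
  rintro z ⟨h0, h1, h2⟩
  exact ((eventually_mem_iff b h1 h2).self_of_nhds.1).2 h0.ge

theorem notMem_range_of_mem_openEdge {k : Fin 3} {z : ℂ} (h : z ∈ openEdge b k) :
    z ∉ Set.range b := notMem_range_of_coord b h.2.1 h.2.2

theorem convex_openEdge (k : Fin 3) : Convex ℝ (openEdge b k) := by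
  rintro x ⟨hx0, hx1, hx2⟩ y ⟨hy0, hy1, hy2⟩ s t hs ht hst
  have hs' : s = 1 - t := by linarith
  subst hs'
  simp only [Complex.real_smul]
  refine ⟨?_, ?_, ?_⟩
  · rw [(isRealAffine_coord b _).apply_combo, hx0, hy0]; ring
  · rw [(isRealAffine_coord b _).apply_combo]
    rcases hs.eq_or_lt with h | h
    · have : t = 1 := by linarith
      subst this
      simpa using hy1
    · have := mul_pos h hx1
      have := mul_nonneg ht hy1.le
      linarith
  · rw [(isRealAffine_coord b _).apply_combo]
    rcases hs.eq_or_lt with h | h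
    · have : t = 1 := by linarith
      subst this
      simpa using hy2
    · have := mul_pos h hx2
      have := mul_nonneg ht hy2.le
      linarith

theorem combo_mem_openEdge (k : Fin 3) {t : ℝ} (h0 : 0 < t) (h1 : t < 1) :
    ((1 - t : ℝ) : ℂ) * b (k + 1) + (t : ℂ) * b (k + 2) ∈ openEdge b k := by
  refine ⟨?_, ?_, ?_⟩
  · rw [(isRealAffine_coord b _).apply_combo, coord_vertex_ne b (fin3_add_one_ne k).symm,
      coord_vertex_ne b (fin3_add_two_ne k).symm]
    ring
  · rw [(isRealAffine_coord b _).apply_combo, coord_self,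
      coord_vertex_ne b (fin3_add_one_ne_add_two k)]
    linarith
  · rw [(isRealAffine_coord b _).apply_combo, coord_self,
      coord_vertex_ne b (fin3_add_one_ne_add_two k).symm]
    linarith

/-- The endpoints of an edge are limits of points of the open edge. -/
theorem endpoint_mem_closure (k : Fin 3) :
    b (k + 1) ∈ closure (openEdge b k) ∧ b (k + 2) ∈ closure (openEdge b k) := by
  have hc : Continuous fun t : ℝ => ((1 - t : ℝ) : ℂ) * b (k + 1) + (t : ℂ) * b (k + 2) := by
    fun_prop
  have h : ∀ t ∈ Set.Ioo (0 : ℝ) 1, ((1 - t : ℝ) : ℂ) * b (k + 1) + (t : ℂ) * b (k + 2)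
      ∈ openEdge b k := fun t ht => combo_mem_openEdge b k ht.1 ht.2
  have hcl := closure_Ioo (zero_ne_one (α := ℝ))
  constructor
  · have := map_mem_closure hc (x := 0) (by rw [hcl]; exact ⟨le_rfl, zero_le_one⟩) h
    simpa using this
  · have := map_mem_closure hc (x := 1) (by rw [hcl]; exact ⟨zero_le_one, le_rfl⟩) h
    simpa using this

theorem vertex_ne {k l : Fin 3} (h : k ≠ l) : b k ≠ b l := fun h' => h (b.ind.injective h')

/-- A property that holds near a point of a triangle holds at another point of the triangle. -/
theorem exists_ne_of_eventually {z : ℂ} (hz : z ∈ convexHull ℝ (Set.range b)) {p : ℂ → Prop}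
    (h : ∀ᶠ w in 𝓝[convexHull ℝ (Set.range b)] z, p w) :
    ∃ w ∈ convexHull ℝ (Set.range b), w ≠ z ∧ p w := by
  obtain ⟨k, hk⟩ : ∃ k, b k ≠ z := by
    by_contra hcon
    push Not at hcon
    exact vertex_ne b (zero_ne_one (α := Fin 3)) ((hcon 0).trans (hcon 1).symm)
  have hlim : Filter.Tendsto (fun t : ℝ => ((1 - t : ℝ) : ℂ) * z + (t : ℝ) * b k) (𝓝[>] 0)
      (𝓝[convexHull ℝ (Set.range b)] z) := by
    refine tendsto_nhdsWithin_iff.2 ⟨?_, ?_⟩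
    · have : Continuous (fun t : ℝ => ((1 - t : ℝ) : ℂ) * z + (t : ℝ) * b k) := by fun_prop
      have h2 := this.tendsto 0
      simp only [sub_zero, Complex.ofReal_one, one_mul, Complex.ofReal_zero, zero_mul,
        add_zero] at h2
      exact h2.mono_left nhdsWithin_le_nhds
    · filter_upwards [Ioo_mem_nhdsGT (zero_lt_one (α := ℝ))] with t ht
      have := (convex_convexHull ℝ (Set.range b)) hz (vertex_mem b k) (a := 1 - t) (b := t)
        (by linarith [ht.2]) ht.1.le (by ring)
      simpa only [Complex.real_smul] using this
  obtain ⟨t, ⟨ht1, ht2⟩, ht0⟩ := (((hlim.eventually h).and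
    (hlim.eventually self_mem_nhdsWithin)).and self_mem_nhdsWithin).exists
  refine ⟨_, ht2, ?_, ht1⟩
  intro heq
  have : (t : ℂ) * (b k - z) = 0 := by
    push_cast at heq
    linear_combination heq
  rcases mul_eq_zero.1 this with h1 | h1
  · exact (ne_of_gt ht0) (by exact_mod_cast h1)
  · exact hk (sub_eq_zero.1 h1)

theorem angle_halfDilation {s : ℝ} (hs : s ≠ 0) (t x y z : ℂ) :
    EuclideanGeometry.angle ((s : ℂ) * x + t) ((s : ℂ) * y + t) ((s : ℂ) * z + t)
      = EuclideanGeometry.angle x y z := by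
  rw [EuclideanGeometry.angle, EuclideanGeometry.angle]
  have h1 : ((s : ℂ) * x + t) -ᵥ ((s : ℂ) * y + t) = s • (x -ᵥ y) := by
    simp only [vsub_eq_sub, Complex.real_smul]; ring
  have h2 : ((s : ℂ) * z + t) -ᵥ ((s : ℂ) * y + t) = s • (z -ᵥ y) := by
    simp only [vsub_eq_sub, Complex.real_smul]; ring
  rw [h1, h2, InnerProductGeometry.angle_smul_smul hs]

end PlaneTriangle

/-- For a continuous map on a compact set, a property that holds near all points of the fibre over
`x` holds on all fibres over points near `x`. -/
theorem IsCompact.eventually_fibre {Y X : Type*} [TopologicalSpace Y] [TopologicalSpace X]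
    [T2Space X] {K : Set Y} (hK : IsCompact K) {f : Y → X} (hf : ContinuousOn f K) {x : X}
    {p : Y → Prop} (h : ∀ w ∈ K, f w = x → ∀ᶠ w' in 𝓝[K] w, p w') :
    ∀ᶠ y in 𝓝 x, ∀ w ∈ K, f w = y → p w := by
  by_contra hcon
  have hF : (Filter.comap f (𝓝 x) ⊓ Filter.principal {w | w ∈ K ∧ ¬ p w}).NeBot := by
    rw [← Filter.frequently_mem_iff_neBot, Filter.frequently_comap]
    refine (Filter.not_eventually.1 hcon).mono fun y hy => ?_
    push Not at hy
    obtain ⟨w, hw, rfl, hp⟩ := hy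
    exact ⟨w, rfl, hw, hp⟩
  set F := Filter.comap f (𝓝 x) ⊓ Filter.principal {w | w ∈ K ∧ ¬ p w} with hFdef
  have hFK : F ≤ Filter.principal K :=
    inf_le_right.trans (Filter.principal_mono.2 fun w hw => hw.1)
  obtain ⟨w, hw, hcl⟩ := hK hFK
  have hcl' : (𝓝[K] w ⊓ F).NeBot := by
    have : 𝓝[K] w ⊓ F = 𝓝 w ⊓ F := by
      rw [nhdsWithin, inf_assoc, inf_eq_right.2 hFK]
    rw [this]
    exact hcl
  have h1 : Filter.Tendsto f (𝓝[K] w ⊓ F) (𝓝 (f w)) := (hf w hw).mono_left inf_le_left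
  have h2 : Filter.Tendsto f (𝓝[K] w ⊓ F) (𝓝 x) :=
    Filter.tendsto_comap.mono_left (inf_le_right.trans inf_le_left)
  have h3 := h w hw (tendsto_nhds_unique h1 h2)
  have h4 : ∀ᶠ w' in F, ¬ p w' := by
    have : ∀ᶠ w' in Filter.principal {w | w ∈ K ∧ ¬ p w}, ¬ p w' :=
      Filter.eventually_principal.2 fun w hw => hw.2
    exact this.filter_mono inf_le_right
  obtain ⟨w', h5, h6⟩ := ((h3.filter_mono inf_le_left).and (h4.filter_mono inf_le_right) :
    ∀ᶠ w' in 𝓝[K] w ⊓ F, p w' ∧ ¬ p w').exists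
  exact h6 h5

/-- In the chart `φ` of the target, the map `f` on `D` is near `w` the half-dilation
`z ↦ a z + b`. -/
def LocalForm {X : Type*} [TopologicalSpace X] (φ : OpenPartialHomeomorph X ℂ) (D : Set ℂ)
    (f : ℂ → X) (w : ℂ) (a : ℝ) (b : ℂ) : Prop :=
  a ≠ 0 ∧ f w ∈ φ.source ∧ ∀ᶠ z in 𝓝[D] w, f z ∈ φ.source ∧ φ (f z) = (a : ℂ) * z + b

namespace LocalForm

variable {X : Type*} [TopologicalSpace X] {φ : OpenPartialHomeomorph X ℂ} {D : Set ℂ} {f : ℂ → X}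
  {w : ℂ} {a : ℝ} {b : ℂ}

theorem apply_eq (h : LocalForm φ D f w a b) (hw : w ∈ D) : φ (f w) = (a : ℂ) * w + b :=
  (h.2.2.self_of_nhdsWithin hw).2

theorem inv_eq (h : LocalForm φ D f w a b) (hw : w ∈ D) : (φ (f w) - b) / a = w := by
  have ha : (a : ℂ) ≠ 0 := by exact_mod_cast h.1
  rw [h.apply_eq hw]
  field_simp
  ring

theorem eventually_localForm (h : LocalForm φ D f w a b) :
    ∀ᶠ z in 𝓝[D] w, LocalForm φ D f z a b := by
  filter_upwards [eventually_eventually_nhdsWithin.2 h.2.2, h.2.2] with z hz hz'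
  exact ⟨h.1, hz'.1, hz⟩

theorem eq_of_eventually_tri {B : AffineBasis (Fin 3) ℝ ℂ} {a' : ℝ} {b' : ℂ}
    (hw : w ∈ convexHull ℝ (Set.range B))
    (h : LocalForm φ (convexHull ℝ (Set.range B)) f w a b)
    (h' : LocalForm φ (convexHull ℝ (Set.range B)) f w a' b') : a = a' ∧ b = b' := by
  obtain ⟨z, hz, hzw, e1, e2⟩ := PlaneTriangle.exists_ne_of_eventually B hw (h.2.2.and h'.2.2)
  have e3 := e1.2.symm.trans e2.2
  have e4 := (h.apply_eq hw).symm.trans (h'.apply_eq hw)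
  have e5 : ((a : ℂ) - a') * (z - w) = 0 := by linear_combination e3 - e4
  have e6 : (a : ℂ) = a' := by
    rcases mul_eq_zero.1 e5 with e | e
    · exact sub_eq_zero.1 e
    · exact absurd (sub_eq_zero.1 e) hzw
  refine ⟨by exact_mod_cast e6, ?_⟩
  rw [e6] at e4
  exact add_left_cancel e4

theorem tendsto_inv (h : LocalForm φ D f w a b) (hw : w ∈ D) :
    Filter.Tendsto (fun y : ℂ => (y - b) / a) (𝓝 (φ (f w))) (𝓝 w) := by
  have : Continuous fun y : ℂ => (y - b) / a := by fun_prop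
  have h2 := this.tendsto (φ (f w))
  rwa [h.inv_eq hw] at h2

theorem eventually_inv (h : LocalForm φ D f w a b) (hw : w ∈ D) :
    ∀ᶠ y in 𝓝 (φ (f w)), y ∈ φ.target ∧ ((y - b) / a ∈ D → f ((y - b) / a) = φ.symm y) := by
  have ha : (a : ℂ) ≠ 0 := by exact_mod_cast h.1
  filter_upwards [φ.open_target.mem_nhds (φ.map_source h.2.1),
    (h.tendsto_inv hw).eventually (eventually_nhdsWithin_iff.1 h.2.2)] with y hy hy'
  refine ⟨hy, fun hD => ?_⟩
  obtain ⟨h1, h2⟩ := hy' hD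
  rw [← φ.left_inv h1, h2]
  congr 1
  field_simp
  ring

end LocalForm

namespace HalfDilationStructure

variable {X : Type*} [TopologicalSpace X] {S : HalfDilationStructure X}

theorem exists_localForm {D : Set ℂ} {f : ℂ → X} {w : ℂ} (hw : w ∈ D)
    (h : IsHalfDilationAt S.atlas (fun z : {z : ℂ // z ∈ D} => f z) ⟨w, hw⟩)
    {φ : OpenPartialHomeomorph X ℂ} (hφ : φ ∈ S.atlas) (hs : f w ∈ φ.source) :
    ∃ a b, LocalForm φ D f w a b := by
  obtain ⟨ψ, hψ, hs', g, ⟨a, b, ha, hg⟩, hev⟩ := h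
  obtain ⟨k, ⟨a', b', ha', hk⟩, hev'⟩ := S.compatible ψ hψ φ hφ (f w) ⟨hs', hs⟩
  have hev2 : ∀ᶠ z in 𝓝[D] w, f z ∈ ψ.source ∧ ψ (f z) = g z :=
    (eventually_nhds_subtype_iff D ⟨w, hw⟩ (fun z => f z ∈ ψ.source ∧ ψ (f z) = g z)).1 hev
  have hgw := (hev2.self_of_nhdsWithin hw).2
  have hcont : Filter.Tendsto f (𝓝[D] w) (𝓝 (f w)) := by
    have h1 : Filter.Tendsto (fun z => ψ.symm (g z)) (𝓝[D] w) (𝓝 (ψ.symm (g w))) := by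
      have hgc : Continuous g := by
        have : g = fun z => (a : ℂ) * z + b := funext hg
        rw [this]
        fun_prop
      have h2 : ContinuousAt ψ.symm (g w) := by
        rw [← hgw]
        exact ψ.symm.continuousAt (ψ.map_source hs')
      exact (h2.tendsto.comp (hgc.tendsto w)).mono_left nhdsWithin_le_nhds
    rw [← hgw, ψ.left_inv hs'] at h1
    refine h1.congr' ?_
    filter_upwards [hev2] with z hz
    rw [← hz.2, ψ.left_inv hz.1]
  refine ⟨a' * a, a' * b + b', mul_ne_zero ha' ha, hs, ?_⟩
  filter_upwards [hev2, hcont.eventually hev', hcont.eventually (φ.open_source.mem_nhds hs)]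
    with z h1 h2 h3
  refine ⟨h3, ?_⟩
  rw [h2, h1.2, hg, hk]
  push_cast
  ring

namespace Triangulation

/-- The vertices of a plane triangle of a triangulation, as an affine basis of the plane. -/
def basis (T : S.Triangulation) (i : Fin T.n) : AffineBasis (Fin 3) ℝ ℂ where
  toFun := T.vert i
  ind' := T.affineIndependent i
  tot' := by
    rw [(T.affineIndependent i).affineSpan_eq_top_iff_card_eq_finrank_add_one]
    simp [Complex.finrank_real_complex]

theorem coe_basis (T : S.Triangulation) (i : Fin T.n) : ⇑(T.basis i) = T.vert i := rfl

/-- The `i`-th plane triangle. -/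
def tri (T : S.Triangulation) (i : Fin T.n) : Set ℂ := convexHull ℝ (Set.range (T.basis i))

variable (T : S.Triangulation) {T' : S.Triangulation}

theorem continuousOn_tri (i : Fin T.n) : ContinuousOn (T.map i) (T.tri i) := T.continuousOn i

theorem notMem_range_of_notMem_sing {i : Fin T.n} {w : ℂ} (h : T.map i w ∉ S.sing) :
    w ∉ Set.range (T.basis i) := by
  rintro ⟨j, rfl⟩
  exact h (T.map_vert_mem i j)

theorem notMem_sing {i : Fin T.n} {w : ℂ} (hw : w ∈ T.tri i) (h : w ∉ Set.range (T.basis i)) :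
    T.map i w ∉ S.sing := T.map_notMem i w hw h

theorem exists_localForm {i : Fin T.n} {w : ℂ} (hw : w ∈ T.tri i) (h : T.map i w ∉ S.sing)
    {φ : OpenPartialHomeomorph X ℂ} (hφ : φ ∈ S.atlas) (hs : T.map i w ∈ φ.source) :
    ∃ a b, LocalForm φ (T.tri i) (T.map i) w a b :=
  HalfDilationStructure.exists_localForm hw
    (T.isHalfDilationAt i ⟨w, hw⟩ (T.notMem_range_of_notMem_sing h)) hφ hs

/-- The half-dilation `z ↦ s z + t` from the plane of the `i`-th triangle of `T` to the plane of
the `j`-th triangle of `T'` is, near `w`, the change of coordinates of the surface. -/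
def IsTransition (T T' : S.Triangulation) (i : Fin T.n) (j : Fin T'.n) (s : ℝ) (t : ℂ) (w : ℂ) :
    Prop :=
  s ≠ 0 ∧ w ∈ T.tri i ∧ (s : ℂ) * w + t ∈ T'.tri j ∧ T.map i w = T'.map j ((s : ℂ) * w + t) ∧
    ∃ φ ∈ S.atlas, ∃ a b, LocalForm φ (T.tri i) (T.map i) w (a * s) (a * t + b) ∧
      LocalForm φ (T'.tri j) (T'.map j) ((s : ℂ) * w + t) a b

variable {T}

/-- Near a regular point, two different triangles, or parts of the same triangle, do not overlap. -/
theorem eventually_not_interior {i j : Fin T.n} {w w' : ℂ} (hne : i = j → w ≠ w')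
    (hw : w ∈ T.tri i) (hw' : w' ∈ T.tri j) (hx : T.map i w = T.map j w')
    {φ : OpenPartialHomeomorph X ℂ} {a a' : ℝ} {b b' : ℂ}
    (h : LocalForm φ (T.tri i) (T.map i) w a b) (h' : LocalForm φ (T.tri j) (T.map j) w' a' b') :
    ∀ᶠ y in 𝓝 (φ (T.map i w)),
      ¬ ((y - b) / a ∈ interior (T.tri i) ∧ (y - b') / a' ∈ interior (T.tri j)) := by
  have H := h.eventually_inv hw
  have H' := h'.eventually_inv hw'
  rw [← hx] at H'
  by_cases hij : i = j
  · -- The same triangle: `w` and `w'` have disjoint neighbourhoods, and interior points have only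
    -- one preimage in the triangle.
    subst hij
    obtain ⟨U, V, hU, hV, hwU, hwV, hUV⟩ := t2_separation (hne rfl)
    have t1 := h.tendsto_inv hw
    have t2 := h'.tendsto_inv hw'
    rw [← hx] at t2
    filter_upwards [H, H', t1.eventually (hU.mem_nhds hwU), t2.eventually (hV.mem_nhds hwV)]
      with y h1 h2 h3 h4
    rintro ⟨h5, h6⟩
    have h7 := (h1.2 (interior_subset h5)).trans (h2.2 (interior_subset h6)).symm
    have h8 := T.injOn_interior i h5 h6 h7
    rw [h8] at h3
    exact Set.disjoint_left.1 hUV h3 h4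
  · -- Different triangles: an interior point of the plane triangle is mapped to the interior of
    -- the face, since the parametrization is a local homeomorphism there.
    have key : ∀ (i : Fin T.n) (w : ℂ) (a : ℝ) (b y : ℂ), (∀ᶠ y' in 𝓝 y, y' ∈ φ.target ∧
        ((y' - b) / a ∈ T.tri i → T.map i ((y' - b) / a) = φ.symm y')) →
        (y - b) / a ∈ interior (T.tri i) → φ.symm y ∈ interior (T.face i) := by
      intro i w a b y hy hin
      have hyt := hy.self_of_nhds.1
      rw [mem_interior_iff_mem_nhds]
      have hc : Filter.Tendsto (fun y' : ℂ => (y' - b) / a) (𝓝 y) (𝓝 ((y - b) / a)) := by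
        have : Continuous fun y : ℂ => (y - b) / a := by fun_prop
        exact this.tendsto y
      have h1 := hy.and (hc.eventually (isOpen_interior.mem_nhds hin))
      have h2 : Filter.Tendsto φ (𝓝 (φ.symm y)) (𝓝 y) := by
        have := φ.continuousAt (φ.map_target hyt)
        rwa [ContinuousAt, φ.right_inv hyt] at this
      filter_upwards [h2.eventually h1, φ.open_source.mem_nhds (φ.map_target hyt)] with x hx hxs
      have h3 := hx.1.2 (interior_subset hx.2)
      rw [φ.left_inv hxs] at h3
      exact ⟨_, interior_subset hx.2, h3⟩
    filter_upwards [eventually_eventually_nhds.2 H, eventually_eventually_nhds.2 H'] with y h1 h2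
    rintro ⟨h3, h4⟩
    exact Set.disjoint_left.1 (T.disjoint_interior i j hij) (key i w a b y h1 h3)
      (key j w' a' b' y h2 h4)

/-- Two different points over the same regular point lie on open edges, and the two triangles
locally are the two sides of a line. -/
theorem exists_edge_coords {i j : Fin T.n} {w w' : ℂ} (hne : i = j → w ≠ w')
    (hw : w ∈ T.tri i) (hw' : w' ∈ T.tri j) (hx : T.map i w = T.map j w')
    (hs : T.map i w ∉ S.sing) {φ : OpenPartialHomeomorph X ℂ} {a a' : ℝ} {b b' : ℂ}
    (h : LocalForm φ (T.tri i) (T.map i) w a b) (h' : LocalForm φ (T.tri j) (T.map j) w' a' b') :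
    ∃ k l, w ∈ PlaneTriangle.openEdge (T.basis i) k ∧ w' ∈ PlaneTriangle.openEdge (T.basis j) l ∧
      ∃ κ : ℝ, 0 < κ ∧ ∀ y : ℂ, (T.basis j).coord l ((y - b') / a')
        = -κ * (T.basis i).coord k ((y - b) / a) := by
  -- a point of a fibre with more than one point is not interior
  have key : ∀ (i j : Fin T.n) (w w' : ℂ) (a a' : ℝ) (b b' : ℂ), (i = j → w ≠ w') →
      w ∈ T.tri i → w' ∈ T.tri j → T.map i w = T.map j w' →
      LocalForm φ (T.tri i) (T.map i) w a b → LocalForm φ (T.tri j) (T.map j) w' a' b' →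
      w ∉ interior (T.tri i) := by
    intro i j w w' a a' b b' hne hw hw' hx h h' hin
    have h1 := (eventually_not_interior hne hw hw' hx h h').and
      ((h.tendsto_inv hw).eventually (isOpen_interior.mem_nhds hin))
    have h2 : Filter.Tendsto (fun z : ℂ => (a' : ℂ) * z + b') (𝓝 w') (𝓝 (φ (T.map i w))) := by
      rw [hx, h'.apply_eq hw']
      have : Continuous fun z : ℂ => (a' : ℂ) * z + b' := by fun_prop
      exact this.tendsto w'
    have h3 : w' ∈ closure (interior (T.tri j)) := by
      rw [tri, PlaneTriangle.closure_interior]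
      exact hw'
    obtain ⟨z, hz1, hz2⟩ := ((mem_closure_iff_frequently.1 h3).and_eventually
      (h2.eventually h1)).exists
    apply hz2.1
    refine ⟨hz2.2, ?_⟩
    have ha : (a' : ℂ) ≠ 0 := by exact_mod_cast h'.1
    have : ((a' : ℂ) * z + b' - b') / a' = z := by field_simp; ring
    rwa [this]
  obtain ⟨k, hk⟩ := (PlaneTriangle.interior_or_edge (T.basis i) hw
    (T.notMem_range_of_notMem_sing hs)).resolve_left (key i j w w' a a' b b' hne hw hw' hx h h')
  obtain ⟨l, hl⟩ := (PlaneTriangle.interior_or_edge (T.basis j) hw'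
    (T.notMem_range_of_notMem_sing (hx ▸ hs))).resolve_left
    (key j i w' w a' a b' b (fun e => (hne e.symm).symm) hw' hw hx.symm h' h)
  refine ⟨k, l, hk, hl, ?_⟩
  -- Near the point the two triangles are half-planes; as they do not overlap, their defining
  -- affine functions are negative multiples of each other.
  have aff : ∀ (i : Fin T.n) (k : Fin 3) (a : ℝ) (b : ℂ), a ≠ 0 →
      IsRealAffine (fun y : ℂ => (T.basis i).coord k ((y - b) / a)) ∧
      ∃ y : ℂ, (T.basis i).coord k ((y - b) / a) ≠ 0 := by
    intro i k a b ha
    have ha : (a : ℂ) ≠ 0 := by exact_mod_cast ha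
    constructor
    · have := (PlaneTriangle.isRealAffine_coord (T.basis i) k).comp_halfDilation a⁻¹ (-b / a)
      convert this using 3
      push_cast
      field_simp
      ring
    · refine ⟨a * T.basis i k + b, ?_⟩
      have : ((a : ℂ) * T.basis i k + b - b) / a = T.basis i k := by field_simp; ring
      rw [this, PlaneTriangle.coord_self]
      exact one_ne_zero
  refine (aff i k a b h.1).1.exists_eq_neg_mul (aff j l a' b' h'.1).1 (o := φ (T.map i w)) ?_ ?_
    (aff i k a b h.1).2 (aff j l a' b' h'.1).2 ?_
  · rw [h.inv_eq hw, hk.1]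
  · rw [hx, h'.inv_eq hw', hl.1]
  · have t2 := h'.tendsto_inv hw'
    rw [← hx] at t2
    filter_upwards [eventually_not_interior hne hw hw' hx h h',
      (h.tendsto_inv hw).eventually (PlaneTriangle.eventually_mem_iff _ hk.2.1 hk.2.2),
      t2.eventually (PlaneTriangle.eventually_mem_iff _ hl.2.1 hl.2.2)] with y h1 h2 h3
    rintro ⟨h4, h5⟩
    exact h1 ⟨h2.2.1.2 h4, h3.2.1.2 h5⟩

end Triangulation

end HalfDilationStructure

/-! ### Changes of coordinates between triangles and gluings of edges -/

namespace HalfDilationStructure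

variable {X : Type*} [TopologicalSpace X] {S : HalfDilationStructure X}

namespace Triangulation

variable {T T' : S.Triangulation}

theorem isCompact_tri (T : S.Triangulation) (i : Fin T.n) : IsCompact (T.tri i) :=
  PlaneTriangle.isCompact _

theorem isTransition_of_localForm {i : Fin T.n} {j : Fin T'.n} {w w' : ℂ} (hw : w ∈ T.tri i)
    (hw' : w' ∈ T'.tri j) (hx : T.map i w = T'.map j w')
    {φ : OpenPartialHomeomorph X ℂ} (hφ : φ ∈ S.atlas) {a a' : ℝ} {b b' : ℂ}
    (h : LocalForm φ (T.tri i) (T.map i) w a b)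
    (h' : LocalForm φ (T'.tri j) (T'.map j) w' a' b') :
    ((a / a' : ℝ) : ℂ) * w + (b - b') / a' = w' ∧
      IsTransition T T' i j (a / a') ((b - b') / a') w := by
  have ha' : (a' : ℂ) ≠ 0 := by exact_mod_cast h'.1
  have h1 : ((a / a' : ℝ) : ℂ) * w + (b - b') / a' = w' := by
    have e1 := h.apply_eq hw
    have e2 := h'.apply_eq hw'
    rw [hx, e2] at e1
    push_cast
    field_simp
    linear_combination -e1
  refine ⟨h1, div_ne_zero h.1 h'.1, hw, h1.symm ▸ hw', h1.symm ▸ hx, φ, hφ, a', b', ?_,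
    h1.symm ▸ h'⟩
  have e1 : a' * (a / a') = a := mul_div_cancel₀ a h'.1
  have e2 : (a' : ℂ) * ((b - b') / a') + b' = b := by
    field_simp
    ring
  rw [e1, e2]
  exact h

theorem IsTransition.symm {i : Fin T.n} {j : Fin T'.n} {s : ℝ} {t w : ℂ}
    (h : IsTransition T T' i j s t w) :
    IsTransition T' T j i s⁻¹ (-t / s) ((s : ℂ) * w + t) := by
  obtain ⟨hs, h1, h2, h3, φ, hφ, a, b, h4, h5⟩ := h
  have hs' : (s : ℂ) ≠ 0 := by exact_mod_cast hs
  have e : ((s⁻¹ : ℝ) : ℂ) * ((s : ℂ) * w + t) + -t / s = w := by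
    push_cast
    field_simp
    ring
  refine ⟨inv_ne_zero hs, h2, e.symm ▸ h1, e.symm ▸ h3.symm, φ, hφ, a * s, a * t + b, ?_,
    e.symm ▸ h4⟩
  have e1 : a * s * s⁻¹ = a := by field_simp [hs]
  have e2 : ((a * s : ℝ) : ℂ) * (-t / s) + (a * t + b) = b := by
    push_cast
    field_simp
    ring
  rw [e1, e2]
  exact h5

/-- Near a point where a half-dilation is a change of coordinates it is one at all points that it
maps to the second triangle. -/
theorem IsTransition.eventually {i : Fin T.n} {j : Fin T'.n} {s : ℝ} {t w : ℂ}
    (h : IsTransition T T' i j s t w) :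
    ∀ᶠ z in 𝓝[T.tri i] w, (s : ℂ) * z + t ∈ T'.tri j → IsTransition T T' i j s t z := by
  obtain ⟨hs, hw, hw', hx, φ, hφ, a, b, h1, h2⟩ := h
  have hc : Filter.Tendsto (fun z : ℂ => (s : ℂ) * z + t) (𝓝 w) (𝓝 ((s : ℂ) * w + t)) := by
    have : Continuous fun z : ℂ => (s : ℂ) * z + t := by fun_prop
    exact this.tendsto w
  have h3 := (hc.eventually (eventually_nhdsWithin_iff.1 (h2.eventually_localForm.and h2.2.2)))
  filter_upwards [h1.eventually_localForm, h1.2.2, nhdsWithin_le_nhds h3, self_mem_nhdsWithin]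
    with z hz1 hz2 hz3 hz4 hz5
  obtain ⟨hz6, hz7, hz8⟩ := hz3 hz5
  refine ⟨hs, hz4, hz5, ?_, φ, hφ, a, b, hz1, hz6⟩
  apply φ.injOn hz2.1 hz7
  rw [hz2.2, hz8]
  push_cast
  ring

/-- An interior point of a triangle is the only point over its image. -/
theorem eq_of_mem_interior {i j : Fin T.n} {w w' : ℂ} (hw : w ∈ interior (T.tri i))
    (hw' : w' ∈ T.tri j) (hx : T.map i w = T.map j w') : i = j ∧ w = w' := by
  by_contra hcon
  have hwt := interior_subset hw
  have hs := T.notMem_sing hwt (PlaneTriangle.notMem_range_of_mem_interior _ hw)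
  obtain ⟨φ, hφ, hsrc⟩ := S.exists_chart _ hs
  obtain ⟨a, b, h⟩ := T.exists_localForm hwt hs hφ hsrc
  obtain ⟨a', b', h'⟩ := T.exists_localForm hw' (hx ▸ hs) hφ (hx ▸ hsrc)
  obtain ⟨k, l, hk, -⟩ := exists_edge_coords (fun e1 e2 => hcon ⟨e1, e2⟩) hwt hw' hx hs h h'
  exact ((PlaneTriangle.mem_interior_iff _).1 hw k).ne' hk.1

variable [T2Space X]

/-- A limit of points where a half-dilation is a change of coordinates. -/
theorem map_eq_of_frequently {i : Fin T.n} {j : Fin T'.n} {s : ℝ} {t w : ℂ} (hw : w ∈ T.tri i)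
    {p : ℂ → Prop} (hp : ∀ z, p z → z ∈ T.tri i ∧ (s : ℂ) * z + t ∈ T'.tri j ∧
      T.map i z = T'.map j ((s : ℂ) * z + t)) (h : ∃ᶠ z in 𝓝 w, p z) :
    (s : ℂ) * w + t ∈ T'.tri j ∧ T.map i w = T'.map j ((s : ℂ) * w + t) := by
  have hc : Filter.Tendsto (fun z : ℂ => (s : ℂ) * z + t) (𝓝 w) (𝓝 ((s : ℂ) * w + t)) := by
    have : Continuous fun z : ℂ => (s : ℂ) * z + t := by fun_prop
    exact this.tendsto w
  have hw' : (s : ℂ) * w + t ∈ T'.tri j := by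
    refine (T'.isCompact_tri j).isClosed.mem_of_frequently_of_tendsto (h.mono fun z hz => ?_) hc
    exact (hp z hz).2.1
  refine ⟨hw', ?_⟩
  set F := 𝓝 w ⊓ Filter.principal {z | p z}
  have hF : F.NeBot := Filter.frequently_mem_iff_neBot.1 h
  have hle : F ≤ 𝓝[T.tri i] w :=
    inf_le_inf_left _ (Filter.principal_mono.2 fun z hz => (hp z hz).1)
  have h1 : Filter.Tendsto (T.map i) F (𝓝 (T.map i w)) :=
    (T.continuousOn_tri i w hw).mono_left hle
  have hpF : ∀ᶠ z in F, p z := Filter.mem_inf_of_right (Filter.mem_principal_self _)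
  have h2 : Filter.Tendsto (fun z : ℂ => (s : ℂ) * z + t) F (𝓝[T'.tri j] ((s : ℂ) * w + t)) := by
    refine tendsto_nhdsWithin_iff.2 ⟨hc.mono_left inf_le_left, ?_⟩
    filter_upwards [hpF] with z hz using (hp z hz).2.1
  have h3 : Filter.Tendsto (fun z : ℂ => T'.map j ((s : ℂ) * z + t)) F
      (𝓝 (T'.map j ((s : ℂ) * w + t))) := (T'.continuousOn_tri j _ hw').tendsto.comp h2
  refine tendsto_nhds_unique h1 (h3.congr' ?_)
  filter_upwards [hpF] with z hz using (hp z hz).2.2.symm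

/-- A half-dilation which is compatible with the parametrizations of two triangles at points
arbitrarily close to a regular point is the change of coordinates there. -/
theorem isTransition_of_frequently {i : Fin T.n} {j : Fin T'.n} {s : ℝ} {t w : ℂ}
    (hs0 : s ≠ 0) (hw : w ∈ T.tri i) (hs : T.map i w ∉ S.sing)
    (h : ∃ᶠ z in 𝓝 w, z ≠ w ∧ z ∈ T.tri i ∧ (s : ℂ) * z + t ∈ T'.tri j ∧
      T.map i z = T'.map j ((s : ℂ) * z + t)) : IsTransition T T' i j s t w := by
  obtain ⟨hw', hx⟩ := map_eq_of_frequently hw (fun z hz => hz) (h.mono fun z hz => hz.2)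
  obtain ⟨φ, hφ, hsrc⟩ := S.exists_chart _ hs
  obtain ⟨a1, b1, h1⟩ := T.exists_localForm hw hs hφ hsrc
  obtain ⟨a2, b2, h2⟩ := T'.exists_localForm hw' (hx ▸ hs) hφ (hx ▸ hsrc)
  have hc : Filter.Tendsto (fun z : ℂ => (s : ℂ) * z + t) (𝓝 w) (𝓝 ((s : ℂ) * w + t)) := by
    have : Continuous fun z : ℂ => (s : ℂ) * z + t := by fun_prop
    exact this.tendsto w
  obtain ⟨z, ⟨hzw, hz⟩, hz1, hz2⟩ := (h.and_eventually ((eventually_nhdsWithin_iff.1 h1.2.2).and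
    (hc.eventually (eventually_nhdsWithin_iff.1 h2.2.2)))).exists
  have e1 := (hz1 hz.1).2
  have e2 := (hz2 hz.2.1).2
  have e3 := h1.apply_eq hw
  have e4 := h2.apply_eq hw'
  rw [← hz.2.2, e1] at e2
  rw [← hx, e3] at e4
  have e5 : ((a1 : ℂ) - a2 * s) * (z - w) = 0 := by linear_combination e2 - e4
  have e6 : (a1 : ℂ) = a2 * s := by
    rcases mul_eq_zero.1 e5 with e | e
    · exact sub_eq_zero.1 e
    · exact absurd (sub_eq_zero.1 e) hzw
  have e7 : b1 = a2 * t + b2 := by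
    rw [e6] at e4
    linear_combination e4
  have e8 : a1 = a2 * s := by exact_mod_cast e6
  refine ⟨hs0, hw, hw', hx, φ, hφ, a2, b2, ?_, h2⟩
  rw [← e7, ← e8]
  exact h1

/-- If a half-dilation that maps the line of an edge to the line of another edge is a change of
coordinates at one point of the first open edge, then it is one at all of its points: the set of
these points is open and closed in the open edge. -/
theorem isTransition_openEdge {i : Fin T.n} {j : Fin T'.n} {k l : Fin 3} {s : ℝ} {t : ℂ}
    {κ : ℝ} (hcoord : ∀ z : ℂ, (T'.basis j).coord l ((s : ℂ) * z + t)
      = -κ * (T.basis i).coord k z) {w : ℂ} (hw : w ∈ PlaneTriangle.openEdge (T.basis i) k)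
    (h : IsTransition T T' i j s t w) {z : ℂ}
    (hz : z ∈ PlaneTriangle.openEdge (T.basis i) k) : IsTransition T T' i j s t z := by
  have hsub := PlaneTriangle.openEdge_subset (T.basis i) k
  have hpre := (PlaneTriangle.convex_openEdge (T.basis i) k).isPreconnected
  have hreg : ∀ y ∈ PlaneTriangle.openEdge (T.basis i) k, T.map i y ∉ S.sing := fun y hy =>
    T.notMem_sing (hsub hy) (PlaneTriangle.notMem_range_of_mem_openEdge _ hy)
  refine hpre.induction₂' (fun y y' => IsTransition T T' i j s t y → IsTransition T T' i j s t y')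
    (fun y hy => ?_) (fun _ _ _ _ _ _ h1 h2 h3 => h2 (h1 h3)) hw hz h
  refine Filter.Eventually.and ?_ ?_
  · -- Openness: near a point of the open edge the image of the edge stays in the open edge.
    by_cases hG : IsTransition T T' i j s t y
    · have hmem : (s : ℂ) * y + t ∉ Set.range (T'.basis j) :=
        T'.notMem_range_of_notMem_sing (hG.2.2.2.1 ▸ hreg y hy)
      have h0 : (T'.basis j).coord l ((s : ℂ) * y + t) = 0 := by rw [hcoord, hy.1, mul_zero]
      have hpos : 0 < (T'.basis j).coord (l + 1) ((s : ℂ) * y + t) ∧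
          0 < (T'.basis j).coord (l + 2) ((s : ℂ) * y + t) := by
        rcases PlaneTriangle.interior_or_edge (T'.basis j) hG.2.2.1 hmem with h1 | ⟨m, h1, h2, h3⟩
        · rw [PlaneTriangle.mem_interior_iff] at h1
          exact absurd h0 (h1 l).ne'
        · rcases PlaneTriangle.fin3_cases m l with rfl | rfl | rfl
          · exact ⟨h2, h3⟩
          · exact absurd h0 h2.ne'
          · exact absurd h0 h3.ne'
      have hc : Filter.Tendsto (fun z : ℂ => (s : ℂ) * z + t) (𝓝 y) (𝓝 ((s : ℂ) * y + t)) := by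
        have : Continuous fun z : ℂ => (s : ℂ) * z + t := by fun_prop
        exact this.tendsto y
      filter_upwards [nhdsWithin_mono y hsub hG.eventually,
        nhdsWithin_le_nhds (hc.eventually (PlaneTriangle.eventually_mem_iff _ hpos.1 hpos.2)),
        self_mem_nhdsWithin] with z h1 h2 h3 _
      apply h1
      apply h2.1.2
      rw [hcoord, h3.1, mul_zero]
    · exact Filter.Eventually.of_forall fun z h => absurd h hG
  · -- Closedness: a limit of points where the map is a change of coordinates.
    by_cases hG : IsTransition T T' i j s t y
    · exact Filter.Eventually.of_forall fun z _ => hG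
    · by_contra hcon
      apply hG
      refine isTransition_of_frequently h.1 (hsub hy) (hreg y hy) ?_
      have h2 : ∃ᶠ z in 𝓝[PlaneTriangle.openEdge (T.basis i) k] y,
          IsTransition T T' i j s t z := (Filter.not_eventually.1 hcon).mono fun z hz => by
        by_contra h3
        exact hz fun h4 => absurd h4 h3
      refine (h2.filter_mono nhdsWithin_le_nhds).mono fun z hz =>
        ⟨?_, hz.2.1, hz.2.2.1, hz.2.2.2.1⟩
      rintro rfl
      exact hG hz

/-- The half-dilation `z ↦ s z + t` glues the edge opposite the corner `c` to the edge opposite the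
corner `d`, the two triangles being on different sides. -/
structure IsGluing (T : S.Triangulation) (c d : T.Corner) (s : ℝ) (t : ℂ) : Prop where
  ne_zero : s ≠ 0
  exists_coord : ∃ κ : ℝ, 0 < κ ∧ ∀ z : ℂ,
    (T.basis d.1).coord d.2 ((s : ℂ) * z + t) = -κ * (T.basis c.1).coord c.2 z
  transition : ∀ z ∈ PlaneTriangle.openEdge (T.basis c.1) c.2, IsTransition T T c.1 d.1 s t z

theorem IsGluing.symm {c d : T.Corner} {s : ℝ} {t : ℂ} (h : T.IsGluing c d s t) {w : ℂ}
    (hw : (s : ℂ) * w + t ∈ PlaneTriangle.openEdge (T.basis d.1) d.2)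
    (hw' : w ∈ PlaneTriangle.openEdge (T.basis c.1) c.2) :
    T.IsGluing d c s⁻¹ (-t / s) := by
  have hs : (s : ℂ) ≠ 0 := by exact_mod_cast h.ne_zero
  obtain ⟨κ, hκ, hc⟩ := h.exists_coord
  have hc' : ∀ z : ℂ, (T.basis c.1).coord c.2 (((s⁻¹ : ℝ) : ℂ) * z + -t / s)
      = -κ⁻¹ * (T.basis d.1).coord d.2 z := by
    intro z
    have := hc (((s⁻¹ : ℝ) : ℂ) * z + -t / s)
    have e : (s : ℂ) * (((s⁻¹ : ℝ) : ℂ) * z + -t / s) + t = z := by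
      push_cast
      field_simp
      ring
    rw [e] at this
    rw [this]
    field_simp
  refine ⟨inv_ne_zero h.ne_zero, ⟨κ⁻¹, inv_pos.2 hκ, hc'⟩, fun z hz => ?_⟩
  exact isTransition_openEdge hc' hw (h.transition w hw').symm hz

theorem IsGluing.endpoints {c d : T.Corner} {s : ℝ} {t : ℂ} (h : T.IsGluing c d s t) :
    ((s : ℂ) * T.basis c.1 (c.2 + 1) + t = T.basis d.1 (d.2 + 1) ∧
      (s : ℂ) * T.basis c.1 (c.2 + 2) + t = T.basis d.1 (d.2 + 2)) ∨
    ((s : ℂ) * T.basis c.1 (c.2 + 1) + t = T.basis d.1 (d.2 + 2) ∧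
      (s : ℂ) * T.basis c.1 (c.2 + 2) + t = T.basis d.1 (d.2 + 1)) := by
  obtain ⟨κ, hκ, hc⟩ := h.exists_coord
  have hs : (s : ℂ) ≠ 0 := by exact_mod_cast h.ne_zero
  -- An endpoint of the edge is mapped to a singular point of the closed triangle, that is, to a
  -- vertex; the barycentric coordinate opposite the edge vanishes there.
  have key : ∀ m, m ≠ c.2 → T.basis c.1 m ∈ closure (PlaneTriangle.openEdge (T.basis c.1) c.2) →
      (s : ℂ) * T.basis c.1 m + t = T.basis d.1 (d.2 + 1) ∨
      (s : ℂ) * T.basis c.1 m + t = T.basis d.1 (d.2 + 2) := by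
    intro m hm hcl
    obtain ⟨h1, h2⟩ := map_eq_of_frequently (T := T) (T' := T) (i := c.1) (j := d.1) (s := s)
      (t := t) (PlaneTriangle.vertex_mem (T.basis c.1) m)
      (p := fun z => z ∈ PlaneTriangle.openEdge (T.basis c.1) c.2)
      (fun z hz => ⟨(h.transition z hz).2.1, (h.transition z hz).2.2.1,
        (h.transition z hz).2.2.2.1⟩) (mem_closure_iff_frequently.1 hcl)
    have h3 : (s : ℂ) * T.basis c.1 m + t ∈ Set.range (T.basis d.1) := by
      by_contra hcon
      have := T.notMem_sing h1 hcon
      rw [← h2] at this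
      exact this (T.map_vert_mem c.1 m)
    obtain ⟨q, hq⟩ := h3
    have h4 := hc (T.basis c.1 m)
    rw [PlaneTriangle.coord_vertex_ne _ hm.symm, ← hq] at h4
    rcases PlaneTriangle.fin3_cases d.2 q with rfl | rfl | rfl
    · rw [PlaneTriangle.coord_self] at h4
      simp at h4
    · exact Or.inl hq.symm
    · exact Or.inr hq.symm
  have hne : (s : ℂ) * T.basis c.1 (c.2 + 1) + t ≠ (s : ℂ) * T.basis c.1 (c.2 + 2) + t := by
    intro e
    exact PlaneTriangle.vertex_ne (T.basis c.1) (PlaneTriangle.fin3_add_one_ne_add_two c.2)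
      (mul_left_cancel₀ hs (add_right_cancel e))
  have hcl := PlaneTriangle.endpoint_mem_closure (T.basis c.1) c.2
  rcases key _ (PlaneTriangle.fin3_add_one_ne c.2) hcl.1 with h1 | h1 <;>
  rcases key _ (PlaneTriangle.fin3_add_two_ne c.2) hcl.2 with h2 | h2
  · exact absurd (h1.trans h2.symm) hne
  · exact Or.inl ⟨h1, h2⟩
  · exact Or.inr ⟨h1, h2⟩
  · exact absurd (h1.trans h2.symm) hne

theorem IsGluing.ne {c d : T.Corner} {s : ℝ} {t : ℂ} (h : T.IsGluing c d s t) : c ≠ d := by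
  rintro rfl
  obtain ⟨κ, hκ, hc⟩ := h.exists_coord
  -- the midpoint of the edge is fixed, hence the gluing is the identity
  have hm := PlaneTriangle.combo_mem_openEdge (T.basis c.1) c.2 (t := 1 / 2) (by norm_num)
    (by norm_num)
  set m := ((1 - 1 / 2 : ℝ) : ℂ) * T.basis c.1 (c.2 + 1) + ((1 / 2 : ℝ) : ℂ)
    * T.basis c.1 (c.2 + 2) with hmdef
  have hfix : (s : ℂ) * m + t = m := by
    rw [hmdef]
    push_cast
    rcases h.endpoints with ⟨h1, h2⟩ | ⟨h1, h2⟩ <;> linear_combination h1 / 2 + h2 / 2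
  obtain ⟨_, h1, h2, h3, φ, hφ, a, b, h4, h5⟩ := h.transition m hm
  rw [hfix] at h5
  obtain ⟨h6, h7⟩ := h4.eq_of_eventually_tri h1 h5
  have hs : s = 1 := by
    have : a * (s - 1) = 0 := by linear_combination h6
    rcases mul_eq_zero.1 this with h | h
    · exact absurd h h5.1
    · linarith
  have ht : t = 0 := by
    rw [hs] at hfix
    push_cast at hfix
    linear_combination hfix
  have := hc (T.basis c.1 c.2)
  rw [hs, ht] at this
  simp only [Complex.ofReal_one, one_mul, add_zero, PlaneTriangle.coord_self] at this
  linarith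

theorem IsGluing.map_eq {c d : T.Corner} {s : ℝ} {t : ℂ} (h : T.IsGluing c d s t) {z : ℂ}
    (hz : z ∈ segment ℝ (T.basis c.1 (c.2 + 1)) (T.basis c.1 (c.2 + 2))) :
    (s : ℂ) * z + t ∈ segment ℝ (T.basis d.1 (d.2 + 1)) (T.basis d.1 (d.2 + 2)) ∧
    T.map c.1 z = T.map d.1 ((s : ℂ) * z + t) := by
  obtain ⟨κ, hκ, hc⟩ := h.exists_coord
  rw [PlaneTriangle.mem_edge_iff] at hz ⊢
  have hcl : z ∈ closure (PlaneTriangle.openEdge (T.basis c.1) c.2) := by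
    by_cases hv : z ∈ Set.range (T.basis c.1)
    · obtain ⟨q, rfl⟩ := hv
      rcases PlaneTriangle.fin3_cases c.2 q with e | e | e
      · have := hz.2
        rw [e, PlaneTriangle.coord_self] at this
        exact absurd this one_ne_zero
      · rw [e]; exact (PlaneTriangle.endpoint_mem_closure (T.basis c.1) c.2).1
      · rw [e]; exact (PlaneTriangle.endpoint_mem_closure (T.basis c.1) c.2).2
    · apply subset_closure
      rcases PlaneTriangle.interior_or_edge (T.basis c.1) hz.1 hv with h1 | ⟨m, h1⟩
      · rw [PlaneTriangle.mem_interior_iff] at h1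
        exact absurd hz.2 (h1 _).ne'
      · rcases PlaneTriangle.fin3_cases m c.2 with e | e | e
        · rw [e]; exact h1
        · rw [e] at hz; exact absurd hz.2 h1.2.1.ne'
        · rw [e] at hz; exact absurd hz.2 h1.2.2.ne'
  obtain ⟨h1, h2⟩ := map_eq_of_frequently (T := T) (T' := T) (i := c.1) (j := d.1) (s := s)
      (t := t) hz.1
      (p := fun z => z ∈ PlaneTriangle.openEdge (T.basis c.1) c.2)
      (fun z hz => ⟨(h.transition z hz).2.1, (h.transition z hz).2.2.1,
        (h.transition z hz).2.2.2.1⟩) (mem_closure_iff_frequently.1 hcl)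
  exact ⟨⟨h1, by rw [hc, hz.2, mul_zero]⟩, h2⟩

theorem IsGluing.edge_subset {c d : T.Corner} {s : ℝ} {t : ℂ} (h : T.IsGluing c d s t) :
    T.edge c ⊆ T.edge d := by
  rintro _ ⟨z, hz, rfl⟩
  obtain ⟨h1, h2⟩ := h.map_eq (z := z) hz
  exact ⟨_, h1, h2.symm⟩

/-- Two different points over a regular point lie on edges that are glued to each other. -/
theorem isGluing_of_localForm {i j : Fin T.n} {w w' : ℂ} (hne : i = j → w ≠ w')
    (hw : w ∈ T.tri i) (hw' : w' ∈ T.tri j) (hx : T.map i w = T.map j w')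
    (hs : T.map i w ∉ S.sing) {φ : OpenPartialHomeomorph X ℂ} (hφ : φ ∈ S.atlas) {a a' : ℝ}
    {b b' : ℂ} (h : LocalForm φ (T.tri i) (T.map i) w a b)
    (h' : LocalForm φ (T.tri j) (T.map j) w' a' b') :
    ∃ k l, w ∈ PlaneTriangle.openEdge (T.basis i) k ∧ w' ∈ PlaneTriangle.openEdge (T.basis j) l ∧
      T.IsGluing (i, k) (j, l) (a / a') ((b - b') / a') ∧ T.AreOpposite (i, k) (j, l) := by
  obtain ⟨k, l, hk, hl, κ, hκ, hc⟩ := exists_edge_coords hne hw hw' hx hs h h'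
  have ha : (a : ℂ) ≠ 0 := by exact_mod_cast h.1
  have ha' : (a' : ℂ) ≠ 0 := by exact_mod_cast h'.1
  obtain ⟨e, htr⟩ := isTransition_of_localForm hw hw' hx hφ h h'
  have hc' : ∀ z : ℂ, (T.basis j).coord l (((a / a' : ℝ) : ℂ) * z + (b - b') / a')
      = -κ * (T.basis i).coord k z := by
    intro z
    have := hc (a * z + b)
    have e1 : ((a : ℂ) * z + b - b) / a = z := by field_simp; ring
    have e2 : ((a : ℂ) * z + b - b') / a' = ((a / a' : ℝ) : ℂ) * z + (b - b') / a' := by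
      push_cast
      field_simp
      ring
    rwa [e1, e2] at this
  have hgl : T.IsGluing (i, k) (j, l) (a / a') ((b - b') / a') :=
    ⟨htr.1, ⟨κ, hκ, hc'⟩, fun z hz => isTransition_openEdge hc' hk htr hz⟩
  refine ⟨k, l, hk, hl, hgl, hgl.ne, Set.Subset.antisymm hgl.edge_subset ?_⟩
  exact (hgl.symm (w := w) (e.symm ▸ hl) hk).edge_subset

/-- Over a regular point, an edge point is never alone: the triangles cover the surface. -/
theorem exists_other {i : Fin T.n} {w : ℂ} {k : Fin 3}
    (hw : w ∈ PlaneTriangle.openEdge (T.basis i) k) :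
    ∃ j, ∃ w' ∈ T.tri j, T.map i w = T.map j w' ∧ (i = j → w ≠ w') := by
  by_contra hcon
  push Not at hcon
  have hwt : w ∈ T.tri i := PlaneTriangle.openEdge_subset _ k hw
  have hs := T.notMem_sing hwt (PlaneTriangle.notMem_range_of_mem_openEdge _ hw)
  obtain ⟨φ, hφ, hsrc⟩ := S.exists_chart _ hs
  obtain ⟨a, b, h⟩ := T.exists_localForm hwt hs hφ hsrc
  have ha : (a : ℂ) ≠ 0 := by exact_mod_cast h.1
  -- If `w` were the only point of its fibre, all nearby points of the surface would lie on one
  -- side of the edge.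
  have h1 : ∀ᶠ y in 𝓝 (T.map i w), ∀ j, ∀ z ∈ T.tri j, T.map j z = y →
      0 ≤ (T.basis i).coord k ((φ y - b) / a) := by
    rw [Filter.eventually_all]
    intro j
    have := (T.isCompact_tri j).eventually_fibre (T.continuousOn_tri j) (x := T.map i w)
      (p := fun z => 0 ≤ (T.basis i).coord k ((φ (T.map j z) - b) / a)) ?_
    · filter_upwards [this] with y hy z hz hzy
      rw [← hzy]
      exact hy z hz hzy
    · intro z hz hzx
      obtain ⟨rfl, rfl⟩ := hcon j z hz hzx.symm
      filter_upwards [h.2.2, self_mem_nhdsWithin] with z' hz' hz''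
      rw [hz'.2]
      have e : ((a : ℂ) * z' + b - b) / a = z' := by field_simp; ring
      rw [e]
      exact (PlaneTriangle.mem_iff (T.basis i)).1 hz'' k
  have h2 : ∀ᶠ y in 𝓝 (φ (T.map i w)), 0 ≤ (T.basis i).coord k ((y - b) / a) := by
    have hc : Filter.Tendsto φ.symm (𝓝 (φ (T.map i w))) (𝓝 (T.map i w)) := by
      have := φ.symm.continuousAt (φ.map_source hsrc)
      rwa [ContinuousAt, φ.left_inv hsrc] at this
    filter_upwards [hc.eventually h1, φ.open_target.mem_nhds (φ.map_source hsrc)] with y hy hyt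
    obtain ⟨j, z, hz, hzy⟩ := T.cover (φ.symm y)
    have := hy j z hz hzy
    rwa [φ.right_inv hyt] at this
  have haff : IsRealAffine fun y : ℂ => (T.basis i).coord k ((y - b) / a) := by
    have := (PlaneTriangle.isRealAffine_coord (T.basis i) k).comp_halfDilation a⁻¹ (-b / a)
    convert this using 3
    push_cast
    field_simp
    ring
  have h3 := haff.eq_zero_of_nonneg_near (by rw [h.inv_eq hwt, hw.1]) h2 (a * T.basis i k + b)
  have e : ((a : ℂ) * T.basis i k + b - b) / a = T.basis i k := by field_simp; ring
  rw [e, PlaneTriangle.coord_self] at h3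
  exact one_ne_zero h3

end Triangulation

end HalfDilationStructure

/-! ### The topology of half-dilation cones -/

namespace HalfDilationCone

variable {k : ℕ} [NeZero k] {a : Fin k → ℝ}

/-- A set of points of the half-planes is saturated if it is a union of classes of glued points. -/
def IsSaturated (a : Fin k → ℝ) (N : Set (Fin k × {z : ℂ // 0 ≤ z.im})) : Prop :=
  ∀ p q, Glue k a p q → (p ∈ N ↔ q ∈ N)

theorem IsSaturated.mk_mem_iff {N : Set (Fin k × {z : ℂ // 0 ≤ z.im})} (hN : IsSaturated a N)
    (n : Fin k) (z : {z : ℂ // 0 ≤ z.im}) : mk a n z ∈ Quot.mk (Glue k a) '' N ↔ (n, z) ∈ N := by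
  constructor
  · rintro ⟨p, hp, hpz⟩
    have := congrArg (Quot.lift (fun p => p ∈ N) fun p q h => propext (hN p q h)) hpz
    exact this.mp hp
  · exact fun h => ⟨_, h, rfl⟩

theorem IsSaturated.isOpen {N : Set (Fin k × {z : ℂ // 0 ≤ z.im})} (hN : IsSaturated a N)
    (ho : IsOpen N) : IsOpen (Quot.mk (Glue k a) '' N : Set (HalfDilationCone k a)) := by
  have : IsOpen (Quot.mk (Glue k a) ⁻¹' (Quot.mk (Glue k a) '' N)) := by
    convert ho using 1
    ext ⟨n, z⟩
    exact hN.mk_mem_iff n z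
  exact isQuotientMap_quot_mk.isOpen_preimage.1 this

theorem IsSaturated.compl {N : Set (Fin k × {z : ℂ // 0 ≤ z.im})} (hN : IsSaturated a N) :
    IsSaturated a Nᶜ := fun p q h => not_congr (hN p q h)

theorem continuous_mk (n : Fin k) : Continuous (mk a n) :=
  continuous_quot_mk.comp (Continuous.prodMk_right n)

theorem mk_eq_of_glue (n : Fin k) (x y : {z : ℂ // 0 ≤ z.im}) (hx : (x : ℂ).im = 0)
    (hx' : (x : ℂ).re ≤ 0) (hy : (y : ℂ) = (a n : ℂ) * (x : ℂ)) : mk a n x = mk a (n + 1) y :=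
  Quot.sound (Glue.glue n x y hx hx' hy)

/-- The height of a point above the boundary of its half-plane. -/
def height : HalfDilationCone k a → ℝ :=
  Quot.lift (fun p => (p.2 : ℂ).im) (by
    rintro _ _ ⟨n, x, y, hx, -, hy⟩
    simp [hx, hy])

@[simp] theorem height_mk (n : Fin k) (z : {z : ℂ // 0 ≤ z.im}) :
    height (mk a n z) = (z : ℂ).im := rfl

theorem continuous_height : Continuous (height : HalfDilationCone k a → ℝ) :=
  continuous_quot_lift _ (Complex.continuous_im.comp (continuous_subtype_val.comp continuous_snd))

theorem height_nonneg (y : HalfDilationCone k a) : 0 ≤ height y := by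
  induction y using Quot.ind with
  | mk p => exact p.2.2

/-- The dilation of the upper half-plane by a nonnegative factor. -/
def scalePoint (r : ℝ) (hr : 0 ≤ r) (z : {z : ℂ // 0 ≤ z.im}) : {z : ℂ // 0 ≤ z.im} :=
  ⟨(r : ℂ) * z, by rw [Complex.im_ofReal_mul]; exact mul_nonneg hr z.2⟩

/-- The dilation of the cone by a nonnegative factor. -/
def scale (r : ℝ) (hr : 0 ≤ r) : HalfDilationCone k a → HalfDilationCone k a :=
  Quot.map (fun p => (p.1, scalePoint r hr p.2)) (by
    rintro _ _ ⟨n, x, y, hx, hx', hy⟩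
    refine Glue.glue n _ _ ?_ ?_ ?_
    · simp [scalePoint, hx]
    · simp only [scalePoint, Complex.re_ofReal_mul]
      exact mul_nonpos_of_nonneg_of_nonpos hr hx'
    · simp only [scalePoint, hy]
      ring)

theorem scale_mk (r : ℝ) (hr : 0 ≤ r) (n : Fin k) (z : {z : ℂ // 0 ≤ z.im}) :
    scale r hr (mk a n z) = mk a n (scalePoint r hr z) := rfl

theorem isSaturated_interior (n : Fin k) {V : Set {z : ℂ // 0 ≤ z.im}}
    (hV : ∀ z ∈ V, 0 < (z : ℂ).im) : IsSaturated a ({n} ×ˢ V) := by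
  rintro _ _ ⟨m, x, y, hx, hx', hy⟩
  have hy0 : (y : ℂ).im = 0 := by simp [hy, hx]
  constructor
  · rintro ⟨-, h⟩
    exact absurd hx (hV x h).ne'
  · rintro ⟨-, h⟩
    exact absurd hy0 (hV y h).ne'

/-- A neighbourhood of a boundary point consists of a piece of a half-plane and the corresponding
piece of the next one. -/
theorem isSaturated_boundary (ha : ∀ n, a n < 0) (n : Fin k) {V W : Set {z : ℂ // 0 ≤ z.im}}
    (hV : ∀ z ∈ V, (z : ℂ).re < 0) (hW : ∀ z ∈ W, 0 < (z : ℂ).re)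
    (hVW : ∀ x y : {z : ℂ // 0 ≤ z.im}, (y : ℂ) = (a n : ℂ) * x → (x ∈ V ↔ y ∈ W)) :
    IsSaturated a ({n} ×ˢ V ∪ {n + 1} ×ˢ W) := by
  rintro _ _ ⟨m, x, y, hx, hx', hy⟩
  have hy' : 0 ≤ (y : ℂ).re := by
    rw [hy, Complex.re_ofReal_mul]
    exact mul_nonneg_of_nonpos_of_nonpos (ha m).le hx'
  constructor
  · rintro (⟨h1, h2⟩ | ⟨h1, h2⟩)
    · simp only [Set.mem_singleton_iff] at h1
      subst h1
      exact Or.inr ⟨rfl, (hVW x y hy).1 h2⟩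
    · exact absurd hx' (not_le.2 (hW x h2))
  · rintro (⟨h1, h2⟩ | ⟨h1, h2⟩)
    · exact absurd hy' (not_le.2 (hV y h2))
    · have h3 : m = n := add_right_cancel h1
      subst h3
      exact Or.inl ⟨rfl, (hVW x y hy).2 h2⟩

theorem mk_eq_apex_iff (ha : ∀ n, a n < 0) (n : Fin k) (z : {z : ℂ // 0 ≤ z.im}) :
    mk a n z = apex a ↔ (z : ℂ) = 0 := by
  have hN : IsSaturated a {p | (p.2 : ℂ) = 0} := by
    rintro _ _ ⟨m, x, y, hx, hx', hy⟩
    have : (a m : ℂ) ≠ 0 := by exact_mod_cast (ha m).ne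
    simp [hy, this]
  have key : ∀ n : Fin k, mk a n ⟨0, le_rfl⟩ = mk a (n + 1) ⟨0, le_rfl⟩ := fun n =>
    mk_eq_of_glue n _ _ rfl le_rfl (by simp)
  have key2 : ∀ m : ℕ, mk a (Fin.ofNat k m) ⟨0, le_rfl⟩ = apex a := by
    intro m
    induction m with
    | zero => rfl
    | succ m ih =>
      have : Fin.ofNat k (m + 1) = Fin.ofNat k m + 1 := by
        apply Fin.ext
        simp [Fin.val_add, Fin.ofNat]
      rw [this, ← key, ih]
  constructor
  · intro h
    have h1 := hN.mk_mem_iff n z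
    rw [h] at h1
    exact h1.1 ((hN.mk_mem_iff 0 ⟨0, le_rfl⟩).2 rfl)
  · intro h
    have : z = ⟨0, le_rfl⟩ := Subtype.ext h
    have hn : Fin.ofNat k n.val = n := Fin.ext (Nat.mod_eq_of_lt n.2)
    rw [this, ← key2 n.val, hn]

theorem mk_eq_mk_of_im_pos {n m : Fin k} {z w : {z : ℂ // 0 ≤ z.im}} (hz : 0 < (z : ℂ).im)
    (h : mk a n z = mk a m w) : n = m ∧ z = w := by
  have hN := isSaturated_interior (a := a) n (V := {z}) (by rintro _ rfl; exact hz)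
  have h1 := (hN.mk_mem_iff n z).2 ⟨rfl, rfl⟩
  rw [h, hN.mk_mem_iff] at h1
  exact ⟨h1.1.symm, h1.2.symm⟩

theorem mk_eq_mk_of_re_neg (ha : ∀ n, a n < 0) {n m : Fin k} {z w : {z : ℂ // 0 ≤ z.im}}
    (hz : (z : ℂ).im = 0)
    (hz' : (z : ℂ).re < 0) (hw : (w : ℂ).re < 0) (h : mk a n z = mk a m w) : n = m ∧ z = w := by
  have han : (a n : ℂ) ≠ 0 := by exact_mod_cast (ha n).ne
  have hN := isSaturated_boundary ha n (V := {z}) (W := {y | (y : ℂ) = (a n : ℂ) * z})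
    (by rintro _ rfl; exact hz')
    (by
      intro y hy
      rw [Set.mem_ofPred_eq] at hy
      rw [hy, Complex.re_ofReal_mul]
      exact mul_pos_of_neg_of_neg (ha n) hz')
    (by
      intro x y hy
      rw [Set.mem_singleton_iff, Set.mem_ofPred_eq, hy, Subtype.ext_iff]
      exact ⟨fun h => by rw [h], fun h => mul_left_cancel₀ han h⟩)
  have h1 := (hN.mk_mem_iff n z).2 (Or.inl ⟨rfl, rfl⟩)
  rw [h, hN.mk_mem_iff] at h1
  rcases h1 with h1 | h1
  · exact ⟨h1.1.symm, h1.2.symm⟩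
  · have h2 : (w : ℂ) = (a n : ℂ) * z := h1.2
    rw [h2, Complex.re_ofReal_mul] at hw
    exact absurd hw (not_lt.2 (mul_pos_of_neg_of_neg (ha n) hz').le)

/-- The half-plane without its nonnegative boundary ray; every point of the cone other than the
apex is represented there exactly once. -/
def IsNormal (z : {z : ℂ // 0 ≤ z.im}) : Prop := 0 < (z : ℂ).im ∨ ((z : ℂ).im = 0 ∧ (z : ℂ).re < 0)

theorem mk_eq_mk_of_isNormal (ha : ∀ n, a n < 0) {n m : Fin k} {z w : {z : ℂ // 0 ≤ z.im}}
    (hz : IsNormal z) (hw : IsNormal w) (h : mk a n z = mk a m w) : n = m ∧ z = w := by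
  rcases hz with hz | ⟨hz, hz'⟩
  · exact mk_eq_mk_of_im_pos hz h
  · rcases hw with hw | ⟨hw, hw'⟩
    · have := mk_eq_mk_of_im_pos hw h.symm
      exact ⟨this.1.symm, this.2.symm⟩
    · exact mk_eq_mk_of_re_neg ha hz hz' hw' h

theorem exists_isNormal (ha : ∀ n, a n < 0) {y : HalfDilationCone k a} (hy : y ≠ apex a) :
    ∃ n z, IsNormal z ∧ y = mk a n z := by
  induction y using Quot.ind with
  | mk p =>
    obtain ⟨n, z⟩ := p
    change mk a n z ≠ apex a at hy
    rw [Ne, mk_eq_apex_iff ha] at hy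
    rcases z.2.eq_or_lt with h | h
    · rcases lt_trichotomy (z : ℂ).re 0 with h1 | h1 | h1
      · exact ⟨n, z, Or.inr ⟨h.symm, h1⟩, rfl⟩
      · exact absurd (Complex.ext h1 h.symm) hy
      · have hn := ha (n - 1)
        have hn' : (a (n - 1) : ℂ) ≠ 0 := by exact_mod_cast hn.ne
        let w : {z : ℂ // 0 ≤ z.im} := ⟨((a (n - 1))⁻¹ : ℝ) * z, by
          rw [Complex.im_ofReal_mul, ← h, mul_zero]⟩
        have hw0 : (w : ℂ).im = 0 := by
          simp only [w]
          rw [Complex.im_ofReal_mul, ← h, mul_zero]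
        have hw1 : (w : ℂ).re < 0 := by
          simp only [w]
          rw [Complex.re_ofReal_mul]
          exact mul_neg_of_neg_of_pos (inv_lt_zero.2 hn) h1
        refine ⟨n - 1, w, Or.inr ⟨hw0, hw1⟩, ?_⟩
        rw [mk_eq_of_glue (n - 1) w z hw0 hw1.le (by
          simp only [w]
          push_cast
          field_simp), sub_add_cancel]
        rfl
    · exact ⟨n, z, Or.inl h, rfl⟩

theorem eventually_of_im_pos {n : Fin k} {z : {z : ℂ // 0 ≤ z.im}} (hz : 0 < (z : ℂ).im)
    {p : {z : ℂ // 0 ≤ z.im} → Prop} (hp : ∀ᶠ w in 𝓝 z, p w) :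
    ∀ᶠ y in 𝓝 (mk a n z), ∃ w, y = mk a n w ∧ p w := by
  have h1 : ∀ᶠ w : {z : ℂ // 0 ≤ z.im} in 𝓝 z, 0 < (w : ℂ).im :=
    (Complex.continuous_im.comp continuous_subtype_val).continuousAt.eventually (lt_mem_nhds hz)
  obtain ⟨V, hV, hVo, hzV⟩ := eventually_nhds_iff.1 (h1.and hp)
  have hN := isSaturated_interior (a := a) n (V := V) fun w hw => (hV w hw).1
  have ho := hN.isOpen ((isOpen_discrete {n}).prod hVo)
  filter_upwards [ho.mem_nhds ((hN.mk_mem_iff n z).2 ⟨rfl, hzV⟩)] with y hy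
  obtain ⟨⟨m, w⟩, ⟨hm, hw⟩, rfl⟩ := hy
  simp only [Set.mem_singleton_iff] at hm
  subst hm
  exact ⟨w, rfl, (hV w hw).2⟩

theorem ball_boundary {k : ℕ} {a : Fin k → ℝ} {n : Fin k} (hn : a n < 0)
    {z : {z : ℂ // 0 ≤ z.im}} {ε : ℝ}
    (hε : ε ≤ -(z : ℂ).re) : (∀ w : {z : ℂ // 0 ≤ z.im}, ‖(w : ℂ) - z‖ < ε → (w : ℂ).re < 0) ∧
    (∀ w : {z : ℂ // 0 ≤ z.im}, ‖(w : ℂ) - a n * z‖ < -a n * ε → 0 < (w : ℂ).re) ∧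
    ∀ x y : {z : ℂ // 0 ≤ z.im}, (y : ℂ) = (a n : ℂ) * x →
      ‖(y : ℂ) - a n * z‖ = -a n * ‖(x : ℂ) - z‖ := by
  refine ⟨fun w hw => ?_, fun w hw => ?_, fun x y h => ?_⟩
  · have h1 := (Complex.abs_re_le_norm ((w : ℂ) - z)).trans_lt hw
    rw [abs_lt, Complex.sub_re] at h1
    linarith [h1.2]
  · have h1 := (Complex.abs_re_le_norm ((w : ℂ) - a n * z)).trans_lt hw
    rw [abs_lt, Complex.sub_re, Complex.re_ofReal_mul] at h1
    nlinarith [h1.1]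
  · rw [h, ← mul_sub, norm_mul, Complex.norm_real, Real.norm_eq_abs, abs_of_neg hn]

theorem eventually_of_re_neg (ha : ∀ n, a n < 0) {n : Fin k} {z y : {z : ℂ // 0 ≤ z.im}}
    (hz' : (z : ℂ).re < 0) (hy : (y : ℂ) = a n * z) {p q : {z : ℂ // 0 ≤ z.im} → Prop}
    (hp : ∀ᶠ w in 𝓝 z, p w) (hq : ∀ᶠ w in 𝓝 y, q w) :
    ∀ᶠ x in 𝓝 (mk a n z), (∃ w, x = mk a n w ∧ p w) ∨
      ∃ w : {z : ℂ // 0 ≤ z.im}, x = mk a (n + 1) w ∧ q w ∧ ∀ x : {z : ℂ // 0 ≤ z.im},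
        (w : ℂ) = a n * x → p x := by
  obtain ⟨ε, hε, hb⟩ := Metric.eventually_nhds_iff.1 hp
  obtain ⟨ε', hε', hb'⟩ := Metric.eventually_nhds_iff.1 hq
  have hn := ha n
  -- The radius has to fit into both neighbourhoods and to keep the half-discs away from `0`; the
  -- gluing scales lengths by `-a n`.
  have hδ : 0 < min (min ε (ε' / -a n)) (-(z : ℂ).re) :=
    lt_min (lt_min hε (div_pos hε' (by linarith))) (by linarith)
  obtain ⟨b1, b2, b3⟩ := ball_boundary hn (z := z)
    (min_le_right (min ε (ε' / -a n)) (-(z : ℂ).re))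
  have hle : min (min ε (ε' / -a n)) (-(z : ℂ).re) ≤ ε := (min_le_left _ _).trans (min_le_left _ _)
  have hle' : -a n * min (min ε (ε' / -a n)) (-(z : ℂ).re) ≤ ε' :=
    calc -a n * min (min ε (ε' / -a n)) (-(z : ℂ).re) ≤ -a n * (ε' / -a n) :=
          mul_le_mul_of_nonneg_left ((min_le_left _ _).trans (min_le_right _ _)) (by linarith)
      _ = ε' := mul_div_cancel₀ _ (by linarith)
  set δ := min (min ε (ε' / -a n)) (-(z : ℂ).re) with hδdef
  have hN := isSaturated_boundary ha n (V := {w | ‖(w : ℂ) - z‖ < δ})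
    (W := {w | ‖(w : ℂ) - a n * z‖ < -a n * δ}) b1 b2 (by
      intro x y h
      rw [Set.mem_ofPred_eq, Set.mem_ofPred_eq, b3 x y h]
      exact (mul_lt_mul_iff_right₀ (by linarith [ha n])).symm)
  have hVo : IsOpen {w : {z : ℂ // 0 ≤ z.im} | ‖(w : ℂ) - z‖ < δ} :=
    isOpen_lt (by fun_prop) continuous_const
  have hWo : IsOpen {w : {z : ℂ // 0 ≤ z.im} | ‖(w : ℂ) - a n * z‖ < -a n * δ} :=
    isOpen_lt (by fun_prop) continuous_const
  have ho := hN.isOpen (((isOpen_discrete {n}).prod hVo).union ((isOpen_discrete {n + 1}).prod hWo))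
  have hmem := (hN.mk_mem_iff n z).2 (Or.inl ⟨rfl, by simpa using hδ⟩)
  have hpδ : ∀ w : {z : ℂ // 0 ≤ z.im}, ‖(w : ℂ) - z‖ < δ → p w := fun w hw => by
    apply hb
    rw [Subtype.dist_eq, dist_eq_norm]
    exact hw.trans_le hle
  filter_upwards [ho.mem_nhds hmem] with x hx
  obtain ⟨⟨m, w⟩, hmw, rfl⟩ := hx
  rcases hmw with ⟨hm, hw⟩ | ⟨hm, hw⟩
  · simp only [Set.mem_singleton_iff] at hm
    subst hm
    exact Or.inl ⟨w, rfl, hpδ w hw⟩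
  · simp only [Set.mem_singleton_iff] at hm
    subst hm
    rw [Set.mem_ofPred_eq] at hw
    refine Or.inr ⟨w, rfl, hb' ?_, fun x hx => hpδ x ?_⟩
    · rw [Subtype.dist_eq, dist_eq_norm, hy]
      exact hw.trans_le hle'
    · rw [b3 x w hx] at hw
      exact (mul_lt_mul_iff_right₀ (by linarith [ha n])).1 hw

theorem disjoint_nhds_apex (ha : ∀ n, a n < 0) {y : HalfDilationCone k a} (hy : y ≠ apex a) :
    Disjoint (𝓝 y) (𝓝 (apex a)) := by
  obtain ⟨n, z, hz | ⟨hz, hz'⟩, rfl⟩ := exists_isNormal ha hy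
  · -- An interior point of a half-plane is separated from the apex by its height.
    have h1 : height (mk a n z) ≠ height (apex a) := by
      simpa [apex] using hz.ne'
    exact Filter.Tendsto.disjoint continuous_height.continuousAt (disjoint_nhds_nhds.2 h1)
      continuous_height.continuousAt
  · -- A boundary point has a closed saturated neighbourhood of radius `δ` that misses the apex; its
    -- complement and the open neighbourhood of the same radius are disjoint.
    have hδ : 0 < -(z : ℂ).re / 2 := by linarith
    obtain ⟨b1, b2, b3⟩ := ball_boundary (ha n) (z := z) (le_refl (-(z : ℂ).re))
    set δ := -(z : ℂ).re / 2 with hδdef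
    have hn := ha n
    have hN := isSaturated_boundary ha n (V := {w | ‖(w : ℂ) - z‖ ≤ δ})
      (W := {w | ‖(w : ℂ) - a n * z‖ ≤ -a n * δ})
      (fun w hw => b1 w (lt_of_le_of_lt hw (by linarith)))
      (fun w hw => b2 w (lt_of_le_of_lt hw (by nlinarith))) (by
        intro x y h
        rw [Set.mem_ofPred_eq, Set.mem_ofPred_eq, b3 x y h]
        exact (mul_le_mul_iff_right₀ (by linarith [ha n])).symm)
    have hVc : IsClosed {w : {z : ℂ // 0 ≤ z.im} | ‖(w : ℂ) - z‖ ≤ δ} :=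
      isClosed_le (by fun_prop) continuous_const
    have hWc : IsClosed {w : {z : ℂ // 0 ≤ z.im} | ‖(w : ℂ) - a n * z‖ ≤ -a n * δ} :=
      isClosed_le (by fun_prop) continuous_const
    have hNc : IsClosed ({n} ×ˢ {w : {z : ℂ // 0 ≤ z.im} | ‖(w : ℂ) - z‖ ≤ δ} ∪
        {n + 1} ×ˢ {w : {z : ℂ // 0 ≤ z.im} | ‖(w : ℂ) - a n * z‖ ≤ -a n * δ} :
        Set (Fin k × {z : ℂ // 0 ≤ z.im})) :=
      ((isClosed_discrete {n}).prod hVc).union ((isClosed_discrete {n + 1}).prod hWc)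
    have ho := hN.compl.isOpen hNc.isOpen_compl
    have hVo : IsOpen {w : {z : ℂ // 0 ≤ z.im} | ‖(w : ℂ) - z‖ < δ} :=
      isOpen_lt (by fun_prop) continuous_const
    have hWo : IsOpen {w : {z : ℂ // 0 ≤ z.im} | ‖(w : ℂ) - a n * z‖ < -a n * δ} :=
      isOpen_lt (by fun_prop) continuous_const
    have hN' := isSaturated_boundary ha n (V := {w | ‖(w : ℂ) - z‖ < δ})
      (W := {w | ‖(w : ℂ) - a n * z‖ < -a n * δ})
      (fun w hw => b1 w (lt_of_lt_of_le hw (by linarith)))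
      (fun w hw => b2 w (lt_of_lt_of_le hw (by nlinarith))) (by
        intro x y h
        rw [Set.mem_ofPred_eq, Set.mem_ofPred_eq, b3 x y h]
        exact (mul_lt_mul_iff_right₀ (by linarith [ha n])).symm)
    have ho' := hN'.isOpen
      (((isOpen_discrete {n}).prod hVo).union ((isOpen_discrete {n + 1}).prod hWo))
    rw [Filter.disjoint_iff]
    refine ⟨_, ho'.mem_nhds ((hN'.mk_mem_iff n z).2 (Or.inl ⟨rfl, by simpa using hδ⟩)), _,
      ho.mem_nhds ((hN.compl.mk_mem_iff 0 _).2 ?_), ?_⟩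
    · rintro (⟨-, h⟩ | ⟨-, h⟩)
      · have := b1 ⟨0, le_rfl⟩ (lt_of_le_of_lt h (by linarith))
        simp at this
      · have := b2 ⟨0, le_rfl⟩ (lt_of_le_of_lt h (by nlinarith))
        simp at this
    · rw [Set.disjoint_left]
      rintro _ ⟨⟨m, w⟩, hp, rfl⟩ hq
      refine (hN.compl.mk_mem_iff m w).1 hq ?_
      rcases hp with ⟨h1, h2⟩ | ⟨h1, h2⟩
      · exact Or.inl ⟨h1, (le_of_lt h2 : ‖(w : ℂ) - z‖ ≤ δ)⟩
      · exact Or.inr ⟨h1, (le_of_lt h2 : ‖(w : ℂ) - a n * z‖ ≤ -a n * δ)⟩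

end HalfDilationCone

/-! ### Straight curves from the apex of a cone -/

namespace HalfDilationCone

variable {k : ℕ} [NeZero k] {a : Fin k → ℝ}

/-- Near the parameter `r`, the curve `F` in the cone moves in every half-plane along lines of
direction `u`. -/
def MovesAlong (F : ℝ → HalfDilationCone k a) (u : ℂ) (r : ℝ) : Prop :=
  ∀ (n : Fin k) (w : {z : ℂ // 0 ≤ z.im}), F r = mk a n w → ∃ α : ℝ, α ≠ 0 ∧ ∃ V ∈ 𝓝 w,
    ∀ᶠ r' in 𝓝[Set.Ioc 0 1] r, ∀ w' ∈ V, F r' = mk a n w' →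
      (w' : ℂ) = w + ((α * (r' - r) : ℝ) : ℂ) * u

theorem MovesAlong.height_of_pos {F : ℝ → HalfDilationCone k a} {u : ℂ} {r : ℝ}
    (hF : ContinuousWithinAt F (Set.Ioc 0 1) r) (h : MovesAlong F u r)
    {n : Fin k} {w : {z : ℂ // 0 ≤ z.im}} (hw : F r = mk a n w) (hpos : 0 < (w : ℂ).im) :
    ∃ α : ℝ, α ≠ 0 ∧ ∀ᶠ r' in 𝓝[Set.Ioc 0 1] r, ∃ w' : {z : ℂ // 0 ≤ z.im}, 0 < (w' : ℂ).im ∧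
      F r' = mk a n w' ∧ (w' : ℂ) = w + ((α * (r' - r) : ℝ) : ℂ) * u := by
  obtain ⟨α, hα, V, hV, hev⟩ := h n w hw
  refine ⟨α, hα, ?_⟩
  have h1 : ∀ᶠ w : {z : ℂ // 0 ≤ z.im} in 𝓝 w, 0 < (w : ℂ).im :=
    (Complex.continuous_im.comp continuous_subtype_val).continuousAt.eventually (lt_mem_nhds hpos)
  have h2 := eventually_of_im_pos (a := a) (n := n) hpos (h1.and hV)
  rw [← hw] at h2
  filter_upwards [hev, hF.eventually h2] with r' h3 h4
  obtain ⟨w', h5, h6, h7⟩ := h4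
  exact ⟨w', h6, h5, h3 w' h7 h5⟩

theorem MovesAlong.height_of_zero (ha : ∀ n, a n < 0) {F : ℝ → HalfDilationCone k a} {u : ℂ} {r : ℝ}
    (hF : ContinuousWithinAt F (Set.Ioc 0 1) r) (h : MovesAlong F u r)
    {n : Fin k} {w : {z : ℂ // 0 ≤ z.im}} (hw : F r = mk a n w) (hw0 : (w : ℂ).im = 0)
    (hneg : (w : ℂ).re < 0) : ∃ α β : ℝ, α ≠ 0 ∧ β ≠ 0 ∧ ∀ᶠ r' in 𝓝[Set.Ioc 0 1] r,
      height (F r') = α * (r' - r) * u.im ∨ height (F r') = β * (r' - r) * u.im := by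
  obtain ⟨α, hα, V, hV, hev⟩ := h n w hw
  let y : {z : ℂ // 0 ≤ z.im} := ⟨(a n : ℂ) * w, by rw [Complex.im_ofReal_mul, hw0, mul_zero]⟩
  have hy : mk a n w = mk a (n + 1) y := mk_eq_of_glue n w y hw0 hneg.le rfl
  obtain ⟨β, hβ, W, hW, hev'⟩ := h (n + 1) y (hw.trans hy)
  refine ⟨α, β, hα, hβ, ?_⟩
  have h1 : ∀ᶠ w' in 𝓝 w, w' ∈ V := hV
  have h2 := hF.eventually (hw ▸ eventually_of_re_neg ha hneg (y := y) rfl h1 hW)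
  filter_upwards [hev, hev', h2] with r' h3 h4 h5
  rcases h5 with ⟨w', h5, h6⟩ | ⟨w', h5, h6, -⟩
  · left
    have := congrArg Complex.im (h3 w' h6 h5)
    rw [Complex.add_im, Complex.im_ofReal_mul, hw0, zero_add] at this
    rw [h5, height_mk, this]
  · right
    have h7 := congrArg Complex.im (h4 w' h6 h5)
    have hy0 : (y : ℂ).im = 0 := by
      change ((a n : ℂ) * w).im = 0
      rw [Complex.im_ofReal_mul, hw0, mul_zero]
    rw [Complex.add_im, hy0, Complex.im_ofReal_mul, zero_add] at h7
    rw [h5, height_mk, h7]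

theorem frequently_ne {r : ℝ} (hr : r ∈ Set.Ioc (0 : ℝ) 1) {p : ℝ → Prop}
    (h : ∀ᶠ s in 𝓝[Set.Ioc 0 1] r, p s) : ∃ s ∈ Set.Ioo (0 : ℝ) r, p s := by
  have h1 : 𝓝[Set.Ioo 0 r] r ≤ 𝓝[Set.Ioc 0 1] r :=
    nhdsWithin_mono _ fun s hs => ⟨hs.1, hs.2.le.trans hr.2⟩
  have h2 : (𝓝[Set.Ioo 0 r] r).NeBot := by
    rw [← mem_closure_iff_nhdsWithin_neBot, closure_Ioo hr.1.ne]
    exact ⟨hr.1.le, le_rfl⟩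
  obtain ⟨s, hs, hs'⟩ := ((h.filter_mono h1).and self_mem_nhdsWithin).exists
  exact ⟨s, hs', hs⟩

/-- The height along a curve that starts at the apex and moves along lines which are not horizontal
is positive: otherwise it would have a local maximum where it is affine and not constant. -/
theorem height_pos (ha : ∀ n, a n < 0) {F : ℝ → HalfDilationCone k a} {u : ℂ}
    (hF : ContinuousOn F (Set.Icc 0 1)) (h0 : F 0 = apex a)
    (hne : ∀ r ∈ Set.Ioc (0 : ℝ) 1, F r ≠ apex a)
    (hmov : ∀ r ∈ Set.Ioc (0 : ℝ) 1, MovesAlong F u r) (hu : u.im ≠ 0) {r : ℝ}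
    (hr : r ∈ Set.Ioc (0 : ℝ) 1) : 0 < height (F r) := by
  by_contra hcon
  have hr0 : height (F r) = 0 := le_antisymm (not_lt.1 hcon) (height_nonneg _)
  have hsub : Set.Ioc (0 : ℝ) 1 ⊆ Set.Icc 0 1 := Set.Ioc_subset_Icc_self
  have hcw : ∀ s ∈ Set.Ioc (0 : ℝ) 1, ContinuousWithinAt F (Set.Ioc 0 1) s := fun s hs =>
    (hF s (hsub hs)).mono hsub
  -- If the height vanishes at `r`, it is positive a little earlier, so that its maximum on
  -- `[0, r]` is attained at an interior point `m`.
  have hpos : ∃ s ∈ Set.Ioo (0 : ℝ) r, 0 < height (F s) := by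
    obtain ⟨n, w, hw, hFw⟩ := exists_isNormal ha (hne r hr)
    rw [hFw, height_mk] at hr0
    rcases hw with hw | ⟨-, hw⟩
    · exact absurd hr0 hw.ne'
    obtain ⟨α, β, hα, hβ, hev⟩ := (hmov r hr).height_of_zero ha (hcw r hr) hFw hr0 hw
    obtain ⟨s, hs, hs'⟩ := frequently_ne hr hev
    have hsr : s - r ≠ 0 := (sub_neg.2 hs.2).ne
    refine ⟨s, hs, lt_of_le_of_ne (height_nonneg _) fun he => ?_⟩
    rw [← he] at hs'
    rcases hs' with h | h
    · exact mul_ne_zero (mul_ne_zero hα hsr) hu h.symm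
    · exact mul_ne_zero (mul_ne_zero hβ hsr) hu h.symm
  obtain ⟨s, hs, hspos⟩ := hpos
  have hsub' : Set.Icc 0 r ⊆ Set.Icc (0 : ℝ) 1 := Set.Icc_subset_Icc_right hr.2
  obtain ⟨m, hm, hmax⟩ := isCompact_Icc.exists_isMaxOn (Set.nonempty_Icc.2 hr.1.le)
    (continuous_height.comp_continuousOn (hF.mono hsub'))
  have hmpos : 0 < height (F m) := hspos.trans_le (hmax ⟨hs.1.le, hs.2.le⟩)
  have hm0 : 0 < m := by
    refine lt_of_le_of_ne hm.1 fun he => ?_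
    rw [← he, h0] at hmpos
    simp [apex] at hmpos
  have hmr : m < r := by
    refine lt_of_le_of_ne hm.2 fun he => ?_
    rw [he, hr0] at hmpos
    exact lt_irrefl _ hmpos
  have hmI : m ∈ Set.Ioc (0 : ℝ) 1 := ⟨hm0, hmr.le.trans hr.2⟩
  obtain ⟨n, w, hw, hFw⟩ := exists_isNormal ha (hne m hmI)
  have hwpos : 0 < (w : ℂ).im := by rwa [hFw, height_mk] at hmpos
  obtain ⟨α, hα, hev⟩ := (hmov m hmI).height_of_pos (hcw m hmI) hFw hwpos
  have hnh : 𝓝 m ≤ 𝓝[Set.Ioc 0 1] m := by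
    rw [nhdsWithin_eq_nhds.2 (Ioc_mem_nhds hm0 (hmr.trans_le hr.2))]
  obtain ⟨ε, hε, hb⟩ := Metric.eventually_nhds_iff.1 ((hev.filter_mono hnh).and
    (Ioo_mem_nhds hm0 hmr))
  -- Near `m` the height is affine with slope `α * u.im ≠ 0`, which contradicts maximality.
  have key : ∀ δ : ℝ, |δ| < ε → α * u.im * δ ≤ 0 := by
    intro δ hδ
    obtain ⟨⟨w', -, hw1, hw2⟩, hI⟩ := hb (y := m + δ) (by rw [Real.dist_eq]; simpa using hδ)
    have h1 := hmax (Set.Ioo_subset_Icc_self hI)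
    simp only [Set.mem_ofPred_eq, Function.comp, hw1, hFw, height_mk, hw2] at h1
    rw [Complex.add_im, Complex.im_ofReal_mul] at h1
    nlinarith
  have k1 := key (ε / 2) (by rw [abs_of_pos (by linarith)]; linarith)
  have k2 := key (-(ε / 2)) (by rw [abs_neg, abs_of_pos (by linarith)]; linarith)
  have : α * u.im = 0 := by nlinarith
  exact mul_ne_zero hα hu this

/-- The height along a curve that starts at the apex and moves along horizontal lines vanishes. -/
theorem height_eq_zero (ha : ∀ n, a n < 0) {F : ℝ → HalfDilationCone k a} {u : ℂ}
    (hF : ContinuousOn F (Set.Icc 0 1)) (h0 : F 0 = apex a)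
    (hne : ∀ r ∈ Set.Ioc (0 : ℝ) 1, F r ≠ apex a)
    (hmov : ∀ r ∈ Set.Ioc (0 : ℝ) 1, MovesAlong F u r) (hu : u.im = 0) {r : ℝ}
    (hr : r ∈ Set.Ioc (0 : ℝ) 1) : height (F r) = 0 := by
  have hsub : Set.Ioc (0 : ℝ) 1 ⊆ Set.Icc 0 1 := Set.Ioc_subset_Icc_self
  have hcw : ∀ s ∈ Set.Ioc (0 : ℝ) 1, ContinuousWithinAt F (Set.Ioc 0 1) s := fun s hs =>
    (hF s (hsub hs)).mono hsub
  -- The height is locally constant on `(0, 1]`, and tends to zero at the apex.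
  have hloc : ∀ s ∈ Set.Ioc (0 : ℝ) 1, ∀ᶠ s' in 𝓝[Set.Ioc 0 1] s,
      height (F s') = height (F s) := by
    intro s hs
    obtain ⟨n, w, hw, hFw⟩ := exists_isNormal ha (hne s hs)
    rcases hw with hw | ⟨hw0, hw⟩
    · obtain ⟨α, -, hev⟩ := (hmov s hs).height_of_pos (hcw s hs) hFw hw
      filter_upwards [hev] with s' hs'
      obtain ⟨w', -, h1, h2⟩ := hs'
      rw [h1, hFw, height_mk, height_mk, h2, Complex.add_im, Complex.im_ofReal_mul, hu]
      ring
    · obtain ⟨α, β, -, -, hev⟩ := (hmov s hs).height_of_zero ha (hcw s hs) hFw hw0 hw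
      filter_upwards [hev] with s' hs'
      rw [hFw, height_mk, hw0]
      rcases hs' with h | h <;> rw [h, hu, mul_zero]
  have hconst : ∀ s ∈ Set.Ioc (0 : ℝ) 1, height (F r) = height (F s) := fun s hs =>
    isPreconnected_Ioc.induction₂' (fun s s' => height (F s) = height (F s'))
      (fun s hs => (hloc s hs).mono fun s' h => ⟨h.symm, h⟩)
      (fun _ _ _ _ _ _ h1 h2 => h1.trans h2) hr hs
  have hlim : Filter.Tendsto (fun s => height (F s)) (𝓝[Set.Ioc 0 1] 0) (𝓝 0) := by
    have h1 := (continuous_height.continuousAt.comp_continuousWithinAt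
      ((hF 0 ⟨le_rfl, zero_le_one⟩).mono hsub)).tendsto
    have h2 : height (F 0) = 0 := by rw [h0]; rfl
    simpa [Function.comp_def, h2] using h1
  have hnb : (𝓝[Set.Ioc (0 : ℝ) 1] 0).NeBot := by
    rw [← mem_closure_iff_nhdsWithin_neBot, closure_Ioc zero_ne_one]
    exact ⟨le_rfl, zero_le_one⟩
  refine tendsto_nhds_unique (tendsto_const_nhds.congr' ?_) hlim
  filter_upwards [self_mem_nhdsWithin] with s hs using hconst s hs

/-- A curve that starts at the apex of a cone and moves along lines of direction `u` runs along a
ray of direction `u`. -/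
theorem exists_eq_scale (ha : ∀ n, a n < 0) {F : ℝ → HalfDilationCone k a} {u : ℂ}
    (hF : ContinuousOn F (Set.Icc 0 1)) (h0 : F 0 = apex a)
    (hne : ∀ r ∈ Set.Ioc (0 : ℝ) 1, F r ≠ apex a)
    (hmov : ∀ r ∈ Set.Ioc (0 : ℝ) 1, MovesAlong F u r) :
    ∃ (n : Fin k) (w : {z : ℂ // 0 ≤ z.im}) (α : ℝ), α ≠ 0 ∧ (w : ℂ) = α * u ∧
      ∀ (r : ℝ) (hr : 0 ≤ r), r ≤ 1 → F r = scale r hr (mk a n w) := by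
  have hsub : Set.Ioc (0 : ℝ) 1 ⊆ Set.Icc 0 1 := Set.Ioc_subset_Icc_self
  have hcw : ∀ s ∈ Set.Ioc (0 : ℝ) 1, ContinuousWithinAt F (Set.Ioc 0 1) s := fun s hs =>
    (hF s (hsub hs)).mono hsub
  -- `Q n A B r`: in the normal form, the curve is at the point `A * r + B` of the `n`-th
  -- half-plane.
  let Q : Fin k → ℂ → ℂ → ℝ → Prop := fun n A B r =>
    ∃ w : {z : ℂ // 0 ≤ z.im}, IsNormal w ∧ F r = mk a n w ∧ (w : ℂ) = A * r + B
  have hloc : ∀ s ∈ Set.Ioc (0 : ℝ) 1, ∃ n, ∃ α : ℝ, ∃ B, α ≠ 0 ∧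
      ∀ᶠ s' in 𝓝[Set.Ioc 0 1] s, Q n (α * u) B s' := by
    intro s hs
    obtain ⟨n, w, hw, hFw⟩ := exists_isNormal ha (hne s hs)
    rcases hw with hw | ⟨hw0, hw⟩
    · obtain ⟨α, hα, hev⟩ := (hmov s hs).height_of_pos (hcw s hs) hFw hw
      refine ⟨n, α, w - α * s * u, hα, ?_⟩
      filter_upwards [hev] with s' hs'
      obtain ⟨w', h1, h2, h3⟩ := hs'
      refine ⟨w', Or.inl h1, h2, ?_⟩
      rw [h3]
      push_cast
      ring
    · -- On the boundary of a half-plane: then the direction is horizontal and the curve stays on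
      -- the boundary, where points of the next half-plane can be rewritten in the normal form.
      have hu0 : u.im = 0 := by
        by_contra hu0
        have := height_pos ha hF h0 hne hmov hu0 hs
        rw [hFw, height_mk, hw0] at this
        exact lt_irrefl _ this
      obtain ⟨α, hα, V, hV, hev⟩ := hmov s hs n w hFw
      have hneg : ∀ᶠ w' : {z : ℂ // 0 ≤ z.im} in 𝓝 w, (w' : ℂ).re < 0 :=
        (Complex.continuous_re.comp continuous_subtype_val).continuousAt.eventually
          (gt_mem_nhds hw)
      have h2 := eventually_of_re_neg ha (n := n) hw
        (y := ⟨(a n : ℂ) * w, by rw [Complex.im_ofReal_mul, hw0, mul_zero]⟩) rfl (hneg.and hV)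
        (Filter.Eventually.of_forall fun _ => trivial)
      rw [← hFw] at h2
      refine ⟨n, α, w - α * s * u, hα, ?_⟩
      filter_upwards [hev, (hcw s hs).eventually h2, self_mem_nhdsWithin] with s' h3 h4 h5
      have h6 := height_eq_zero ha hF h0 hne hmov hu0 h5
      have key : ∀ w' : {z : ℂ // 0 ≤ z.im}, F s' = mk a n w' → (w' : ℂ).re < 0 → w' ∈ V →
          Q n (α * u) (w - α * s * u) s' := by
        intro w' k1 k2 k3
        refine ⟨w', Or.inr ⟨by rw [k1, height_mk] at h6; exact h6, k2⟩, k1, ?_⟩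
        rw [h3 w' k3 k1]
        push_cast
        ring
      rcases h4 with ⟨w', k1, k2, k3⟩ | ⟨w', k1, -, k2⟩
      · exact key w' k1 k2 k3
      · rw [k1, height_mk] at h6
        have han : (a n : ℂ) ≠ 0 := by exact_mod_cast (ha n).ne
        let x : {z : ℂ // 0 ≤ z.im} := ⟨((a n)⁻¹ : ℝ) * w', by
          rw [Complex.im_ofReal_mul, h6, mul_zero]⟩
        have hx : (w' : ℂ) = a n * x := by
          simp only [x]
          push_cast
          field_simp
        have hx0 : (x : ℂ).im = 0 := by
          simp only [x]
          rw [Complex.im_ofReal_mul, h6, mul_zero]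
        obtain ⟨k3, k4⟩ := k2 x hx
        refine key x ?_ k3 k4
        rw [k1, mk_eq_of_glue n x w' hx0 k3.le hx]
  -- The data at a point are unique.
  have huniq : ∀ s ∈ Set.Ioc (0 : ℝ) 1, ∀ n A B n' A' B', (∀ᶠ s' in 𝓝[Set.Ioc 0 1] s, Q n A B s') →
      (∀ᶠ s' in 𝓝[Set.Ioc 0 1] s, Q n' A' B' s') → n = n' ∧ A = A' ∧ B = B' := by
    intro s hs n A B n' A' B' h1 h2
    have step : ∀ s', Q n A B s' → Q n' A' B' s' → n = n' ∧ A * s' + B = A' * s' + B' := by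
      rintro s' ⟨w, k1, k2, k3⟩ ⟨w', l1, l2, l3⟩
      obtain ⟨e1, e2⟩ := mk_eq_mk_of_isNormal ha k1 l1 (k2.symm.trans l2)
      exact ⟨e1, by rw [← k3, ← l3, e2]⟩
    obtain ⟨e1, e2⟩ := step s (h1.self_of_nhdsWithin hs) (h2.self_of_nhdsWithin hs)
    obtain ⟨s', hs', h3, h4⟩ := frequently_ne hs (h1.and h2)
    obtain ⟨-, e3⟩ := step s' h3 h4
    have e4 : (A - A') * ((s : ℂ) - s') = 0 := by linear_combination e2 - e3
    have e5 : (s : ℂ) - s' ≠ 0 := by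
      rw [sub_ne_zero]
      exact_mod_cast hs'.2.ne'
    have e6 : A = A' := sub_eq_zero.1 ((mul_eq_zero.1 e4).resolve_right e5)
    refine ⟨e1, e6, ?_⟩
    rw [e6] at e2
    exact add_left_cancel e2
  obtain ⟨n, α, B, hα, hev⟩ := hloc 1 ⟨zero_lt_one, le_rfl⟩
  -- The data are locally constant, hence constant on `(0, 1]`.
  have hall : ∀ s ∈ Set.Ioc (0 : ℝ) 1, ∀ᶠ s' in 𝓝[Set.Ioc 0 1] s, Q n (α * u) B s' := by
    intro s hs
    refine isPreconnected_Ioc.induction₂' (fun s s' => ∀ n A B,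
      (∀ᶠ r in 𝓝[Set.Ioc 0 1] s, Q n A B r) → ∀ᶠ r in 𝓝[Set.Ioc 0 1] s', Q n A B r)
      (fun s hs => ?_) (fun _ _ _ _ _ _ h1 h2 n A B h => h2 n A B (h1 n A B h))
      (⟨zero_lt_one, le_rfl⟩ : (1 : ℝ) ∈ Set.Ioc (0 : ℝ) 1) hs n _ B hev
    obtain ⟨m, α', B', -, hev'⟩ := hloc s hs
    filter_upwards [eventually_eventually_nhdsWithin.2 hev', self_mem_nhdsWithin] with s' hs' hs''
    constructor
    · intro n A B h
      obtain ⟨rfl, rfl, rfl⟩ := huniq s hs _ _ _ _ _ _ h hev'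
      exact hs'
    · intro n A B h
      obtain ⟨rfl, rfl, rfl⟩ := huniq s' hs'' _ _ _ _ _ _ h hs'
      exact hev'
  have hQ : ∀ s ∈ Set.Ioc (0 : ℝ) 1, Q n (α * u) B s := fun s hs =>
    (hall s hs).self_of_nhdsWithin hs
  have hnb : (𝓝[Set.Ioc (0 : ℝ) 1] 0).NeBot := by
    rw [← mem_closure_iff_nhdsWithin_neBot, closure_Ioc zero_ne_one]
    exact ⟨le_rfl, zero_le_one⟩
  have hlimB : Filter.Tendsto (fun s : ℝ => α * u * (s : ℂ) + B) (𝓝[Set.Ioc 0 1] 0) (𝓝 B) := by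
    have : Continuous fun s : ℝ => α * u * (s : ℂ) + B := by fun_prop
    have h := this.tendsto 0
    simp only [Complex.ofReal_zero, mul_zero, zero_add] at h
    exact h.mono_left nhdsWithin_le_nhds
  have hBim : 0 ≤ B.im := by
    refine ge_of_tendsto ((Complex.continuous_im.tendsto B).comp hlimB) ?_
    filter_upwards [self_mem_nhdsWithin] with s hs
    obtain ⟨w, -, -, hw⟩ := hQ s hs
    rw [Function.comp, ← hw]
    exact w.2
  -- The curve starts at the apex, so the line that it runs along passes through the origin.
  have hB : B = 0 := by
    by_contra hB
    have h1 : mk a n ⟨B, hBim⟩ ≠ apex a := by rwa [Ne, mk_eq_apex_iff ha]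
    have h2 : Filter.Tendsto F (𝓝[Set.Ioc 0 1] 0) (𝓝 (apex a)) := by
      have := (hF 0 ⟨le_rfl, zero_le_one⟩).mono hsub
      rwa [ContinuousWithinAt, h0] at this
    have h3 : Filter.Tendsto F (𝓝[Set.Ioc 0 1] 0) (𝓝 (mk a n ⟨B, hBim⟩)) := by
      have : Nonempty {z : ℂ // 0 ≤ z.im} := ⟨⟨0, le_rfl⟩⟩
      choose! w hw1 hw2 hw3 using hQ
      have h4 : Filter.Tendsto w (𝓝[Set.Ioc 0 1] 0) (𝓝 ⟨B, hBim⟩) := by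
        rw [tendsto_subtype_rng]
        refine hlimB.congr' ?_
        filter_upwards [self_mem_nhdsWithin] with s hs using (hw3 s hs).symm
      refine (((continuous_mk (a := a) n).tendsto _).comp h4).congr' ?_
      filter_upwards [self_mem_nhdsWithin] with s hs using (hw2 s hs).symm
    exact (h3.not_tendsto (disjoint_nhds_apex ha h1)) h2
  obtain ⟨w, hw1, hw2, hw3⟩ := hQ 1 ⟨zero_lt_one, le_rfl⟩
  rw [hB] at hw3
  simp only [Complex.ofReal_one, mul_one, add_zero] at hw3
  refine ⟨n, w, α, hα, hw3, fun r hr hr1 => ?_⟩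
  rcases hr.eq_or_lt with h | h
  · subst h
    rw [h0, scale_mk]
    refine ((mk_eq_apex_iff ha n _).2 ?_).symm
    simp [scalePoint]
  · obtain ⟨w', -, h2, h3⟩ := hQ r ⟨h, hr1⟩
    rw [h2, scale_mk]
    congr 1
    apply Subtype.ext
    rw [h3, hB]
    simp only [scalePoint, hw3]
    ring

end HalfDilationCone

/-! ### Corners at a singularity -/

theorem HalfDilationCone.exists_eq_mul {k : ℕ} [NeZero k] {a : Fin k → ℝ} (ha : ∀ n, a n < 0)
    {n m : Fin k} {z w : {z : ℂ // 0 ≤ z.im}} (h : mk a n z = mk a m w) :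
    ∃ β : ℝ, β ≠ 0 ∧ (w : ℂ) = β * z := by
  have h1 := Quot.eqvGen_exact h
  have key : ∀ p q : Fin k × {z : ℂ // 0 ≤ z.im}, Relation.EqvGen (Glue k a) p q →
      ∃ β : ℝ, β ≠ 0 ∧ (q.2 : ℂ) = β * p.2 := by
    intro p q h
    induction h with
    | rel p q h =>
      obtain ⟨n, x, y, hx, hx', hy⟩ := h
      exact ⟨a n, (ha n).ne, hy⟩
    | refl p => exact ⟨1, one_ne_zero, by simp⟩
    | symm p q _ ih =>
      obtain ⟨β, hβ, h⟩ := ih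
      have : (β : ℂ) ≠ 0 := by exact_mod_cast hβ
      refine ⟨β⁻¹, inv_ne_zero hβ, ?_⟩
      rw [h]
      push_cast
      field_simp
    | trans p q r _ _ ih1 ih2 =>
      obtain ⟨β, hβ, h⟩ := ih1
      obtain ⟨β', hβ', h'⟩ := ih2
      refine ⟨β' * β, mul_ne_zero hβ' hβ, ?_⟩
      rw [h', h]
      push_cast
      ring
  exact key _ _ h1

namespace HalfDilationStructure

variable {X : Type*} [TopologicalSpace X] {S : HalfDilationStructure X}

/-- The map `c` is a chart at the singularity `p` with values in a half-dilation cone. -/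
structure IsConeChart (S : HalfDilationStructure X) (p : X) {k : ℕ} [NeZero k] {a : Fin k → ℝ}
    (c : OpenPartialHomeomorph X (HalfDilationCone k a)) : Prop where
  neg : ∀ n, a n < 0
  mem_source : p ∈ c.source
  map_eq : c p = HalfDilationCone.apex a
  isHalfDilationAt : ∀ (n : Fin k) (z : {z : ℂ // 0 ≤ z.im}), (z : ℂ) ≠ 0 →
    HalfDilationCone.mk a n z ∈ c.target →
    IsHalfDilationAt S.atlas (fun w => c.symm (HalfDilationCone.mk a n w)) z

theorem exists_isConeChart {p : X} (hp : p ∈ S.sing) : ∃ (k : ℕ) (_ : NeZero k) (a : Fin k → ℝ)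
    (c : OpenPartialHomeomorph X (HalfDilationCone k a)), S.IsConeChart p c := by
  obtain ⟨k, hk, a, ha, c, h1, h2, h3⟩ := S.exists_cone p hp
  exact ⟨k, hk, a, c, ha, h1, h2, h3⟩

namespace Triangulation

variable {T T' : S.Triangulation}

/-- In a chart at a singularity, the rays from the vertex of a corner are rays from the apex of the
cone, with the same direction up to sign. -/
theorem eventually_eq_scale {p : X} {k : ℕ} [NeZero k] {a : Fin k → ℝ}
    {c : OpenPartialHomeomorph X (HalfDilationCone k a)} (hc : S.IsConeChart p c)
    {i : Fin T.n} {j : Fin 3} (hp : T.map i (T.basis i j) = p) :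
    ∀ᶠ z in 𝓝[T.tri i] (T.basis i j), z ≠ T.basis i j →
      ∃ (n : Fin k) (w : {z : ℂ // 0 ≤ z.im}) (α : ℝ), α ≠ 0 ∧ (w : ℂ) = α * (z - T.basis i j) ∧
        ∀ (r : ℝ) (hr : 0 ≤ r), r ≤ 1 →
          T.map i (T.basis i j + r * (z - T.basis i j)) ∈ c.source ∧
          c (T.map i (T.basis i j + r * (z - T.basis i j)))
            = HalfDilationCone.scale r hr (HalfDilationCone.mk a n w) := by
  set v := T.basis i j with hv
  have hvt : v ∈ T.tri i := PlaneTriangle.vertex_mem _ j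
  have h1 : ∀ᶠ z in 𝓝[T.tri i] v, T.map i z ∈ c.source :=
    (T.continuousOn_tri i v hvt).eventually (c.open_source.mem_nhds (hp ▸ hc.mem_source))
  have h2 : ∀ᶠ z in 𝓝 v, ∀ l, l ≠ j → z ≠ T.basis i l := by
    rw [Filter.eventually_all]
    intro l
    by_cases hl : l = j
    · exact Filter.Eventually.of_forall fun z h => absurd hl h
    · filter_upwards [isOpen_compl_singleton.mem_nhds
        (show v ∈ ({T.basis i l} : Set ℂ)ᶜ from PlaneTriangle.vertex_ne _ (Ne.symm hl))] with z hz _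
      exact hz
  obtain ⟨δ, hδ, hb⟩ := Metric.eventually_nhds_iff_ball.1
    ((eventually_nhdsWithin_iff.1 h1).and h2)
  filter_upwards [nhdsWithin_le_nhds (Metric.ball_mem_nhds v hδ), self_mem_nhdsWithin]
    with z hz hzt hzv
  have hseg : ∀ r : ℝ, r ∈ Set.Icc (0 : ℝ) 1 → v + r * (z - v) ∈ T.tri i ∧
      v + r * (z - v) ∈ Metric.ball v δ := by
    intro r hr
    have e : v + (r : ℂ) * (z - v) = (1 - r) • v + r • z := by
      simp only [Complex.real_smul]
      push_cast
      ring
    rw [e]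
    exact ⟨(convex_convexHull ℝ _) hvt hzt (by linarith [hr.2]) hr.1 (by ring),
      (convex_ball v δ) (Metric.mem_ball_self hδ) hz (by linarith [hr.2]) hr.1 (by ring)⟩
  have hsrc : ∀ r : ℝ, r ∈ Set.Icc (0 : ℝ) 1 → T.map i (v + r * (z - v)) ∈ c.source := fun r hr =>
    (hb _ (hseg r hr).2).1 (hseg r hr).1
  have hreg : ∀ r : ℝ, r ∈ Set.Ioc (0 : ℝ) 1 → T.map i (v + r * (z - v)) ∉ S.sing := by
    intro r hr
    refine T.notMem_sing (hseg r ⟨hr.1.le, hr.2⟩).1 ?_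
    rintro ⟨l, hl⟩
    by_cases hlj : l = j
    · rw [hlj, ← hv] at hl
      have h3 : (r : ℂ) * (z - v) = 0 := by linear_combination -hl
      rcases mul_eq_zero.1 h3 with h | h
      · exact hr.1.ne' (by exact_mod_cast h)
      · exact hzv (sub_eq_zero.1 h)
    · exact (hb _ (hseg r ⟨hr.1.le, hr.2⟩).2).2 l hlj hl.symm
  have hcontγ : Continuous fun r : ℝ => v + (r : ℂ) * (z - v) := by fun_prop
  have hF1 : ContinuousOn (fun r : ℝ => c (T.map i (v + r * (z - v)))) (Set.Icc 0 1) :=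
    c.continuousOn.comp ((T.continuousOn_tri i).comp hcontγ.continuousOn
      fun r hr => (hseg r hr).1) fun r hr => hsrc r hr
  have hF2 : c (T.map i (v + ((0 : ℝ) : ℂ) * (z - v))) = HalfDilationCone.apex a := by
    simp only [Complex.ofReal_zero, zero_mul, add_zero]
    rw [hp, hc.map_eq]
  have hF3 : ∀ r ∈ Set.Ioc (0 : ℝ) 1,
      c (T.map i (v + r * (z - v))) ≠ HalfDilationCone.apex a := by
    intro r hr he
    have h3 := c.injOn (hsrc r ⟨hr.1.le, hr.2⟩) hc.mem_source (he.trans hc.map_eq.symm)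
    exact hreg r hr (h3 ▸ hp ▸ T.map_vert_mem i j)
  -- In a chart near a regular point both the parametrization of the triangle and the inverse of the
  -- cone chart are half-dilations, so that straight segments run along lines of the same direction.
  have hF4 : ∀ r ∈ Set.Ioc (0 : ℝ) 1,
      HalfDilationCone.MovesAlong (fun r : ℝ => c (T.map i (v + r * (z - v)))) (z - v) r := by
    intro r hr n w hFw
    have hrI : r ∈ Set.Icc (0 : ℝ) 1 := ⟨hr.1.le, hr.2⟩
    have hx : c.symm (HalfDilationCone.mk a n w) = T.map i (v + r * (z - v)) := by
      rw [← hFw, c.left_inv (hsrc r hrI)]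
    have hw0 : (w : ℂ) ≠ 0 := by
      intro h0
      have h4 := (HalfDilationCone.mk_eq_apex_iff hc.neg n w).2 h0
      rw [h4, ← hc.map_eq, c.left_inv hc.mem_source] at hx
      exact hreg r hr (hx ▸ hp ▸ T.map_vert_mem i j)
    have htgt : HalfDilationCone.mk a n w ∈ c.target := by
      rw [← hFw]
      exact c.map_source (hsrc r hrI)
    obtain ⟨ψ, hψ, hs, g, ⟨a0, b0, ha0, hg⟩, hev⟩ := hc.isHalfDilationAt n w hw0 htgt
    beta_reduce at hs hev ⊢
    rw [hx] at hs
    obtain ⟨A, B, hLF⟩ := T.exists_localForm (hseg r hrI).1 (hreg r hr) hψ hs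
    have ha0' : (a0 : ℂ) ≠ 0 := by exact_mod_cast ha0
    have hgw := hev.self_of_nhds.2
    rw [hx, hLF.apply_eq (hseg r hrI).1, hg] at hgw
    have hγ : Filter.Tendsto (fun r : ℝ => v + (r : ℂ) * (z - v)) (𝓝[Set.Ioc 0 1] r)
        (𝓝[T.tri i] (v + (r : ℂ) * (z - v))) := by
      refine tendsto_nhdsWithin_iff.2 ⟨(hcontγ.tendsto r).mono_left nhdsWithin_le_nhds, ?_⟩
      filter_upwards [self_mem_nhdsWithin] with s hs
      exact (hseg s ⟨hs.1.le, hs.2⟩).1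
    refine ⟨A / a0, div_ne_zero hLF.1 ha0, _, hev, ?_⟩
    filter_upwards [hγ.eventually hLF.2.2, self_mem_nhdsWithin] with r' h5 h6 w' h7 h8
    have h9 : c.symm (HalfDilationCone.mk a n w') = T.map i (v + r' * (z - v)) := by
      rw [← h8, c.left_inv (hsrc r' ⟨h6.1.le, h6.2⟩)]
    have h10 : ψ (c.symm (HalfDilationCone.mk a n w')) = g w' := h7.2
    rw [h9, h5.2, hg] at h10
    push_cast
    field_simp
    linear_combination hgw - h10
  obtain ⟨n, w, α, hα, hw, hsc⟩ := HalfDilationCone.exists_eq_scale hc.neg hF1 hF2 hF3 hF4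
  exact ⟨n, w, α, hα, hw, fun r hr hr1 => ⟨hsrc r ⟨hr, hr1⟩, hsc r hr hr1⟩⟩

theorem exists_vertex_of_mem_sing {i : Fin T.n} {z : ℂ} (hz : z ∈ T.tri i)
    (h : T.map i z ∈ S.sing) : ∃ j, z = T.basis i j := by
  by_contra hcon
  push Not at hcon
  exact T.notMem_sing hz (by rintro ⟨j, hj⟩; exact hcon j hj.symm) h

variable [T2Space X]

/-- Points near a singularity lie near the corners at that singularity. -/
theorem eventually_near_corner {p : X} (hp : p ∈ S.sing) {P : Fin T.n → Fin 3 → ℂ → Prop}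
    (hP : ∀ i j, T.map i (T.basis i j) = p → ∀ᶠ z in 𝓝[T.tri i] (T.basis i j), P i j z) :
    ∀ᶠ x in 𝓝 p, ∃ i j, ∃ z ∈ T.tri i, T.map i z = x ∧ T.map i (T.basis i j) = p ∧ P i j z := by
  have h1 : ∀ᶠ x in 𝓝 p, ∀ i, ∀ z ∈ T.tri i, T.map i z = x →
      ∃ j, T.map i (T.basis i j) = p ∧ P i j z := by
    rw [Filter.eventually_all]
    intro i
    refine (T.isCompact_tri i).eventually_fibre (T.continuousOn_tri i) ?_
    intro w hw hwp
    obtain ⟨j, rfl⟩ := exists_vertex_of_mem_sing hw (hwp ▸ hp)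
    filter_upwards [hP i j hwp] with z hz using ⟨j, hwp, hz⟩
  filter_upwards [h1] with x hx
  obtain ⟨i, z, hz, hzx⟩ := T.cover x
  obtain ⟨j, h2, h3⟩ := hx i z hz hzx
  exact ⟨i, j, z, hz, hzx, h2, h3⟩

/-- Every direction of a chart at a singularity is, up to sign, a direction of a corner there. -/
theorem exists_corner_direction (T : S.Triangulation) {p : X} (hp : p ∈ S.sing) {d : ℂ}
    (hd : 0 < d.im) :
    ∃ i j, T.map i (T.basis i j) = p ∧ ∃ z ∈ T.tri i, ∃ β : ℝ, d = β * (z - T.basis i j) := by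
  obtain ⟨k, hk, a, c, hc⟩ := S.exists_isConeChart hp
  have h1 := T.eventually_near_corner hp fun i j hij => eventually_eq_scale hc hij
  -- Follow the ray of direction `d` in the first half-plane towards the apex; a point close to
  -- the apex lies near a corner.  The absolute value keeps the ray in the half-plane for all `r`.
  let γ : ℝ → {z : ℂ // 0 ≤ z.im} := fun r => ⟨((|r| : ℝ) : ℂ) * d, by
    rw [Complex.im_ofReal_mul]
    positivity⟩
  have hγ : Continuous fun r => HalfDilationCone.mk a 0 (γ r) :=
    (HalfDilationCone.continuous_mk 0).comp (Continuous.subtype_mk (by fun_prop) _)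
  have hγ0 : HalfDilationCone.mk a 0 (γ 0) = HalfDilationCone.apex a := by
    rw [HalfDilationCone.mk_eq_apex_iff hc.neg]
    simp [γ]
  have ht : HalfDilationCone.apex a ∈ c.target := hc.map_eq ▸ c.map_source hc.mem_source
  have hlim : Filter.Tendsto (fun r => HalfDilationCone.mk a 0 (γ r)) (𝓝 0)
      (𝓝 (HalfDilationCone.apex a)) := hγ0 ▸ hγ.tendsto 0
  have hsymm : Filter.Tendsto c.symm (𝓝 (HalfDilationCone.apex a)) (𝓝 p) := by
    have := c.symm.continuousAt (x := HalfDilationCone.apex a) ht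
    rw [ContinuousAt, ← hc.map_eq, c.left_inv hc.mem_source] at this
    rwa [← hc.map_eq]
  have h2 := ((hsymm.comp hlim).eventually h1).and (hlim.eventually (c.open_target.mem_nhds ht))
  obtain ⟨ε, hε, hb⟩ := Metric.eventually_nhds_iff.1 h2
  have hε2 : (0 : ℝ) < ε / 2 := by linarith
  obtain ⟨⟨i, j, z, hz, hzx, hij, hP⟩, htgt⟩ := hb (y := ε / 2)
    (by rw [Real.dist_eq, sub_zero, abs_of_pos hε2]; linarith)
  have hγε : (γ (ε / 2) : ℂ) = ((ε / 2 : ℝ) : ℂ) * d := by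
    simp only [γ, abs_of_pos hε2]
  have hεc : ((ε / 2 : ℝ) : ℂ) ≠ 0 := by exact_mod_cast hε2.ne'
  have hd0 : d ≠ 0 := by
    rintro rfl
    simp at hd
  have hzv : z ≠ T.basis i j := by
    rintro rfl
    rw [hij] at hzx
    have h3 : c p = HalfDilationCone.mk a 0 (γ (ε / 2)) := by
      rw [hzx, Function.comp, c.right_inv htgt]
    rw [hc.map_eq] at h3
    have h4 := (HalfDilationCone.mk_eq_apex_iff hc.neg _ _).1 h3.symm
    rw [hγε] at h4
    exact mul_ne_zero hεc hd0 h4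
  obtain ⟨n, w, α, hα, hw, hsc⟩ := hP hzv
  have h5 := (hsc 1 zero_le_one le_rfl).2
  have e1 : T.basis i j + ((1 : ℝ) : ℂ) * (z - T.basis i j) = z := by push_cast; ring
  rw [e1, hzx, Function.comp, c.right_inv htgt, HalfDilationCone.scale_mk] at h5
  obtain ⟨β, hβ, h6⟩ := HalfDilationCone.exists_eq_mul hc.neg h5.symm
  rw [hγε] at h6
  refine ⟨i, j, hij, z, hz, (ε / 2)⁻¹ * (β * α), ?_⟩
  have h7 : ((ε / 2 : ℝ) : ℂ) * d = β * (α * (z - T.basis i j)) := by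
    rw [h6, ← hw]
    simp [HalfDilationCone.scalePoint]
  apply mul_left_cancel₀ hεc
  rw [h7]
  have hε0 : (ε : ℂ) ≠ 0 := by exact_mod_cast hε.ne'
  push_cast
  field_simp

/-- Near a vertex of a triangle of `T'`, a ray from that vertex coincides on the surface with a ray
from a vertex of a triangle of `T`, the parametrizations being proportional. -/
theorem eventually_radial (T : S.Triangulation) {j : Fin T'.n} {m : Fin 3} :
    ∀ᶠ z in 𝓝[T'.tri j] (T'.basis j m), z ≠ T'.basis j m → ∃ i l, ∃ w ∈ T.tri i,
      (∃ s : ℝ, s ≠ 0 ∧ w - T.basis i l = s * (z - T'.basis j m)) ∧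
      ∀ r : ℝ, 0 ≤ r → r ≤ 1 → T'.map j (T'.basis j m + r * (z - T'.basis j m))
        = T.map i (T.basis i l + r * (w - T.basis i l)) := by
  have hp : T'.map j (T'.basis j m) ∈ S.sing := T'.map_vert_mem j m
  obtain ⟨k, hk, a, c, hc⟩ := S.exists_isConeChart hp
  have h1 := T.eventually_near_corner hp fun i j hij => eventually_eq_scale hc hij
  have hvt : T'.basis j m ∈ T'.tri j := PlaneTriangle.vertex_mem _ m
  have h2 := (T'.continuousOn_tri j _ hvt).eventually h1
  filter_upwards [eventually_eq_scale (T := T') hc rfl, h2] with z h3 h4 hzv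
  obtain ⟨n', w', α', hα', hw', hsc'⟩ := h3 hzv
  obtain ⟨i, l, w, hw, hwx, hil, hP⟩ := h4
  have e1 : T'.basis j m + ((1 : ℝ) : ℂ) * (z - T'.basis j m) = z := by push_cast; ring
  have e2 : T.basis i l + ((1 : ℝ) : ℂ) * (w - T.basis i l) = w := by push_cast; ring
  have hz1 := hsc' 1 zero_le_one le_rfl
  rw [e1] at hz1
  have hone : ∀ y : HalfDilationCone k a, HalfDilationCone.scale 1 zero_le_one y = y := by
    intro y
    induction y using Quot.ind with
    | mk p =>
      obtain ⟨n, q⟩ := p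
      change HalfDilationCone.scale 1 zero_le_one (HalfDilationCone.mk a n q)
        = HalfDilationCone.mk a n q
      rw [HalfDilationCone.scale_mk]
      congr 1
      apply Subtype.ext
      simp [HalfDilationCone.scalePoint]
  rw [hone] at hz1
  have hwv : w ≠ T.basis i l := by
    rintro rfl
    rw [hil] at hwx
    rw [← hwx, hc.map_eq] at hz1
    have h5 := (HalfDilationCone.mk_eq_apex_iff hc.neg _ _).1 hz1.2.symm
    rw [hw'] at h5
    have hα'c : (α' : ℂ) ≠ 0 := by exact_mod_cast hα'
    exact mul_ne_zero hα'c (sub_ne_zero.2 hzv) h5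
  obtain ⟨n, y, α, hα, hy, hsc⟩ := hP hwv
  have hw1 := hsc 1 zero_le_one le_rfl
  rw [e2, hone, hwx] at hw1
  -- Both rays are rays of the cone through the same point, hence they agree.
  have hmk : HalfDilationCone.mk a n y = HalfDilationCone.mk a n' w' := hw1.2.symm.trans hz1.2
  obtain ⟨β, hβ, h6⟩ := HalfDilationCone.exists_eq_mul hc.neg hmk
  have hα'c : (α' : ℂ) ≠ 0 := by exact_mod_cast hα'
  have hαc : (α : ℂ) ≠ 0 := by exact_mod_cast hα
  have hβc : (β : ℂ) ≠ 0 := by exact_mod_cast hβ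
  refine ⟨i, l, w, hw, ⟨α' / (β * α), div_ne_zero hα' (mul_ne_zero hβ hα), ?_⟩, ?_⟩
  · rw [hw', hy] at h6
    push_cast
    field_simp
    linear_combination -h6
  · intro r hr hr1
    apply c.injOn (hsc' r hr hr1).1 (hsc r hr hr1).1
    rw [(hsc' r hr hr1).2, (hsc r hr hr1).2, hmk]

end Triangulation

end HalfDilationStructure

/-! ### The density of a triangulation -/

/-- A continuous function on `[0, 1]` that has an affine minorant at each interior point lies below
its chord: otherwise consider the first point where the difference is maximal. -/
theorem le_chord_of_affine_minorant {f : ℝ → ℝ} (hf : ContinuousOn f (Set.Icc 0 1))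
    (h : ∀ t ∈ Set.Ioo (0 : ℝ) 1, ∃ m : ℝ, ∀ᶠ s in 𝓝 t, f t + m * (s - t) ≤ f s) {t : ℝ}
    (ht : t ∈ Set.Icc (0 : ℝ) 1) : f t ≤ (1 - t) * f 0 + t * f 1 := by
  by_contra hcon
  push Not at hcon
  set g : ℝ → ℝ := fun s => f s - ((1 - s) * f 0 + s * f 1) with hg
  have hgc : ContinuousOn g (Set.Icc 0 1) := hf.sub (by fun_prop)
  obtain ⟨x, hx, hmax⟩ := isCompact_Icc.exists_isMaxOn ⟨t, ht⟩ hgc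
  have hA : IsCompact (Set.Icc (0 : ℝ) 1 ∩ g ⁻¹' {g x}) :=
    isCompact_Icc.of_isClosed_subset (hgc.preimage_isClosed_of_isClosed isClosed_Icc
      isClosed_singleton) Set.inter_subset_left
  -- `y` is the first point where the difference `g` to the chord attains its maximum.
  obtain ⟨y, ⟨hy, hyx⟩, hmin⟩ := hA.exists_isLeast ⟨x, hx, rfl⟩
  have hyx' : g y = g x := hyx
  have hpos : 0 < g y := by
    rw [hyx']
    exact lt_of_lt_of_le (sub_pos.2 hcon) (hmax ht)
  have hy0 : 0 < y := by
    rcases hy.1.eq_or_lt with e | e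
    · rw [← e] at hpos; simp [hg] at hpos
    · exact e
  have hy1 : y < 1 := by
    rcases hy.2.eq_or_lt with e | e
    · rw [e] at hpos; simp [hg] at hpos
    · exact e
  obtain ⟨m, hm⟩ := h y ⟨hy0, hy1⟩
  set m' := m - (f 1 - f 0) with hm'
  have hev : ∀ᶠ s in 𝓝 y, s ∈ Set.Icc (0 : ℝ) 1 ∧ g y + m' * (s - y) ≤ g s ∧ g s ≤ g y := by
    filter_upwards [hm, Icc_mem_nhds hy0 hy1] with s hs hs1
    refine ⟨hs1, ?_, hyx' ▸ hmax hs1⟩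
    simp only [hg, hm']
    linarith
  obtain ⟨ε, hε, hb⟩ := Metric.eventually_nhds_iff.1 hev
  have h1 := hb (y := y + ε / 2) (by rw [Real.dist_eq, abs_lt]; constructor <;> linarith)
  have h2 := hb (y := y - ε / 2) (by rw [Real.dist_eq, abs_lt]; constructor <;> linarith)
  -- An affine minorant at a maximum is constant, so `g` is constant near `y`.
  have h3 : m' = 0 := by nlinarith [h1.2.1, h1.2.2, h2.2.1, h2.2.2]
  rw [h3] at h2
  have h4 := hmin ⟨h2.1, show g (y - ε / 2) = g x by linarith [h2.2.1, h2.2.2]⟩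
  linarith

theorem LocalForm.change {X : Type*} [TopologicalSpace X] {φ ψ : OpenPartialHomeomorph X ℂ}
    {D : Set ℂ} {f : ℂ → X} {w : ℂ} {a a' : ℝ} {b b' : ℂ} (h : LocalForm φ D f w a b)
    (hf : ContinuousWithinAt f D w) (hs : f w ∈ ψ.source) (ha' : a' ≠ 0)
    (hψ : ∀ᶠ y in 𝓝 (f w), ψ y = a' * φ y + b') : LocalForm ψ D f w (a' * a) (a' * b + b') := by
  refine ⟨mul_ne_zero ha' h.1, hs, ?_⟩
  filter_upwards [h.2.2, hf.eventually hψ, hf.eventually (ψ.open_source.mem_nhds hs)]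
    with z h1 h2 h3
  refine ⟨h3, ?_⟩
  rw [h2, h1.2]
  push_cast
  ring

namespace HalfDilationStructure

variable {X : Type*} [TopologicalSpace X] {S : HalfDilationStructure X}

namespace Triangulation

variable {T T' : S.Triangulation}

theorem IsTransition.notMem_sing {i : Fin T.n} {j : Fin T'.n} {s : ℝ} {t w : ℂ}
    (h : IsTransition T T' i j s t w) : T.map i w ∉ S.sing := by
  obtain ⟨_, _, _, _, φ, hφ, _, _, h1, _⟩ := h
  exact S.source_subset φ hφ h1.2.1

theorem IsTransition.exists_localForm {i : Fin T.n} {j : Fin T'.n} {s : ℝ} {t w : ℂ}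
    (h : IsTransition T T' i j s t w) {ψ : OpenPartialHomeomorph X ℂ} (hψ : ψ ∈ S.atlas)
    (hs : T.map i w ∈ ψ.source) :
    ∃ a b, LocalForm ψ (T.tri i) (T.map i) w (a * s) (a * t + b) ∧
      LocalForm ψ (T'.tri j) (T'.map j) ((s : ℂ) * w + t) a b := by
  obtain ⟨_, h1, h2, h3, φ, hφ, a, b, h4, h5⟩ := h
  obtain ⟨g, ⟨a', b', ha', hg⟩, hev⟩ := S.compatible φ hφ ψ hψ _ ⟨h4.2.1, hs⟩
  simp only [hg] at hev
  refine ⟨a' * a, a' * b + b', ?_, ?_⟩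
  · have := h4.change (T.continuousOn_tri i w h1) hs ha' hev
    convert this using 1
    · ring
    · push_cast; ring
  · exact h5.change (T'.continuousOn_tri j _ h2) (h3 ▸ hs) ha' (h3 ▸ hev)

theorem exists_isTransition (T : S.Triangulation) {j : Fin T'.n} {z : ℂ} (hz : z ∈ T'.tri j)
    (hs : T'.map j z ∉ S.sing) : ∃ i s t, IsTransition T' T j i s t z := by
  obtain ⟨φ, hφ, hsrc⟩ := S.exists_chart _ hs
  obtain ⟨i, w, hw, hwx⟩ := T.cover (T'.map j z)
  obtain ⟨a, b, h⟩ := T'.exists_localForm hz hs hφ hsrc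
  obtain ⟨a', b', h'⟩ := T.exists_localForm (i := i) (w := w) hw (hwx ▸ hs) hφ (hwx ▸ hsrc)
  exact ⟨i, _, _, (isTransition_of_localForm hz hw hwx.symm hφ h h').2⟩

/-- The density `negPower` of `T`, seen in the plane of the `j`-th triangle of `T'` and made locally
piecewise affine by adding `|z|²`.  At the vertices, where no change of coordinates exists, it is
`|z|²`. -/
noncomputable def density (T T' : S.Triangulation) (j : Fin T'.n) (z : ℂ) : ℝ :=
  open Classical in
  if h : ∃ p : Fin T.n × ℝ × ℂ, IsTransition T' T j p.1 p.2.1 p.2.2 z then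
    PlaneTriangle.pull (T.basis h.choose.1) h.choose.2.1 h.choose.2.2 z
  else Complex.normSq z

theorem density_vertex (T : S.Triangulation) (j : Fin T'.n) (m : Fin 3) :
    density T T' j (T'.basis j m) = Complex.normSq (T'.basis j m) := by
  rw [density, dif_neg]
  rintro ⟨p, hp⟩
  exact hp.notMem_sing (T'.map_vert_mem j m)

variable [T2Space X]

/-- Two changes of coordinates at the same point differ by the gluing of two edges. -/
theorem IsTransition.eq_or_isGluing {j : Fin T'.n} {z : ℂ} {i i' : Fin T.n} {s s' : ℝ} {t t' : ℂ}
    (h : IsTransition T' T j i s t z) (h' : IsTransition T' T j i' s' t' z) :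
    (i = i' ∧ s = s' ∧ t = t') ∨
    ∃ k l σ τ, (s : ℂ) * z + t ∈ PlaneTriangle.openEdge (T.basis i) k ∧
      (s' : ℂ) * z + t' ∈ PlaneTriangle.openEdge (T.basis i') l ∧
      T.IsGluing (i, k) (i', l) σ τ ∧ T.AreOpposite (i, k) (i', l) ∧ s' = σ * s ∧
      t' = σ * t + τ := by
  have hs := h.notMem_sing
  obtain ⟨φ, hφ, hsrc⟩ := S.exists_chart _ hs
  obtain ⟨a, b, h1, h2⟩ := h.exists_localForm hφ hsrc
  obtain ⟨a', b', h1', h2'⟩ := h'.exists_localForm hφ hsrc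
  obtain ⟨e1, e2⟩ := h1.eq_of_eventually_tri h.2.1 h1'
  have ha : a ≠ 0 := h2.1
  have ha' : a' ≠ 0 := h2'.1
  have hac : (a' : ℂ) ≠ 0 := by exact_mod_cast ha'
  by_cases hij : i = i' ∧ (s : ℂ) * z + t = s' * z + t'
  · left
    obtain ⟨rfl, hw⟩ := hij
    rw [← hw] at h2'
    obtain ⟨rfl, rfl⟩ := h2.eq_of_eventually_tri h.2.2.1 h2'
    exact ⟨rfl, mul_left_cancel₀ ha e1, mul_left_cancel₀ hac (add_right_cancel e2)⟩
  · right
    have hx := h.2.2.2.1.symm.trans h'.2.2.2.1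
    obtain ⟨k, l, h3, h4, h5, h6⟩ := isGluing_of_localForm (fun e1 e2 => hij ⟨e1, e2⟩)
      h.2.2.1 h'.2.2.1 hx (h.2.2.2.1 ▸ hs) hφ h2 h2'
    refine ⟨k, l, _, _, h3, h4, h5, h6, ?_, ?_⟩
    · field_simp
      linear_combination -e1
    · push_cast
      field_simp
      linear_combination -e2

/-- The angle of the first of two glued triangles, seen in the plane of the second one. -/
theorem IsGluing.angle_apex {c d : T.Corner} {σ : ℝ} {τ : ℂ} (h : T.IsGluing c d σ τ) :
    EuclideanGeometry.angle (T.basis d.1 (d.2 + 1)) (σ * T.basis c.1 c.2 + τ)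
      (T.basis d.1 (d.2 + 2)) = T.angle c := by
  have hd := fun x z => PlaneTriangle.angle_halfDilation h.ne_zero τ x (T.basis c.1 c.2) z
  rcases h.endpoints with ⟨h1, h2⟩ | ⟨h1, h2⟩
  · rw [← h1, ← h2, hd]; rfl
  · rw [← h1, ← h2, hd, EuclideanGeometry.angle_comm]; rfl

/-- Across a glued edge the functions `pull` of the two triangles differ by a multiple of the
barycentric coordinate that vanishes on the edge.  The sign of the factor tells whether the edge is
Delaunay. -/
theorem IsGluing.exists_pull_sub {c d : T.Corner} {σ : ℝ} {τ : ℂ} (h : T.IsGluing c d σ τ)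
    {s : ℝ} (hs : s ≠ 0) (t : ℂ) : ∃ C : ℝ,
      (∀ ζ : ℂ, PlaneTriangle.pull (T.basis c.1) s t ζ
        - PlaneTriangle.pull (T.basis d.1) (σ * s) (σ * t + τ) ζ
        = C * (T.basis c.1).coord c.2 ((s : ℂ) * ζ + t)) ∧
      (T.angle c + T.angle d ≤ Real.pi → 0 ≤ C) ∧ (T.angle c + T.angle d < Real.pi → 0 < C) := by
  have hσ := h.ne_zero
  have hσc : (σ : ℂ) ≠ 0 := by exact_mod_cast hσ
  have hsc : (s : ℂ) ≠ 0 := by exact_mod_cast hs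
  obtain ⟨κ, hκ, hc⟩ := h.exists_coord
  set p : ℂ := σ * T.basis c.1 c.2 + τ with hp
  have hpneg : (T.basis d.1).coord d.2 p < 0 := by
    rw [hc, PlaneTriangle.coord_self]; linarith
  have hsum : T.angle c + T.angle d
      = EuclideanGeometry.angle (T.basis d.1 (d.2 + 1)) p (T.basis d.1 (d.2 + 2))
      + EuclideanGeometry.angle (T.basis d.1 (d.2 + 1)) (T.basis d.1 d.2)
        (T.basis d.1 (d.2 + 2)) := by rw [h.angle_apex]; rfl
  have hσs : 0 < (σ * s) ^ 2 := by positivity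
  -- The factor is found by evaluating at the vertex of the first triangle: it is the power of
  -- that vertex with respect to the circumcircle of the second triangle, up to scale.
  refine ⟨-PlaneTriangle.negPower (T.basis d.1) p / (σ * s) ^ 2, fun ζ => ?_, fun hle => ?_,
    fun hlt => ?_⟩
  · -- both sides are affine in `s ζ + t`; compare them at the vertices of the first triangle
    have hD : IsRealAffine fun w : ℂ => PlaneTriangle.pull (T.basis c.1) s t
        (((s⁻¹ : ℝ) : ℂ) * w + -t / s) - PlaneTriangle.pull (T.basis d.1) (σ * s) (σ * t + τ)
        (((s⁻¹ : ℝ) : ℂ) * w + -t / s) :=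
      ((PlaneTriangle.isRealAffine_pull _ hs t).sub
        (PlaneTriangle.isRealAffine_pull _ (mul_ne_zero hσ hs) _)).comp_halfDilation s⁻¹ _
    have hw : ∀ w : ℂ, (s : ℂ) * (((s⁻¹ : ℝ) : ℂ) * w + -t / s) + t = w := by
      intro w; push_cast; field_simp; ring
    have hw' : ∀ w : ℂ, ((σ * s : ℝ) : ℂ) * (((s⁻¹ : ℝ) : ℂ) * w + -t / s) + (σ * t + τ)
        = σ * w + τ := by
      intro w; push_cast; field_simp; ring
    have hv : ∀ w : ℂ, PlaneTriangle.pull (T.basis c.1) s t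
        (((s⁻¹ : ℝ) : ℂ) * w + -t / s) - PlaneTriangle.pull (T.basis d.1) (σ * s) (σ * t + τ)
        (((s⁻¹ : ℝ) : ℂ) * w + -t / s) = PlaneTriangle.negPower (T.basis c.1) w / s ^ 2
        - PlaneTriangle.negPower (T.basis d.1) (σ * w + τ) / (σ * s) ^ 2 := by
      intro w
      rw [PlaneTriangle.pull, PlaneTriangle.pull, hw, hw']
      ring
    have he : ∀ m, m ≠ c.2 → PlaneTriangle.negPower (T.basis d.1) (σ * T.basis c.1 m + τ) = 0 := by
      intro m hm
      rcases PlaneTriangle.fin3_cases c.2 m with e | e | e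
      · exact absurd e hm
      all_goals
        rw [e]
        rcases h.endpoints with ⟨h1, h2⟩ | ⟨h1, h2⟩ <;>
        simp only [h1, h2, PlaneTriangle.negPower_vertex]
    have hsumm := hD.apply_eq_sum (T.basis c.1) ((s : ℂ) * ζ + t)
    have hζ : ((s⁻¹ : ℝ) : ℂ) * ((s : ℂ) * ζ + t) + -t / s = ζ := by push_cast; field_simp; ring
    beta_reduce at hsumm
    rw [hζ] at hsumm
    rw [hsumm, Finset.sum_eq_single c.2]
    · rw [hv, PlaneTriangle.negPower_vertex]
      ring
    · intro m _ hm
      rw [hv, PlaneTriangle.negPower_vertex, he m hm]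
      ring
    · simp
  · have := PlaneTriangle.negPower_nonpos (T.basis d.1) d.2 hpneg (hsum ▸ hle)
    exact div_nonneg (by linarith) hσs.le
  · have := PlaneTriangle.negPower_neg (T.basis d.1) d.2 hpneg (hsum ▸ hlt)
    exact div_pos (by linarith) hσs

theorem IsTransition.density_eq {j : Fin T'.n} {z : ℂ} {i : Fin T.n} {s : ℝ} {t : ℂ}
    (h : IsTransition T' T j i s t z) :
    density T T' j z = PlaneTriangle.pull (T.basis i) s t z := by
  have hex : ∃ p : Fin T.n × ℝ × ℂ, IsTransition T' T j p.1 p.2.1 p.2.2 z := ⟨(i, s, t), h⟩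
  rw [density, dif_pos hex]
  generalize hp : hex.choose = p
  have h' : IsTransition T' T j p.1 p.2.1 p.2.2 z := hp ▸ hex.choose_spec
  rcases h'.eq_or_isGluing h with ⟨e1, e2, e3⟩ | ⟨k, l, σ, τ, hk, hl, hgl, -, e1, e2⟩
  · rw [e1, e2, e3]
  · obtain ⟨C, hC, -⟩ := hgl.exists_pull_sub h'.1 p.2.2
    have := hC z
    rw [hk.1, mul_zero] at this
    rw [e1, e2]
    exact sub_eq_zero.1 this

/-- For a Delaunay triangulation the density is near each regular point the maximum of two affine
functions, which are different along the edges with angle sum less than `π`. -/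
theorem IsTransition.exists_max (hT : T.IsDelaunay) {j : Fin T'.n} {z : ℂ} {i : Fin T.n} {s : ℝ}
    {t : ℂ} (h : IsTransition T' T j i s t z) : ∃ L M : ℂ → ℝ, IsRealAffine L ∧ IsRealAffine M ∧
      L z = density T T' j z ∧ M z = density T T' j z ∧
      (∀ᶠ y in 𝓝[T'.tri j] z, density T T' j y = max (L y) (M y)) ∧
      ((∀ c d, T.AreOpposite c d → T.angle c + T.angle d < Real.pi) → L = M →
        (s : ℂ) * z + t ∈ interior (T.tri i)) := by
  have hs := h.notMem_sing
  have hdz := h.density_eq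
  have hL := PlaneTriangle.isRealAffine_pull (T.basis i) h.1 t
  have hc : Filter.Tendsto (fun z : ℂ => (s : ℂ) * z + t) (𝓝[T'.tri j] z)
      (𝓝 ((s : ℂ) * z + t)) := by
    have : Continuous fun z : ℂ => (s : ℂ) * z + t := by fun_prop
    exact (this.tendsto z).mono_left nhdsWithin_le_nhds
  have hreg : (s : ℂ) * z + t ∉ Set.range (T.basis i) :=
    T.notMem_range_of_notMem_sing (h.2.2.2.1 ▸ hs)
  rcases PlaneTriangle.interior_or_edge (T.basis i) h.2.2.1 hreg with hint | ⟨k, hk⟩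
  · refine ⟨_, _, hL, hL, hdz.symm, hdz.symm, ?_, fun _ _ => hint⟩
    filter_upwards [h.eventually, hc.eventually (isOpen_interior.mem_nhds hint)] with y h1 h2
    rw [(h1 (interior_subset h2)).density_eq, max_self]
  · -- On an edge, take the functions of the triangles on both sides.  By the Delaunay condition
    -- each one is the larger one on the side of its own triangle.
    have hk' : (s : ℂ) * z + t ∈ PlaneTriangle.openEdge (T.basis i) k := hk
    obtain ⟨i', w', hw', hx, hne⟩ := exists_other hk'
    obtain ⟨φ, hφ, hsrc⟩ := S.exists_chart _ hs
    obtain ⟨a, b, h1, h2⟩ := h.exists_localForm hφ hsrc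
    have hx' := h.2.2.2.1.trans hx
    obtain ⟨a', b', h2'⟩ := T.exists_localForm hw' (hx' ▸ hs) hφ (hx' ▸ hsrc)
    obtain ⟨e, htr⟩ := isTransition_of_localForm h.2.1 hw' hx' hφ h1 h2'
    rcases h.eq_or_isGluing htr with ⟨e1, e2, e3⟩ | ⟨k', l, σ, τ, hk1, hl, hgl, hopp, e2, e3⟩
    · exact absurd (by rw [e2, e3]; exact e) (hne e1)
    have hkk : k' = k := by
      rcases PlaneTriangle.fin3_cases k k' with e | e | e
      · exact e
      · have := hk1.1; rw [e] at this; exact absurd this hk.2.1.ne'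
      · have := hk1.1; rw [e] at this; exact absurd this hk.2.2.ne'
    rw [hkk] at hgl hopp
    rw [e2, e3] at htr hl
    obtain ⟨C, hC, hC1, hC2⟩ := hgl.exists_pull_sub h.1 t
    have hM := PlaneTriangle.isRealAffine_pull (T.basis i') htr.1 (σ * t + τ)
    have hC0 := hC1 (hT _ _ hopp)
    refine ⟨_, _, hL, hM, hdz.symm, htr.density_eq.symm, ?_, fun hstr hLM => ?_⟩
    · have hc' : Filter.Tendsto (fun z : ℂ => ((σ * s : ℝ) : ℂ) * z + (σ * t + τ))
          (𝓝[T'.tri j] z) (𝓝 (((σ * s : ℝ) : ℂ) * z + (σ * t + τ))) := by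
        have : Continuous fun z : ℂ => ((σ * s : ℝ) : ℂ) * z + (σ * t + τ) := by fun_prop
        exact (this.tendsto z).mono_left nhdsWithin_le_nhds
      obtain ⟨κ, hκ, hcd⟩ := hgl.exists_coord
      filter_upwards [h.eventually, htr.eventually,
        hc.eventually (PlaneTriangle.eventually_mem_iff _ hk.2.1 hk.2.2),
        hc'.eventually (PlaneTriangle.eventually_mem_iff _ hl.2.1 hl.2.2)] with y h1 h2 h3 h4
      have hCy := hC y
      rcases le_total 0 ((T.basis i).coord k ((s : ℂ) * y + t)) with hy | hy
      · rw [(h1 (h3.1.2 hy)).density_eq, max_eq_left]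
        have := mul_nonneg hC0 hy
        linarith
      · have hy' : 0 ≤ (T.basis i').coord l (((σ * s : ℝ) : ℂ) * y + (σ * t + τ)) := by
          have := hcd ((s : ℂ) * y + t)
          have e : (σ : ℂ) * ((s : ℂ) * y + t) + τ = ((σ * s : ℝ) : ℂ) * y + (σ * t + τ) := by
            push_cast; ring
          rw [e] at this
          rw [this]
          nlinarith
        rw [(h2 (h4.1.2 hy')).density_eq, max_eq_right]
        have := mul_nonpos_of_nonneg_of_nonpos hC0 hy
        linarith
    · have hCp := hC2 (hstr _ _ hopp)
      have hsc : (s : ℂ) ≠ 0 := by exact_mod_cast h.1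
      have := hC ((T.basis i k - t) / s)
      rw [hLM, sub_self] at this
      have e : (s : ℂ) * ((T.basis i k - t) / s) + t = T.basis i k := by field_simp; ring
      rw [e, PlaneTriangle.coord_self] at this
      linarith

end Triangulation

end HalfDilationStructure

/-! ### Minimality of the Delaunay density -/

namespace HalfDilationStructure

variable {X : Type*} [TopologicalSpace X] {S : HalfDilationStructure X}

namespace Triangulation

variable {T T' : S.Triangulation} [T2Space X]

theorem continuousWithinAt_density (hT : T.IsDelaunay) {j : Fin T'.n} {z : ℂ} (hz : z ∈ T'.tri j)
    (hs : T'.map j z ∉ S.sing) : ContinuousWithinAt (density T T' j) (T'.tri j) z := by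
  obtain ⟨i, s, t, h⟩ := exists_isTransition T hz hs
  obtain ⟨L, M, hL, hM, -, -, hev, -⟩ := h.exists_max hT
  refine ContinuousWithinAt.congr_of_eventuallyEq
    (hL.continuous.max hM.continuous).continuousWithinAt hev (hev.self_of_nhdsWithin hz)

/-- The density is continuous along each ray from a vertex. -/
theorem tendsto_density_radial (T : S.Triangulation) {j : Fin T'.n} (m : Fin 3) {z : ℂ}
    (hz : z ∈ T'.tri j) (hzv : z ≠ T'.basis j m) :
    Filter.Tendsto (fun r : ℝ => density T T' j (((1 - r : ℝ) : ℂ) * T'.basis j m + (r : ℂ) * z))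
      (𝓝[>] 0) (𝓝 (Complex.normSq (T'.basis j m))) := by
  have hvt : T'.basis j m ∈ T'.tri j := PlaneTriangle.vertex_mem _ m
  set v := T'.basis j m with hv
  have hcv : Continuous fun r : ℝ => ((1 - r : ℝ) : ℂ) * v + (r : ℂ) * z := by fun_prop
  have hseg : ∀ r : ℝ, 0 ≤ r → r ≤ 1 → ((1 - r : ℝ) : ℂ) * v + (r : ℂ) * z ∈ T'.tri j := by
    intro r h0 h1
    have := (convex_convexHull ℝ (Set.range (T'.basis j))) hvt hz (a := 1 - r) (b := r)
      (by linarith) h0 (by ring)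
    simp only [Complex.real_smul] at this
    exact this
  have hlim : Filter.Tendsto (fun r : ℝ => ((1 - r : ℝ) : ℂ) * v + (r : ℂ) * z) (𝓝[>] 0)
      (𝓝[T'.tri j] v) := by
    refine tendsto_nhdsWithin_iff.2 ⟨?_, ?_⟩
    · have h2 := hcv.tendsto 0
      simp only [sub_zero, Complex.ofReal_one, one_mul, Complex.ofReal_zero, zero_mul,
        add_zero] at h2
      exact h2.mono_left nhdsWithin_le_nhds
    · filter_upwards [Ioo_mem_nhdsGT (zero_lt_one (α := ℝ))] with r hr
      exact hseg r hr.1.le hr.2.le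
  -- Near the vertex the segment lies in a single triangle of `T`, as a segment from a vertex.
  obtain ⟨r₀, h1, hr0, hr1⟩ := ((hlim.eventually
    (eventually_radial (T' := T') T (j := j) (m := m))).and
    (Ioo_mem_nhdsGT (zero_lt_one (α := ℝ)))).exists
  have hr0c : (r₀ : ℂ) ≠ 0 := by exact_mod_cast hr0.ne'
  have hzv0 : z - v ≠ 0 := sub_ne_zero.2 hzv
  have hd : ((1 - r₀ : ℝ) : ℂ) * v + (r₀ : ℂ) * z - v = r₀ * (z - v) := by push_cast; ring
  obtain ⟨i, l, w, hw, ⟨s, hs, hws⟩, hmap⟩ := h1 (by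
    rw [← sub_ne_zero, hd]; exact mul_ne_zero hr0c hzv0)
  rw [hd] at hws
  simp only [← hv, hd] at hmap
  have hwt : ∀ r : ℝ, 0 ≤ r → r ≤ 1 → T.basis i l + r * (w - T.basis i l) ∈ T.tri i := by
    intro r h0 h1
    have := (convex_convexHull ℝ (Set.range (T.basis i))) (PlaneTriangle.vertex_mem _ l) hw
      (a := 1 - r) (b := r) (by linarith) h0 (by ring)
    simp only [Complex.real_smul] at this
    have e : T.basis i l + r * (w - T.basis i l)
        = ((1 - r : ℝ) : ℂ) * T.basis i l + (r : ℂ) * w := by push_cast; ring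
    rw [e]
    exact this
  set t : ℂ := T.basis i l - s * v with ht
  have hpt : ∀ r ∈ Set.Ioo (0 : ℝ) r₀, (((1 - r : ℝ) : ℂ) * v + (r : ℂ) * z) ∈ T'.tri j ∧
      (s : ℂ) * (((1 - r : ℝ) : ℂ) * v + (r : ℂ) * z) + t ∈ T.tri i ∧
      T'.map j (((1 - r : ℝ) : ℂ) * v + (r : ℂ) * z)
        = T.map i ((s : ℂ) * (((1 - r : ℝ) : ℂ) * v + (r : ℂ) * z) + t) := by
    intro r hr
    have h0 : 0 ≤ r / r₀ := div_nonneg hr.1.le hr0.le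
    have h1 : r / r₀ ≤ 1 := (div_le_one hr0).2 hr.2.le
    have e1 : v + ((r / r₀ : ℝ) : ℂ) * (r₀ * (z - v)) = ((1 - r : ℝ) : ℂ) * v + (r : ℂ) * z := by
      push_cast; field_simp; ring
    have e2 : T.basis i l + ((r / r₀ : ℝ) : ℂ) * (w - T.basis i l)
        = (s : ℂ) * (((1 - r : ℝ) : ℂ) * v + (r : ℂ) * z) + t := by
      rw [hws, ht]; push_cast; field_simp; ring
    refine ⟨hseg r hr.1.le (hr.2.le.trans hr1.le), ?_, ?_⟩
    · rw [← e2]; exact hwt _ h0 h1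
    · rw [← e1, hmap _ h0 h1, e2, e1]
  have htr : ∀ r ∈ Set.Ioo (0 : ℝ) r₀,
      IsTransition T' T j i s t (((1 - r : ℝ) : ℂ) * v + (r : ℂ) * z) := by
    intro r hr
    obtain ⟨p1, p2, p3⟩ := hpt r hr
    refine isTransition_of_frequently hs p1 ?_ ?_
    · refine T'.notMem_sing p1 ?_
      rintro ⟨q, hq⟩
      -- a point strictly inside a segment that starts at a vertex is not a vertex
      have hqm : q ≠ m := by
        rintro rfl
        have : (r : ℂ) * (z - v) = 0 := by
          push_cast at hq
          linear_combination -hq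
        rcases mul_eq_zero.1 this with h | h
        · exact hr.1.ne' (by exact_mod_cast h)
        · exact hzv0 h
      have h2 := (PlaneTriangle.isRealAffine_coord (T'.basis j) q).apply_combo v z r
      rw [← hq, PlaneTriangle.coord_self, hv, PlaneTriangle.coord_vertex_ne _ hqm] at h2
      have h3 : (T'.basis j).coord q z ≤ 1 := by
        have := PlaneTriangle.coord_sum (T'.basis j) q z
        have hh := (PlaneTriangle.mem_iff (T'.basis j)).1 hz
        linarith [hh (q + 1), hh (q + 2)]
      have h4 := hr.2.trans hr1
      nlinarith [hr.1]
    · have h2 : ∀ᶠ r' in 𝓝 r, r' ∈ Set.Ioo (0 : ℝ) r₀ := Ioo_mem_nhds hr.1 hr.2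
      have h3 : ∀ᶠ r' in 𝓝[≠] r, r' ∈ Set.Ioo (0 : ℝ) r₀ ∧ r' ≠ r :=
        (h2.filter_mono nhdsWithin_le_nhds).and self_mem_nhdsWithin
      have h4 := (hcv.tendsto r).mono_left (nhdsWithin_le_nhds (s := {r}ᶜ))
      refine h4.frequently (h3.mono fun r' hr' => ⟨?_, hpt r' hr'.1⟩).frequently
      intro heq
      have : ((r' : ℂ) - r) * (z - v) = 0 := by
        push_cast at heq
        linear_combination heq
      rcases mul_eq_zero.1 this with h | h
      · exact hr'.2 (by exact_mod_cast sub_eq_zero.1 h)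
      · exact hzv0 h
  -- The function `negPower` of that triangle vanishes at its vertex.
  have hp : PlaneTriangle.pull (T.basis i) s t v = Complex.normSq v := by
    have e : (s : ℂ) * v + t = T.basis i l := by rw [ht]; ring
    rw [PlaneTriangle.pull, e, PlaneTriangle.negPower_vertex, zero_div, zero_add]
  have hfin : Filter.Tendsto (fun r : ℝ => PlaneTriangle.pull (T.basis i) s t
      (((1 - r : ℝ) : ℂ) * v + (r : ℂ) * z)) (𝓝[>] 0) (𝓝 (Complex.normSq v)) := by
    rw [← hp]
    exact ((PlaneTriangle.isRealAffine_pull (T.basis i) hs t).continuous.tendsto v).comp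
      (hlim.mono_right nhdsWithin_le_nhds)
  refine hfin.congr' ?_
  filter_upwards [Ioo_mem_nhdsGT hr0] with r hr
  exact (htr r hr).density_eq.symm

/-- The density of a Delaunay triangulation is convex along each segment that starts at a vertex,
continues through regular points and ends at a vertex or at a regular point. -/
theorem density_le_chord (hT : T.IsDelaunay) {j : Fin T'.n} (m : Fin 3) {z : ℂ}
    (hz : z ∈ T'.tri j) (hzv : z ≠ T'.basis j m)
    (hmid : ∀ r ∈ Set.Ioo (0 : ℝ) 1,
      ((1 - r : ℝ) : ℂ) * T'.basis j m + (r : ℂ) * z ∉ Set.range (T'.basis j))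
    {r : ℝ} (hr : r ∈ Set.Icc (0 : ℝ) 1) :
    density T T' j (((1 - r : ℝ) : ℂ) * T'.basis j m + (r : ℂ) * z)
      ≤ (1 - r) * Complex.normSq (T'.basis j m) + r * density T T' j z := by
  have hvt : T'.basis j m ∈ T'.tri j := PlaneTriangle.vertex_mem _ m
  have hseg : ∀ r ∈ Set.Icc (0 : ℝ) 1,
      ((1 - r : ℝ) : ℂ) * T'.basis j m + (r : ℂ) * z ∈ T'.tri j := by
    intro r hr
    have := (convex_convexHull ℝ (Set.range (T'.basis j))) hvt hz (a := 1 - r) (b := r)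
      (by linarith [hr.2]) hr.1 (by ring)
    simp only [Complex.real_smul] at this
    exact this
  have hcv : Continuous fun r : ℝ => ((1 - r : ℝ) : ℂ) * T'.basis j m + (r : ℂ) * z := by fun_prop
  set f : ℝ → ℝ := fun r => density T T' j (((1 - r : ℝ) : ℂ) * T'.basis j m + (r : ℂ) * z) with hf
  have hf0 : f 0 = Complex.normSq (T'.basis j m) := by
    simp only [hf]
    rw [← density_vertex T j m]
    congr 1
    push_cast; ring
  have hf1 : f 1 = density T T' j z := by
    simp only [hf]
    congr 1
    push_cast; ring
  have hreg : ∀ r ∈ Set.Icc (0 : ℝ) 1,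
      ((1 - r : ℝ) : ℂ) * T'.basis j m + (r : ℂ) * z ∉ Set.range (T'.basis j) →
      ContinuousWithinAt f (Set.Icc 0 1) r := by
    intro r hr h
    have h1 := continuousWithinAt_density hT (hseg r hr) (T'.notMem_sing (hseg r hr) h)
    exact ContinuousWithinAt.comp (t := T'.tri j) (f := fun r : ℝ =>
      ((1 - r : ℝ) : ℂ) * T'.basis j m + (r : ℂ) * z) h1 hcv.continuousWithinAt hseg
  -- At regular points continuity comes from `exists_max`, at the vertices from
  -- `tendsto_density_radial`, at the endpoint `z` with the segment reversed.
  have hcont : ContinuousOn f (Set.Icc 0 1) := by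
    intro r hr
    rcases hr.1.eq_or_lt with h0 | h0
    · rw [← h0]
      have h1 := tendsto_density_radial T m hz hzv
      rw [← hf0] at h1
      have h2 : ContinuousWithinAt f (Set.Ioi 0) 0 := h1
      exact (continuousWithinAt_Ioi_iff_Ici.1 h2).mono Set.Icc_subset_Ici_self
    rcases hr.2.eq_or_lt with h1 | h1
    · rw [h1]
      by_cases hzr : z ∈ Set.range (T'.basis j)
      · obtain ⟨q, rfl⟩ := hzr
        have h3 := tendsto_density_radial T q hvt hzv.symm
        have h4 : Filter.Tendsto (fun r : ℝ => 1 - r) (𝓝[<] 1) (𝓝[>] 0) := by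
          refine tendsto_nhdsWithin_iff.2 ⟨?_, ?_⟩
          · have : Continuous fun r : ℝ => 1 - r := by fun_prop
            have := this.tendsto 1
            rw [sub_self] at this
            exact this.mono_left nhdsWithin_le_nhds
          · filter_upwards [self_mem_nhdsWithin] with r hr
            exact sub_pos.2 (Set.mem_Iio.1 hr)
        have h5 := h3.comp h4
        rw [← density_vertex T j q, ← hf1] at h5
        have h2 : ContinuousWithinAt f (Set.Iio 1) 1 := by
          refine Filter.Tendsto.congr (fun r => ?_) h5
          simp only [hf, Function.comp]
          congr 1
          push_cast; ring
        exact (continuousWithinAt_Iio_iff_Iic.1 h2).mono Set.Icc_subset_Iic_self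
      · refine hreg 1 ⟨zero_le_one, le_rfl⟩ ?_
        convert hzr using 1
        push_cast; ring_nf
    · exact hreg r hr (hmid r ⟨h0, h1⟩)
  have := le_chord_of_affine_minorant hcont (fun r hr => ?_) hr
  · rwa [hf0, hf1] at this
  · have hr' : r ∈ Set.Icc (0 : ℝ) 1 := ⟨hr.1.le, hr.2.le⟩
    obtain ⟨i, s, t, h⟩ := exists_isTransition T (hseg r hr')
      (T'.notMem_sing (hseg r hr') (hmid r hr))
    obtain ⟨L, M, hL, hM, e1, e2, hev, -⟩ := h.exists_max hT
    -- The first of the two affine functions is the affine minorant.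
    refine ⟨L z - L (T'.basis j m), ?_⟩
    have hlim : Filter.Tendsto (fun r : ℝ => ((1 - r : ℝ) : ℂ) * T'.basis j m + (r : ℂ) * z) (𝓝 r)
        (𝓝[T'.tri j] (((1 - r : ℝ) : ℂ) * T'.basis j m + (r : ℂ) * z)) := by
      refine tendsto_nhdsWithin_iff.2 ⟨hcv.tendsto r, ?_⟩
      filter_upwards [Icc_mem_nhds hr.1 hr.2] with r' hr' using hseg r' hr'
    filter_upwards [hlim.eventually hev] with r' hr'
    have h1 := le_max_left (L (((1 - r' : ℝ) : ℂ) * T'.basis j m + (r' : ℂ) * z))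
      (M (((1 - r' : ℝ) : ℂ) * T'.basis j m + (r' : ℂ) * z))
    rw [← hr', hL.apply_combo] at h1
    have h2 : f r = (1 - r) * L (T'.basis j m) + r * L z := by
      rw [← hL.apply_combo]; exact e1.symm
    have h3 : f r' = density T T' j (((1 - r' : ℝ) : ℂ) * T'.basis j m + (r' : ℂ) * z) := rfl
    rw [h2, h3]
    linarith

/-- Among all triangulations, the Delaunay ones have the smallest density. -/
theorem density_le (hT : T.IsDelaunay) {j : Fin T'.n} {z : ℂ} (hz : z ∈ T'.tri j) :
    density T T' j z ≤ PlaneTriangle.negPower (T'.basis j) z + Complex.normSq z := by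
  set B := T'.basis j with hB
  have hA := PlaneTriangle.isRealAffine_negPower_add B
  have hv : ∀ m, density T T' j (B m) = Complex.normSq (B m) := density_vertex T j
  -- Both sides agree at the vertices, and the right side is affine.  So the inequality holds on
  -- the edges, and then on each segment from a vertex to a point of the opposite edge.
  have hedge : ∀ (k : Fin 3) {z : ℂ}, z ∈ PlaneTriangle.openEdge B k →
      density T T' j z ≤ PlaneTriangle.negPower B z + Complex.normSq z := by
    intro k z hzk
    have hsum := PlaneTriangle.coord_sum B k z
    have heq := PlaneTriangle.eq_combo B k z
    rw [hzk.1] at hsum heq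
    rw [Complex.ofReal_zero, zero_mul] at heq
    set r := B.coord (k + 2) z with hr
    have e1 : B.coord (k + 1) z = 1 - r := by linarith
    rw [e1] at heq
    have e2 : z = ((1 - r : ℝ) : ℂ) * B (k + 1) + (r : ℂ) * B (k + 2) := by
      linear_combination heq
    have hr1 : r < 1 := by linarith [hzk.2.1]
    have h1 := density_le_chord hT (k + 1) (PlaneTriangle.vertex_mem B (k + 2))
      (PlaneTriangle.vertex_ne B (PlaneTriangle.fin3_add_one_ne_add_two k)).symm
      (fun r' hr' => PlaneTriangle.notMem_range_of_mem_openEdge B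
        (PlaneTriangle.combo_mem_openEdge B k hr'.1 hr'.2)) (r := r) ⟨hzk.2.2.le, hr1.le⟩
    have h2 := hA.apply_combo (B (k + 1)) (B (k + 2)) r
    simp only [PlaneTriangle.negPower_vertex, zero_add] at h2
    rw [← hB, ← e2, hv] at h1
    rw [← e2] at h2
    linarith
  by_cases hr : z ∈ Set.range B
  · obtain ⟨m, rfl⟩ := hr
    rw [hv, PlaneTriangle.negPower_vertex, zero_add]
  rcases PlaneTriangle.interior_or_edge B hz hr with hint | ⟨k, hk⟩
  · rw [PlaneTriangle.mem_interior_iff] at hint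
    have hsum := PlaneTriangle.coord_sum B 0 z
    have heq := PlaneTriangle.eq_combo B 0 z
    set x := B.coord 0 z
    have hx1 : 0 < 1 - x := by linarith [hint (0 + 1), hint (0 + 2)]
    -- `y` is the point where the ray from the vertex `0` through `z` meets the opposite edge.
    set r := B.coord (0 + 2) z / (1 - x) with hrdef
    have hr0 : 0 < r := div_pos (hint _) hx1
    have e1 : B.coord (0 + 1) z = (1 - x) * (1 - r) := by
      rw [hrdef]; field_simp; linarith
    have e2 : B.coord (0 + 2) z = (1 - x) * r := by
      rw [hrdef]; field_simp
    have hr1 : r < 1 := by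
      have := hint (0 + 1)
      rw [e1] at this
      by_contra hcon
      push Not at hcon
      nlinarith
    have he := PlaneTriangle.combo_mem_openEdge B 0 hr0 hr1
    set y := ((1 - r : ℝ) : ℂ) * B (0 + 1) + (r : ℂ) * B (0 + 2) with hy
    have e3 : z = ((1 - (1 - x) : ℝ) : ℂ) * B 0 + ((1 - x : ℝ) : ℂ) * y := by
      rw [e1, e2] at heq
      rw [hy]
      push_cast at heq ⊢
      linear_combination heq
    have hyv := PlaneTriangle.notMem_range_of_mem_openEdge B he
    have h1 := density_le_chord (T := T) hT 0 (PlaneTriangle.openEdge_subset B 0 he)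
      (fun e => hyv ⟨0, e.symm⟩) (fun r' hr' => ?_) (r := 1 - x) ⟨hx1.le, by linarith [hint 0]⟩
    · have h2 := hA.apply_combo (B 0) y (1 - x)
      simp only [PlaneTriangle.negPower_vertex, zero_add] at h2
      rw [← hB, ← e3] at h1
      rw [← e3] at h2
      have h3 := hedge 0 he
      nlinarith
    · refine PlaneTriangle.notMem_range_of_coord B (k := 0) ?_ ?_
      · rw [(PlaneTriangle.isRealAffine_coord B _).apply_combo,
          PlaneTriangle.coord_vertex_ne B (PlaneTriangle.fin3_add_one_ne 0), mul_zero, zero_add]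
        exact mul_pos hr'.1 he.2.1
      · rw [(PlaneTriangle.isRealAffine_coord B _).apply_combo,
          PlaneTriangle.coord_vertex_ne B (PlaneTriangle.fin3_add_two_ne 0), mul_zero, zero_add]
        exact mul_pos hr'.1 he.2.2
  · exact hedge k hk

/-- All Delaunay triangulations have the same density. -/
theorem density_eq_of_isDelaunay (hT : T.IsDelaunay) (hT' : T'.IsDelaunay) {j : Fin T'.n} {z : ℂ}
    (hz : z ∈ T'.tri j) :
    density T T' j z = PlaneTriangle.negPower (T'.basis j) z + Complex.normSq z := by
  by_cases hr : z ∈ Set.range (T'.basis j)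
  · obtain ⟨m, rfl⟩ := hr
    rw [density_vertex, PlaneTriangle.negPower_vertex, zero_add]
  obtain ⟨i, s, t, h⟩ := exists_isTransition T hz (T'.notMem_sing hz hr)
  refine (density_le hT hz).antisymm ?_
  -- The reverse inequality, with the roles of the triangulations exchanged, has to be transported
  -- back by the change of coordinates, which scales densities by `s ^ 2`.
  have h1 := density_le hT' h.2.2.1
  have hs := h.1
  have hsc : (s : ℂ) ≠ 0 := by exact_mod_cast hs
  rw [h.symm.density_eq, PlaneTriangle.pull] at h1
  have e : ((s⁻¹ : ℝ) : ℂ) * ((s : ℂ) * z + t) + -t / s = z := by push_cast; field_simp; ring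
  rw [e] at h1
  rw [h.density_eq, PlaneTriangle.pull]
  have hs2 : 0 < s ^ 2 := by positivity
  have h2 : PlaneTriangle.negPower (T'.basis j) z / s⁻¹ ^ 2
      = PlaneTriangle.negPower (T'.basis j) z * s ^ 2 := by field_simp
  rw [h2] at h1
  have := (le_div_iff₀ hs2).2 (show PlaneTriangle.negPower (T'.basis j) z * s ^ 2
    ≤ PlaneTriangle.negPower (T.basis i) ((s : ℂ) * z + t) by linarith)
  linarith

/-- If all edges of `T` are strictly Delaunay, an open triangle of another Delaunay triangulation
does not meet the edges of `T`: along these the density is not affine. -/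
theorem IsTransition.mem_interior (hT : T.IsDelaunay)
    (hstr : ∀ c d, T.AreOpposite c d → T.angle c + T.angle d < Real.pi) (hT' : T'.IsDelaunay)
    {j : Fin T'.n} {z : ℂ} {i : Fin T.n} {s : ℝ} {t : ℂ} (h : IsTransition T' T j i s t z)
    (hz : z ∈ interior (T'.tri j)) : (s : ℂ) * z + t ∈ interior (T.tri i) := by
  obtain ⟨L, M, hL, hM, e1, e2, hev, hint⟩ := h.exists_max hT
  refine hint hstr ?_
  have hA := PlaneTriangle.isRealAffine_negPower_add (T'.basis j)
  have hev' : ∀ᶠ y in 𝓝 z, PlaneTriangle.negPower (T'.basis j) y + Complex.normSq y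
      = max (L y) (M y) := by
    filter_upwards [eventually_nhdsWithin_iff.1 hev, isOpen_interior.mem_nhds hz] with y h1 h2
    rw [← h1 (interior_subset h2), density_eq_of_isDelaunay hT hT' (interior_subset h2)]
  have hz0 := density_eq_of_isDelaunay hT hT' (interior_subset hz)
  -- An affine function that is the maximum of `L` and `M` near `z` equals both, since it is
  -- touched from below at `z` by each of them.
  have key : ∀ F : ℂ → ℝ, IsRealAffine F → F z = density T T' j z →
      (∀ y, F y ≤ max (L y) (M y)) → ∀ y, PlaneTriangle.negPower (T'.basis j) y + Complex.normSq y
        = F y := by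
    intro F hF hFz hle y
    refine sub_eq_zero.1 ((hA.sub hF).eq_zero_of_nonneg_near (o := z) ?_ ?_ y)
    · rw [hFz, hz0, sub_self]
    · filter_upwards [hev'] with y hy
      rw [hy]
      exact sub_nonneg.2 (hle y)
  funext y
  rw [← key L hL e1 (fun y => le_max_left _ _), ← key M hM e2 (fun y => le_max_right _ _)]

end Triangulation

end HalfDilationStructure

/-! ### Uniqueness of strict Delaunay triangulations -/

namespace HalfDilationStructure

variable {X : Type*} [TopologicalSpace X] {S : HalfDilationStructure X}

namespace Triangulation

variable {T T' : S.Triangulation} [T2Space X]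

/-- A change of coordinates at all interior points of a triangle extends to the closed triangle. -/
theorem map_eq_of_forall_interior {j : Fin T'.n} {i : Fin T.n} {s : ℝ} {t : ℂ}
    (h : ∀ z ∈ interior (T'.tri j), IsTransition T' T j i s t z) {z : ℂ} (hz : z ∈ T'.tri j) :
    (s : ℂ) * z + t ∈ T.tri i ∧ T'.map j z = T.map i ((s : ℂ) * z + t) := by
  have hcl : z ∈ closure (interior (T'.tri j)) := by
    rw [tri, PlaneTriangle.closure_interior]; exact hz
  exact map_eq_of_frequently (T := T') (T' := T) hz (p := fun y => y ∈ interior (T'.tri j))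
    (fun y hy => ⟨(h y hy).2.1, (h y hy).2.2.1, (h y hy).2.2.2.1⟩)
    (mem_closure_iff_frequently.1 hcl)

/-- If a half-dilation is the change of coordinates at all interior points of a triangle, the two
triangles are the same subset of the surface, since vertices go to vertices. -/
theorem face_eq_of_forall_interior {j : Fin T'.n} {i : Fin T.n} {s : ℝ} {t : ℂ} (hs : s ≠ 0)
    (h : ∀ z ∈ interior (T'.tri j), IsTransition T' T j i s t z) : T'.face j = T.face i := by
  have hm := fun z hz => map_eq_of_forall_interior h (z := z) hz
  have hsc : (s : ℂ) ≠ 0 := by exact_mod_cast hs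
  have hv : ∀ m, ∃ l, (s : ℂ) * T'.basis j m + t = T.basis i l := by
    intro m
    obtain ⟨h1, h2⟩ := hm _ (PlaneTriangle.vertex_mem (T'.basis j) m)
    have h3 : T.map i ((s : ℂ) * T'.basis j m + t) ∈ S.sing := h2 ▸ T'.map_vert_mem j m
    obtain ⟨l, hl⟩ := exists_vertex_of_mem_sing h1 h3
    exact ⟨l, hl⟩
  choose f hf using hv
  have hinj : Function.Injective f := by
    intro m m' hmm
    have : (s : ℂ) * T'.basis j m + t = s * T'.basis j m' + t := by rw [hf, hf, hmm]
    exact (T'.basis j).ind.injective (mul_left_cancel₀ hsc (add_right_cancel this))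
  have hsurj := Finite.injective_iff_surjective.1 hinj
  apply Set.Subset.antisymm
  · rintro _ ⟨z, hz, rfl⟩
    obtain ⟨h1, h2⟩ := hm z hz
    exact ⟨_, h1, h2.symm⟩
  · -- the inverse half-dilation maps the vertices, hence the triangle, back
    have hsub : T.tri i ⊆ (fun z : ℂ => s • z + t) '' T'.tri j := by
      refine convexHull_min ?_ ?_
      · rintro _ ⟨l, rfl⟩
        obtain ⟨m, rfl⟩ := hsurj l
        exact ⟨_, PlaneTriangle.vertex_mem (T'.basis j) m, by
          simp only [Complex.real_smul]; exact hf m⟩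
      · have h1 : Convex ℝ (T'.tri j) := convex_convexHull ℝ _
        have h2 := (h1.smul s).vadd t
        rw [← Set.image_smul, ← Set.image_vadd, Set.image_image] at h2
        have e : ∀ z : ℂ, s • z + t = t +ᵥ s • z := fun z => add_comm _ _
        simp only [e]
        exact h2
    rintro _ ⟨w, hw, rfl⟩
    obtain ⟨z, hz, rfl⟩ := hsub hw
    refine ⟨z, hz, ?_⟩
    simp only [Complex.real_smul]
    exact (hm z hz).2

/-- A Delaunay triangulation without edges of angle sum `π` is the only Delaunay triangulation. -/
theorem isUniqueDelaunay_of_forall_lt (hT : T.IsDelaunay)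
    (hstr : ∀ c d, T.AreOpposite c d → T.angle c + T.angle d < Real.pi) : T.IsUniqueDelaunay := by
  refine ⟨hT, fun T' hT' => ?_⟩
  have key : ∀ j : Fin T'.n, ∀ z₀ ∈ interior (T'.tri j), ∃ i s t,
      (s : ℂ) * z₀ + t ∈ interior (T.tri i) ∧ T'.map j z₀ = T.map i ((s : ℂ) * z₀ + t) ∧
      T'.face j = T.face i := by
    intro j z₀ hz₀
    have hreg : ∀ z ∈ interior (T'.tri j), T'.map j z ∉ S.sing := fun z hz =>
      T'.notMem_sing (interior_subset hz) (PlaneTriangle.notMem_range_of_mem_interior _ hz)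
    obtain ⟨i, s, t, h⟩ := exists_isTransition T (interior_subset hz₀) (hreg z₀ hz₀)
    refine ⟨i, s, t, h.mem_interior hT hstr hT' hz₀, h.2.2.2.1,
      face_eq_of_forall_interior (s := s) (t := t) h.1 fun z hz => ?_⟩
    -- The set of points of the open triangle where the half-dilation is the change of coordinates
    -- is open, because the image never meets the edges of `T`, and closed.
    have hpre : IsPreconnected (interior (T'.tri j)) :=
      (convex_convexHull ℝ (Set.range (T'.basis j))).interior.isPreconnected
    refine hpre.induction₂' (fun y y' => IsTransition T' T j i s t y → IsTransition T' T j i s t y')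
      (fun y hy => ?_) (fun _ _ _ _ _ _ h1 h2 h3 => h2 (h1 h3)) hz₀ hz h
    refine Filter.Eventually.and ?_ ?_
    · by_cases hG : IsTransition T' T j i s t y
      · have hc : Filter.Tendsto (fun z : ℂ => (s : ℂ) * z + t) (𝓝 y) (𝓝 ((s : ℂ) * y + t)) := by
          have : Continuous fun z : ℂ => (s : ℂ) * z + t := by fun_prop
          exact this.tendsto y
        filter_upwards [nhdsWithin_mono y interior_subset hG.eventually, nhdsWithin_le_nhds
          (hc.eventually (isOpen_interior.mem_nhds (hG.mem_interior hT hstr hT' hy)))]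
          with y' h1 h2 _ using h1 (interior_subset h2)
      · exact Filter.Eventually.of_forall fun z h => absurd h hG
    · by_cases hG : IsTransition T' T j i s t y
      · exact Filter.Eventually.of_forall fun z _ => hG
      · by_contra hcon
        apply hG
        refine isTransition_of_frequently h.1 (interior_subset hy) (hreg y hy) ?_
        have h2 : ∃ᶠ z in 𝓝[interior (T'.tri j)] y, IsTransition T' T j i s t z :=
          (Filter.not_eventually.1 hcon).mono fun z hz => by
            by_contra h3
            exact hz fun h4 => absurd h4 h3
        refine (h2.filter_mono nhdsWithin_le_nhds).mono fun z hz =>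
          ⟨?_, hz.2.1, hz.2.2.1, hz.2.2.2.1⟩
        rintro rfl
        exact hG hz
  apply Set.Subset.antisymm
  · rintro _ ⟨j, rfl⟩
    have hne : (interior (T'.tri j)).Nonempty :=
      interior_convexHull_nonempty_iff_affineSpan_eq_top.2 (T'.basis j).tot
    obtain ⟨z, hz⟩ := hne
    obtain ⟨i, _, _, _, _, h⟩ := key j z hz
    exact ⟨i, h.symm⟩
  · rintro _ ⟨i, rfl⟩
    -- a point of `T'` over an interior point of the triangle `i` which is not on an edge of `T'`
    obtain ⟨w₀, hw₀⟩ : (interior (T.tri i)).Nonempty :=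
      interior_convexHull_nonempty_iff_affineSpan_eq_top.2 (T.basis i).tot
    have hs := T.notMem_sing (interior_subset hw₀)
      (PlaneTriangle.notMem_range_of_mem_interior _ hw₀)
    obtain ⟨j, s, t, h⟩ := exists_isTransition T' (interior_subset hw₀) hs
    have hcl : (s : ℂ) * w₀ + t ∈ closure (interior (T'.tri j)) := by
      rw [tri, PlaneTriangle.closure_interior]; exact h.2.2.1
    have h' := h.symm
    have hw' : ((s⁻¹ : ℝ) : ℂ) * ((s : ℂ) * w₀ + t) + -t / s = w₀ := by
      have hsc : (s : ℂ) ≠ 0 := by exact_mod_cast h.1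
      push_cast; field_simp; ring
    have hc : Filter.Tendsto (fun z : ℂ => ((s⁻¹ : ℝ) : ℂ) * z + -t / s) (𝓝 ((s : ℂ) * w₀ + t))
        (𝓝 w₀) := by
      have : Continuous fun z : ℂ => ((s⁻¹ : ℝ) : ℂ) * z + -t / s := by fun_prop
      have := this.tendsto ((s : ℂ) * w₀ + t)
      rwa [hw'] at this
    obtain ⟨z, hz, hz1, hz2⟩ := ((mem_closure_iff_frequently.1 hcl).and_eventually
      ((eventually_nhdsWithin_iff.1 h'.eventually).and
        (hc.eventually (isOpen_interior.mem_nhds hw₀)))).exists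
    have htr := hz1 (interior_subset hz) (interior_subset hz2)
    obtain ⟨i', s', t', h1, h2, h3⟩ := key j z hz
    have h4 := htr.2.2.2.1
    rw [h2] at h4
    obtain ⟨rfl, -⟩ := eq_of_mem_interior h1 (interior_subset hz2) h4
    exact ⟨j, h3⟩

end Triangulation

end HalfDilationStructure

/-! ### Angle sums at the singularities -/

namespace PlaneTriangle

/-- If `ψ` is the argument of `u' / u`, the points between the rays through `u` and `u'` have
arguments between those of `u` and `u'`. -/
theorem exists_eq_mul_exp {u u' : ℂ} (hu : u ≠ 0) (hψ : 0 < (u' / u).arg)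
    (hψ' : (u' / u).arg < Real.pi) {x y : ℝ} (hx : 0 ≤ x) (hy : 0 ≤ y) :
    ∃ χ : ℝ, 0 ≤ χ ∧ χ ≤ (u' / u).arg ∧
      ∃ R : ℝ, x * u + y * u' = R * Complex.exp (χ * Complex.I) * u := by
  set ψ := (u' / u).arg with hψdef
  set q : ℂ := x + y * (u' / u) with hq
  have hquu : x * u + y * u' = q * u := by rw [hq]; field_simp
  by_cases hq0 : q = 0
  · exact ⟨0, le_rfl, hψ.le, 0, by rw [hquu, hq0]; simp⟩
  have hpol := Complex.norm_mul_exp_arg_mul_I (u' / u)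
  rw [← hψdef] at hpol
  set ρ := ‖u' / u‖ with hρ
  have hρ0 : 0 ≤ ρ := norm_nonneg _
  have hre : (u' / u).re = ρ * Real.cos ψ := by
    rw [← hpol]; simp [Complex.exp_re]
  have him : (u' / u).im = ρ * Real.sin ψ := by
    rw [← hpol]; simp [Complex.exp_im]
  have hsin : 0 < Real.sin ψ := Real.sin_pos_of_pos_of_lt_pi hψ hψ'
  have hpolq := Complex.norm_mul_exp_arg_mul_I q
  set χ := q.arg with hχ
  have hN : 0 < ‖q‖ := norm_pos_iff.2 hq0
  have hqre : q.re = ‖q‖ * Real.cos χ := by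
    conv_lhs => rw [← hpolq]
    simp [Complex.exp_re]
  have hqim : q.im = ‖q‖ * Real.sin χ := by
    conv_lhs => rw [← hpolq]
    simp [Complex.exp_im]
  have hre' : q.re = x + y * (ρ * Real.cos ψ) := by rw [hq]; simp [hre]
  have him' : q.im = y * (ρ * Real.sin ψ) := by rw [hq]; simp [him]
  have hχ0 : 0 ≤ χ := by
    rw [hχ, Complex.arg_nonneg_iff, him']
    positivity
  refine ⟨χ, hχ0, ?_, ‖q‖, by rw [hquu, hpolq]⟩
  -- Otherwise `q` would lie on the wrong side of `u' / u`.
  by_contra hcon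
  push Not at hcon
  have h1 : 0 < Real.sin (χ - ψ) :=
    Real.sin_pos_of_pos_of_lt_pi (by linarith) (by linarith [Complex.arg_le_pi q])
  have h2 : ‖q‖ * Real.sin (χ - ψ) = -(x * Real.sin ψ) := by
    rw [Real.sin_sub]
    have h3 : ‖q‖ * Real.sin χ = y * (ρ * Real.sin ψ) := by rw [← hqim, him']
    have h4 : ‖q‖ * Real.cos χ = x + y * (ρ * Real.cos ψ) := by rw [← hqre, hre']
    linear_combination Real.cos ψ * h3 - Real.sin ψ * h4
  have h3 := mul_pos hN h1
  have h4 := mul_nonneg hx hsin.le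
  linarith

instance fact_pi_pos : Fact (0 < Real.pi) := ⟨Real.pi_pos⟩

theorem norm_coe_addCircle_le (x : ℝ) : ‖(x : AddCircle Real.pi)‖ ≤ |x| :=
  QuotientAddGroup.norm_mk_le_norm

/-- Modulo `π` the directions from a corner into the triangle form an arc that is as long as the
angle at the corner. -/
theorem exists_center (b : AffineBasis (Fin 3) ℝ ℂ) (k : Fin 3) : ∃ o : AddCircle Real.pi,
    ∀ z ∈ convexHull ℝ (Set.range b), ∀ β φ : ℝ,
      Complex.exp (φ * Complex.I) = β * (z - b k) → (φ : AddCircle Real.pi) ∈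
        Metric.closedBall o (EuclideanGeometry.angle (b (k + 1)) (b k) (b (k + 2)) / 2) := by
  -- it suffices to argue for one orientation of the two sides
  have key : ∀ k₁ k₂ : Fin 3, (∀ z : ℂ, b.coord k z + b.coord k₁ z + b.coord k₂ z = 1) →
      (∀ z, z = (b.coord k z : ℂ) * b k + (b.coord k₁ z : ℂ) * b k₁ + (b.coord k₂ z : ℂ) * b k₂) →
      b k₁ - b k ≠ 0 → 0 < ((b k₂ - b k) / (b k₁ - b k)).arg →
      ((b k₂ - b k) / (b k₁ - b k)).arg < Real.pi → ∃ o : AddCircle Real.pi,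
      ∀ z ∈ convexHull ℝ (Set.range b), ∀ β φ : ℝ,
      Complex.exp (φ * Complex.I) = β * (z - b k) → (φ : AddCircle Real.pi) ∈
        Metric.closedBall o (((b k₂ - b k) / (b k₁ - b k)).arg / 2) := by
    intro k₁ k₂ hsum heq hu h0 h1
    set u := b k₁ - b k with hudef
    set u' := b k₂ - b k
    set ψ := (u' / u).arg
    refine ⟨((u.arg + ψ / 2 : ℝ) : AddCircle Real.pi), fun z hz β φ h => ?_⟩
    have hz' := (mem_iff b).1 hz
    obtain ⟨χ, hχ0, hχ1, R, hR⟩ := exists_eq_mul_exp hu h0 h1 (hz' k₁) (hz' k₂)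
    have hzk : z - b k = (b.coord k₁ z : ℂ) * u + (b.coord k₂ z : ℂ) * u' := by
      have h2 := hsum z
      have h3 : b.coord k z = 1 - b.coord k₁ z - b.coord k₂ z := by linarith
      conv_lhs => rw [heq z, h3]
      push_cast
      ring
    have hup := Complex.norm_mul_exp_arg_mul_I u
    rw [hzk, hR, ← hup] at h
    -- hence `φ` and `arg u + χ` agree modulo `π`
    have h4 : Complex.exp (((φ - u.arg - χ : ℝ) : ℂ) * Complex.I) = ((β * R * ‖u‖ : ℝ) : ℂ) := by
      have e : ((φ - u.arg - χ : ℝ) : ℂ) * Complex.I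
          = φ * Complex.I - u.arg * Complex.I - χ * Complex.I := by push_cast; ring
      rw [e, Complex.exp_sub, Complex.exp_sub, h]
      have h5 := Complex.exp_ne_zero (u.arg * Complex.I)
      have h6 := Complex.exp_ne_zero (χ * Complex.I)
      field_simp
      push_cast
      ring
    have h5 := congrArg Complex.im h4
    rw [Complex.exp_ofReal_mul_I_im, Complex.ofReal_im] at h5
    obtain ⟨n, hn⟩ := Real.sin_eq_zero_iff.1 h5
    have h6 : (φ : AddCircle Real.pi) - ((u.arg + ψ / 2 : ℝ) : AddCircle Real.pi)
        = ((χ - ψ / 2 : ℝ) : AddCircle Real.pi) := by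
      have e : φ = u.arg + χ + n * Real.pi := by linarith
      have e2 : ((n * Real.pi : ℝ) : AddCircle Real.pi) = 0 := by
        rw [← zsmul_eq_mul, AddCircle.coe_zsmul, AddCircle.coe_period, smul_zero]
      rw [e, AddCircle.coe_add, e2, add_zero, ← AddCircle.coe_sub]
      congr 1
      ring
    rw [Metric.mem_closedBall, dist_eq_norm, h6]
    refine (norm_coe_addCircle_le _).trans (abs_le.2 ⟨?_, ?_⟩) <;> linarith
  have hu1 : b (k + 1) - b k ≠ 0 := sub_ne_zero.2 (vertex_ne b (fin3_add_one_ne k))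
  have hu2 : b (k + 2) - b k ≠ 0 := sub_ne_zero.2 (vertex_ne b (fin3_add_two_ne k))
  have hang := angle_vertex_pos_lt b k
  rw [EuclideanGeometry.angle, vsub_eq_sub, vsub_eq_sub] at hang ⊢
  rcases lt_or_ge 0 ((b (k + 2) - b k) / (b (k + 1) - b k)).arg with h | h
  · rw [InnerProductGeometry.angle_comm, Complex.angle_eq_abs_arg hu2 hu1, abs_of_pos h] at hang ⊢
    exact key (k + 1) (k + 2) (coord_sum b k) (eq_combo b k) hu1 h hang.2
  · have h3 := hang
    rw [InnerProductGeometry.angle_comm, Complex.angle_eq_abs_arg hu2 hu1, abs_of_nonpos h] at h3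
    have h4 : ((b (k + 1) - b k) / (b (k + 2) - b k)).arg
        = -((b (k + 2) - b k) / (b (k + 1) - b k)).arg := by
      rw [← inv_div, Complex.arg_inv, if_neg]
      linarith [Real.pi_pos]
    rw [Complex.angle_eq_abs_arg hu1 hu2, h4, abs_of_pos (by linarith), ← h4]
    refine key (k + 2) (k + 1) (fun z => ?_) (fun z => ?_) hu2 ?_ ?_
    · rw [← coord_sum b k z]; ring
    · conv_lhs => rw [eq_combo b k z]
      ring
    · rw [h4]; linarith
    · rw [h4]; linarith

end PlaneTriangle

namespace HalfDilationStructure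

variable {X : Type*} [TopologicalSpace X] {S : HalfDilationStructure X}

namespace Triangulation

variable (T : S.Triangulation)

theorem angle_pos (c : T.Corner) : 0 < T.angle c :=
  (PlaneTriangle.angle_vertex_pos_lt (T.basis c.1) c.2).1

theorem angle_sum (i : Fin T.n) : T.angle (i, 0) + T.angle (i, 1) + T.angle (i, 2) = Real.pi := by
  have h := EuclideanGeometry.angle_add_angle_add_angle_eq_pi (p₁ := T.basis i 2)
    (p₂ := T.basis i 0) (T.basis i 1) (PlaneTriangle.vertex_ne (T.basis i) (by decide))
  have e0 : T.angle (i, 0)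
      = EuclideanGeometry.angle (T.basis i 2) (T.basis i 0) (T.basis i 1) :=
    EuclideanGeometry.angle_comm _ _ _
  have e1 : T.angle (i, 1)
      = EuclideanGeometry.angle (T.basis i 0) (T.basis i 1) (T.basis i 2) :=
    EuclideanGeometry.angle_comm _ _ _
  have e2 : T.angle (i, 2)
      = EuclideanGeometry.angle (T.basis i 1) (T.basis i 2) (T.basis i 0) :=
    EuclideanGeometry.angle_comm _ _ _
  rw [e0, e1, e2]
  exact h

open Classical in
/-- The angles around a singularity add up to at least `π`, since the directions of the triangles
cover all directions modulo half-turns. -/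
theorem pi_le_sum_angle [T2Space X] {p : X} (hp : p ∈ S.sing) :
    Real.pi ≤ ∑ c : T.Corner with T.vertex c = p, T.angle c := by
  choose o ho using fun c : T.Corner => PlaneTriangle.exists_center (T.basis c.1) c.2
  -- The direction `0` is parallel to the boundary of the half-planes and is treated separately;
  -- a point has measure zero.
  have hcov : (Set.univ : Set (AddCircle Real.pi)) ⊆ Metric.closedBall 0 0 ∪
      ⋃ c ∈ (Finset.univ.filter fun c : T.Corner => T.vertex c = p),
        Metric.closedBall (o c) (T.angle c / 2) := by
    intro x _
    obtain ⟨φ, hφ, rfl⟩ := AddCircle.eq_coe_Ico x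
    rcases hφ.1.eq_or_lt with h0 | h0
    · left
      rw [← h0]
      simp
    · right
      have him : 0 < (Complex.exp (φ * Complex.I)).im := by
        rw [Complex.exp_ofReal_mul_I_im]
        exact Real.sin_pos_of_pos_of_lt_pi h0 hφ.2
      obtain ⟨i, j, hij, z, hz, β, hβ⟩ := T.exists_corner_direction hp him
      exact Set.mem_iUnion₂.2 ⟨(i, j), Finset.mem_filter.2 ⟨Finset.mem_univ _, hij⟩,
        ho (i, j) z hz β φ hβ⟩
  have h1 := MeasureTheory.measure_mono (μ := MeasureTheory.volume) hcov
  rw [AddCircle.measure_univ] at h1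
  have h2 : ENNReal.ofReal Real.pi
      ≤ ENNReal.ofReal (∑ c : T.Corner with T.vertex c = p, T.angle c) := by
    refine h1.trans ((MeasureTheory.measure_union_le _ _).trans ?_)
    rw [AddCircle.volume_closedBall, mul_zero, min_eq_right Real.pi_pos.le, ENNReal.ofReal_zero,
      zero_add, ENNReal.ofReal_sum_of_nonneg fun c _ => (T.angle_pos c).le]
    refine (MeasureTheory.measure_biUnion_finset_le _ _).trans (Finset.sum_le_sum fun c _ => ?_)
    rw [AddCircle.volume_closedBall]
    refine ENNReal.ofReal_le_ofReal ((min_le_right _ _).trans ?_)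
    linarith
  rwa [ENNReal.ofReal_le_ofReal_iff] at h2
  exact Finset.sum_nonneg fun c _ => (T.angle_pos c).le

theorem vertex_mem_sing (c : T.Corner) : T.vertex c ∈ S.sing := T.map_vert_mem c.1 c.2

open Classical in
/-- If there are as many triangles as singularities, the total angle at each singularity is `π`. -/
theorem sum_angle_eq_pi [T2Space X] (hn : S.sing.card = T.n) {p : X} (hp : p ∈ S.sing) :
    ∑ c : T.Corner with T.vertex c = p, T.angle c = Real.pi := by
  have h1 : ∑ q ∈ S.sing, ∑ c : T.Corner with T.vertex c = q, T.angle c = ∑ c, T.angle c :=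
    Finset.sum_fiberwise_of_maps_to (fun c _ => T.vertex_mem_sing c) _
  have h2 : ∑ c : T.Corner, T.angle c = ∑ q ∈ S.sing, Real.pi := by
    rw [Fintype.sum_prod_type]
    have : ∀ i, ∑ j, T.angle (i, j) = Real.pi := fun i => by
      rw [Fin.sum_univ_three]; exact T.angle_sum i
    simp only [this, Finset.sum_const, Finset.card_univ, Fintype.card_fin, hn]
  rw [h2] at h1
  have h3 := (Finset.sum_eq_sum_iff_of_le fun q hq => T.pi_le_sum_angle hq).1 h1.symm
  exact (h3 p hp).symm

/-- The singularities on an edge are its endpoints. -/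
theorem mem_edge_sing_iff {c : T.Corner} {x : X} : (x ∈ T.edge c ∧ x ∈ S.sing) ↔
    x = T.vertex (c.1, c.2 + 1) ∨ x = T.vertex (c.1, c.2 + 2) := by
  constructor
  · rintro ⟨⟨z, hz, rfl⟩, hx⟩
    have hz' := (PlaneTriangle.mem_edge_iff (T.basis c.1) c.2).1 hz
    obtain ⟨m, rfl⟩ := exists_vertex_of_mem_sing hz'.1 hx
    rcases PlaneTriangle.fin3_cases c.2 m with rfl | rfl | rfl
    · rw [PlaneTriangle.coord_self] at hz'
      exact absurd hz'.2 one_ne_zero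
    · exact Or.inl rfl
    · exact Or.inr rfl
  · rintro (rfl | rfl)
    · exact ⟨⟨_, left_mem_segment ℝ _ _, rfl⟩, T.vertex_mem_sing _⟩
    · exact ⟨⟨_, right_mem_segment ℝ _ _, rfl⟩, T.vertex_mem_sing _⟩

end Triangulation

end HalfDilationStructure

/-! ### Tetrahedral triangulations -/

/-- If the off-diagonal entries of a 4×4 array have all row sums and all column sums equal to `π`,
the symmetrized entries at `{i, j}` and at the complementary pair agree; so if the symmetrized
entries in one row are less than `π`, all are. -/
theorem add_transpose_lt_pi {θ : Fin 4 → Fin 4 → ℝ} (hrow : ∀ i, ∑ j, θ i j = Real.pi)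
    (hcol : ∀ j, ∑ i, θ i j = Real.pi) (hdiag : ∀ i, θ i i = 0) {a : Fin 4}
    (ha : ∀ k, k ≠ a → θ a k + θ k a < Real.pi) {i j : Fin 4} (hij : i ≠ j) :
    θ i j + θ j i < Real.pi := by
  have hE : ∀ i, ∑ j, (θ i j + θ j i) = 2 * Real.pi := fun i => by
    rw [Finset.sum_add_distrib, hrow, hcol]; ring
  generalize hEdef : (fun i j => θ i j + θ j i) = E at *
  have hEij : ∀ i j, θ i j + θ j i = E i j := fun i j => by rw [← hEdef]
  have hsym : ∀ i j, E i j = E j i := fun i j => by rw [← hEdef]; exact add_comm _ _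
  have hd : ∀ i, E i i = 0 := fun i => by rw [← hEdef]; simp [hdiag]
  simp only [hEij, Fin.sum_univ_four] at hE ha ⊢
  have h0 := hE 0
  have h1 := hE 1
  have h2 := hE 2
  have h3 := hE 3
  rw [hd] at h0 h1 h2 h3
  rw [hsym 1 0] at h1
  rw [hsym 2 0, hsym 2 1] at h2
  rw [hsym 3 0, hsym 3 1, hsym 3 2] at h3
  -- All row sums of the symmetric array `E` are equal, so complementary entries agree.
  have e1 : E 0 1 = E 2 3 := by linarith
  have e2 : E 0 2 = E 1 3 := by linarith
  have e3 : E 0 3 = E 1 2 := by linarith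
  have hall : E 0 1 < Real.pi ∧ E 0 2 < Real.pi ∧ E 0 3 < Real.pi := by
    fin_cases a
    · exact ⟨ha 1 (by decide), ha 2 (by decide), ha 3 (by decide)⟩
    · refine ⟨hsym 0 1 ▸ ha 0 (by decide), e2 ▸ ha 3 (by decide), e3 ▸ ha 2 (by decide)⟩
    · refine ⟨e1 ▸ ha 3 (by decide), hsym 0 2 ▸ ha 0 (by decide), e3 ▸ hsym 1 2 ▸ ha 1 (by decide)⟩
    · refine ⟨e1 ▸ hsym 2 3 ▸ ha 2 (by decide), e2 ▸ hsym 1 3 ▸ ha 1 (by decide),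
        hsym 0 3 ▸ ha 0 (by decide)⟩
  obtain ⟨b1, b2, b3⟩ := hall
  have b4 := e1 ▸ b1
  have b5 := e2 ▸ b2
  have b6 := e3 ▸ b3
  fin_cases i <;> fin_cases j <;> first
    | exact absurd rfl hij
    | assumption
    | (rw [hsym]; assumption)

namespace HalfDilationStructure

variable {X : Type*} [TopologicalSpace X] {S : HalfDilationStructure X}

namespace Triangulation

variable {T : S.Triangulation}

/-- In a tetrahedral triangulation the corner `c` of the triangle that misses `p` which sits at `q`
is opposite the corner at `p` of the triangle that misses `q`. -/
theorem eq_vertex_of_areOpposite {e : Fin T.n ≃ {p : X // p ∈ S.sing}}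
    (he : ∀ i, Set.range (fun j => T.vertex (i, j)) = {p | p ∈ S.sing ∧ p ≠ e i})
    (hinj : ∀ i, Function.Injective fun j => T.vertex (i, j)) {c d : T.Corner}
    (h : T.AreOpposite c d) : (e c.1 : X) = T.vertex d ∧ (e d.1 : X) = T.vertex c := by
  -- the two singularities off the common edge
  have hmem : ∀ (c : T.Corner) (x : X), x ∈ S.sing →
      (x ∉ T.edge c ↔ x = e c.1 ∨ x = T.vertex c) := by
    intro c x hx
    have h1 : x ∉ T.edge c ↔ ¬ (x = T.vertex (c.1, c.2 + 1) ∨ x = T.vertex (c.1, c.2 + 2)) := by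
      rw [← T.mem_edge_sing_iff]
      tauto
    rw [h1]
    have hne : ∀ j, T.vertex (c.1, j) ≠ e c.1 := fun j => by
      have : T.vertex (c.1, j) ∈ {p | p ∈ S.sing ∧ p ≠ e c.1} := he c.1 ▸ ⟨j, rfl⟩
      exact this.2
    have h12 : T.vertex c ≠ T.vertex (c.1, c.2 + 1) := fun h =>
      PlaneTriangle.fin3_add_one_ne c.2 (hinj c.1 h).symm
    have h13 : T.vertex c ≠ T.vertex (c.1, c.2 + 2) := fun h =>
      PlaneTriangle.fin3_add_two_ne c.2 (hinj c.1 h).symm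
    constructor
    · intro h
      by_cases hxe : x = e c.1
      · exact Or.inl hxe
      right
      have : x ∈ Set.range fun j => T.vertex (c.1, j) := by rw [he]; exact ⟨hx, hxe⟩
      obtain ⟨j, rfl⟩ := this
      rcases PlaneTriangle.fin3_cases c.2 j with rfl | rfl | rfl
      · rfl
      · exact absurd (Or.inl rfl) h
      · exact absurd (Or.inr rfl) h
    · rintro (rfl | rfl)
      · rintro (h | h)
        · exact hne _ h.symm
        · exact hne _ h.symm
      · rintro (h | h)
        · exact h12 h
        · exact h13 h
  have hc := hmem c
  have hd := hmem d
  rw [h.2] at hc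
  have h1 := fun x hx => (hc x hx).symm.trans (hd x hx)
  have hne : ∀ c : T.Corner, T.vertex c ≠ e c.1 := fun c => by
    have : T.vertex c ∈ {p | p ∈ S.sing ∧ p ≠ e c.1} := he c.1 ▸ ⟨c.2, rfl⟩
    exact this.2
  have hee : (e c.1 : X) ≠ e d.1 := by
    intro hee
    have h2 : c.1 = d.1 := e.injective (Subtype.ext hee)
    rcases (h1 _ (T.vertex_mem_sing c)).1 (Or.inr rfl) with h3 | h3
    · exact hne c (h3.trans hee.symm)
    · apply h.1
      refine Prod.ext h2 (hinj c.1 ?_)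
      change T.vertex (c.1, c.2) = T.vertex (c.1, d.2)
      exact h3.trans (congrArg (fun i => T.vertex (i, d.2)) h2).symm
  constructor
  · rcases (h1 _ (e c.1).2).1 (Or.inl rfl) with h2 | h2
    · exact absurd h2 hee
    · exact h2
  · rcases (h1 _ (e d.1).2).2 (Or.inl rfl) with h2 | h2
    · exact absurd h2.symm hee
    · exact h2

open Classical in
/-- In a tetrahedral triangulation opposite edges have the same angle sum, hence all angle sums are
less than `π` as soon as this holds for the edges of one triangle. -/
theorem IsTetrahedral.angle_add_lt_pi [T2Space X] (hT : T.IsTetrahedral) (hcard : S.sing.card = 4)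
    {t : Fin T.n} (ht : ∀ k, ∃ A, T.AreOpposite A (t, k) ∧ T.angle A + T.angle (t, k) < Real.pi)
    {c d : T.Corner} (hcd : T.AreOpposite c d) : T.angle c + T.angle d < Real.pi := by
  obtain ⟨e, he⟩ := hT
  have hn : S.sing.card = T.n := by
    have := Fintype.card_congr e
    rw [Fintype.card_fin, Fintype.card_coe] at this
    exact this.symm
  -- the three vertices of a triangle are different
  have hinj : ∀ i, Function.Injective fun j => T.vertex (i, j) := by
    intro i
    have h1 : (Finset.univ.image fun j => T.vertex (i, j)) = S.sing.erase (e i) := by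
      ext x
      have := Set.ext_iff.1 (he i) x
      simp only [Set.mem_range] at this
      simp only [Finset.mem_image, Finset.mem_univ, true_and, Finset.mem_erase, this]
      exact and_comm
    have h2 : (Finset.univ.image fun j => T.vertex (i, j)).card
        = (Finset.univ : Finset (Fin 3)).card := by
      rw [h1, Finset.card_erase_of_mem (e i).2, hcard]
      rfl
    exact fun x y hxy => Finset.card_image_iff.1 h2 (Finset.mem_coe.2 (Finset.mem_univ x))
      (Finset.mem_coe.2 (Finset.mem_univ y)) hxy
  let N : Fin 4 ≃ {p : X // p ∈ S.sing} := (Finset.equivFinOfCardEq hcard).symm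
  have hN : ∀ x ∈ S.sing, ∃ k, (N k : X) = x := fun x hx =>
    ⟨N.symm ⟨x, hx⟩, by rw [Equiv.apply_symm_apply]⟩
  -- the angle at the singularity `l` of the triangle that misses the singularity `k`
  let θ : Fin 4 → Fin 4 → ℝ := fun k l => ∑ j, if T.vertex (e.symm (N k), j) = N l then
    T.angle (e.symm (N k), j) else 0
  have hθ : ∀ (c : T.Corner) (k l : Fin 4), (N k : X) = e c.1 → (N l : X) = T.vertex c →
      θ k l = T.angle c := by
    intro c k l hk hl
    have h1 : e.symm (N k) = c.1 := by
      rw [Equiv.symm_apply_eq]; exact Subtype.ext hk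
    simp only [θ, h1, hl]
    rw [Finset.sum_eq_single c.2]
    · exact if_pos rfl
    · intro j _ hj
      exact if_neg fun h => hj (hinj c.1 h)
    · simp
  suffices key : ∀ {k l : Fin 4}, k ≠ l → θ k l + θ l k < Real.pi by
    obtain ⟨h1, h2⟩ := eq_vertex_of_areOpposite he hinj hcd
    obtain ⟨k, hk⟩ := hN _ (e c.1).2
    obtain ⟨l, hl⟩ := hN _ (e d.1).2
    rw [← hθ c k l hk (hl.trans h2), ← hθ d l k hl (hk.trans h1)]
    refine key ?_
    rintro rfl
    have : T.vertex c ∈ {p | p ∈ S.sing ∧ p ≠ e c.1} := he c.1 ▸ ⟨c.2, rfl⟩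
    exact this.2 (h2.symm.trans (hl.symm.trans hk))
  intro k l hkl
  refine add_transpose_lt_pi ?_ ?_ ?_ (a := N.symm (e t)) ?_ hkl
  · -- Rows: the angles of a triangle.
    intro k
    simp only [θ]
    rw [Finset.sum_comm]
    have : ∀ j : Fin 3, (∑ l, if T.vertex (e.symm (N k), j) = N l then
        T.angle (e.symm (N k), j) else 0) = T.angle (e.symm (N k), j) := by
      intro j
      obtain ⟨l, hl⟩ := hN _ (T.vertex_mem_sing (e.symm (N k), j))
      rw [Finset.sum_eq_single l]
      · exact if_pos hl.symm
      · intro l' _ hne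
        exact if_neg fun h => hne (N.injective (Subtype.ext (h.symm.trans hl.symm)))
      · simp
    simp only [this]
    rw [Fin.sum_univ_three]
    exact T.angle_sum _
  · -- Columns: the angles at a singularity.
    intro l
    rw [← T.sum_angle_eq_pi hn (N l).2, Finset.sum_filter, Fintype.sum_prod_type]
    exact Equiv.sum_comp (N.trans e.symm) fun i => ∑ j, if T.vertex (i, j) = N l then
      T.angle (i, j) else 0
  · intro k
    refine Finset.sum_eq_zero fun j _ => if_neg fun h => ?_
    have : T.vertex (e.symm (N k), j) ∈ {p | p ∈ S.sing ∧ p ≠ e (e.symm (N k))} := he _ ▸ ⟨j, rfl⟩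
    rw [Equiv.apply_symm_apply] at this
    exact this.2 h
  · intro l hl
    have h1 : (N (N.symm (e t)) : X) = e t := by rw [Equiv.apply_symm_apply]
    have h2 : (N l : X) ∈ {p | p ∈ S.sing ∧ p ≠ e t} :=
      ⟨(N l).2, fun h => hl (by rw [Equiv.eq_symm_apply]; exact Subtype.ext h)⟩
    rw [← he] at h2
    obtain ⟨k, hk⟩ := h2
    obtain ⟨A, hA, hlt⟩ := ht k
    obtain ⟨h3, h4⟩ := eq_vertex_of_areOpposite he hinj hA
    rw [hθ (t, k) _ l h1 hk.symm, hθ A l _ (hk.symm.trans h3.symm) (h1.trans h4)]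
    linarith

end Triangulation

end HalfDilationStructure

/-! ### Edges and their two triangles -/

namespace PlaneTriangle

theorem eq_of_mem_openEdge {b : AffineBasis (Fin 3) ℝ ℂ} {k l : Fin 3} {z : ℂ}
    (hk : z ∈ openEdge b k) (hl : b.coord l z = 0) : l = k := by
  rcases fin3_cases k l with e | e | e
  · exact e
  · rw [e] at hl; exact absurd hl hk.2.1.ne'
  · rw [e] at hl; exact absurd hl hk.2.2.ne'

theorem mem_openEdge_of_coord {b : AffineBasis (Fin 3) ℝ ℂ} {k : Fin 3} {z : ℂ}
    (hz : z ∈ convexHull ℝ (Set.range b)) (hv : z ∉ Set.range b) (h : b.coord k z = 0) :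
    z ∈ openEdge b k := by
  rcases interior_or_edge b hz hv with h1 | ⟨m, h1⟩
  · rw [mem_interior_iff] at h1
    exact absurd h (h1 k).ne'
  · have h2 : z ∈ openEdge b m := h1
    rw [eq_of_mem_openEdge h2 h]
    exact h2

end PlaneTriangle

namespace HalfDilationStructure

variable {X : Type*} [TopologicalSpace X] {S : HalfDilationStructure X}

namespace Triangulation

variable {T : S.Triangulation}

theorem AreOpposite.symm {c d : T.Corner} (h : T.AreOpposite c d) : T.AreOpposite d c :=
  ⟨h.1.symm, h.2.symm⟩

/-- A point of an open edge is the image of a point of each open edge with the same image. -/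
theorem exists_mem_openEdge {c d : T.Corner} (h : T.edge c = T.edge d) {w : ℂ}
    (hw : w ∈ PlaneTriangle.openEdge (T.basis c.1) c.2) :
    ∃ w' ∈ PlaneTriangle.openEdge (T.basis d.1) d.2, T.map c.1 w = T.map d.1 w' := by
  have hwt := PlaneTriangle.openEdge_subset _ _ hw
  have hs := T.notMem_sing hwt (PlaneTriangle.notMem_range_of_mem_openEdge _ hw)
  have h1 : T.map c.1 w ∈ T.edge c :=
    ⟨w, (PlaneTriangle.mem_edge_iff (T.basis c.1) c.2).2 ⟨hwt, hw.1⟩, rfl⟩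
  rw [h] at h1
  obtain ⟨w', hw', he⟩ := h1
  have h2 := (PlaneTriangle.mem_edge_iff (T.basis d.1) d.2).1 hw'
  have h3 : w' ∉ Set.range (T.basis d.1) := T.notMem_range_of_notMem_sing (he ▸ hs)
  exact ⟨w', PlaneTriangle.mem_openEdge_of_coord h2.1 h3 h2.2, he.symm⟩

variable [T2Space X]

theorem exists_areOpposite (c : T.Corner) : ∃ d, T.AreOpposite c d := by
  have hw := PlaneTriangle.combo_mem_openEdge (T.basis c.1) c.2 (t := 1 / 2) (by norm_num)
    (by norm_num)
  have hwt := PlaneTriangle.openEdge_subset _ _ hw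
  have hs := T.notMem_sing hwt (PlaneTriangle.notMem_range_of_mem_openEdge _ hw)
  obtain ⟨j, w', hw', hx, hne⟩ := exists_other hw
  obtain ⟨φ, hφ, hsrc⟩ := S.exists_chart _ hs
  obtain ⟨a, b, h⟩ := T.exists_localForm hwt hs hφ hsrc
  obtain ⟨a', b', h'⟩ := T.exists_localForm hw' (hx ▸ hs) hφ (hx ▸ hsrc)
  obtain ⟨k, l, hk, -, -, hopp⟩ := isGluing_of_localForm hne hwt hw' hx hs hφ h h'
  rw [← PlaneTriangle.eq_of_mem_openEdge hk hw.1] at hopp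
  exact ⟨_, hopp⟩

/-- Opposite corners: the edges are glued by a half-dilation. -/
theorem AreOpposite.exists_isGluing {c d : T.Corner} (h : T.AreOpposite c d) :
    ∃ σ τ, T.IsGluing c d σ τ := by
  have hw := PlaneTriangle.combo_mem_openEdge (T.basis c.1) c.2 (t := 1 / 2) (by norm_num)
    (by norm_num)
  obtain ⟨w', hw', hx⟩ := exists_mem_openEdge h.2 hw
  have hwt := PlaneTriangle.openEdge_subset _ _ hw
  have hs := T.notMem_sing hwt (PlaneTriangle.notMem_range_of_mem_openEdge _ hw)
  obtain ⟨φ, hφ, hsrc⟩ := S.exists_chart _ hs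
  obtain ⟨a, b, h1⟩ := T.exists_localForm hwt hs hφ hsrc
  have hwt' := PlaneTriangle.openEdge_subset _ _ hw'
  obtain ⟨a', b', h1'⟩ := T.exists_localForm hwt' (hx ▸ hs) hφ (hx ▸ hsrc)
  obtain ⟨k, l, hk, hl, hgl, -⟩ := isGluing_of_localForm (fun e1 e2 => h.1 (Prod.ext e1 (by
    rw [← e2, ← e1] at hw'
    exact PlaneTriangle.eq_of_mem_openEdge hw' hw.1))) hwt hwt' hx hs hφ h1 h1'
  rw [← PlaneTriangle.eq_of_mem_openEdge hk hw.1, ← PlaneTriangle.eq_of_mem_openEdge hl hw'.1]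
    at hgl
  exact ⟨_, _, hgl⟩

/-- An edge belongs to only two triangles: three triangles would lie pairwise on different sides of
a line. -/
theorem AreOpposite.unique {c d d' : T.Corner} (h : T.AreOpposite c d) (h' : T.AreOpposite c d') :
    d = d' := by
  by_contra hdd
  have hw := PlaneTriangle.combo_mem_openEdge (T.basis c.1) c.2 (t := 1 / 2) (by norm_num)
    (by norm_num)
  obtain ⟨w', hw', hx⟩ := exists_mem_openEdge h.2 hw
  obtain ⟨w'', hw'', hx'⟩ := exists_mem_openEdge h'.2 hw
  set w := ((1 - 1 / 2 : ℝ) : ℂ) * T.basis c.1 (c.2 + 1) + ((1 / 2 : ℝ) : ℂ)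
    * T.basis c.1 (c.2 + 2)
  have hwt := PlaneTriangle.openEdge_subset _ _ hw
  have hwt' := PlaneTriangle.openEdge_subset _ _ hw'
  have hwt'' := PlaneTriangle.openEdge_subset _ _ hw''
  have hs := T.notMem_sing hwt (PlaneTriangle.notMem_range_of_mem_openEdge _ hw)
  obtain ⟨φ, hφ, hsrc⟩ := S.exists_chart _ hs
  obtain ⟨a, b, h1⟩ := T.exists_localForm hwt hs hφ hsrc
  obtain ⟨a', b', h1'⟩ := T.exists_localForm hwt' (hx ▸ hs) hφ (hx ▸ hsrc)
  obtain ⟨a'', b'', h1''⟩ := T.exists_localForm hwt'' (hx' ▸ hs) hφ (hx' ▸ hsrc)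
  have key : ∀ {c d : T.Corner} {w w' : ℂ} (_ : c ≠ d)
      (hw : w ∈ PlaneTriangle.openEdge (T.basis c.1) c.2)
      (hw' : w' ∈ PlaneTriangle.openEdge (T.basis d.1) d.2) (_ : T.map c.1 w = T.map d.1 w')
      (_ : T.map c.1 w ∉ S.sing) {a a' : ℝ} {b b' : ℂ}
      (_ : LocalForm φ (T.tri c.1) (T.map c.1) w a b)
      (_ : LocalForm φ (T.tri d.1) (T.map d.1) w' a' b'),
      T.IsGluing c d (a / a') ((b - b') / a') := by
    intro c d w w' hcd hw hw' hx hs a a' b b' h1 h1'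
    obtain ⟨k, l, hk, hl, hgl, -⟩ := isGluing_of_localForm (fun e1 e2 => hcd (Prod.ext e1 (by
      rw [← e2, ← e1] at hw'
      exact PlaneTriangle.eq_of_mem_openEdge hw' hw.1))) (PlaneTriangle.openEdge_subset _ _ hw)
      (PlaneTriangle.openEdge_subset _ _ hw') hx hs hφ h1 h1'
    rwa [← PlaneTriangle.eq_of_mem_openEdge hk hw.1, ← PlaneTriangle.eq_of_mem_openEdge hl hw'.1]
      at hgl
  -- Composing two of the three gluings gives the third, but each reverses the sign of the
  -- barycentric coordinate.
  obtain ⟨κ₁, hκ₁, e1⟩ := (key h.1 hw hw' hx hs h1 h1').exists_coord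
  obtain ⟨κ₂, hκ₂, e2⟩ := (key h'.1 hw hw'' hx' hs h1 h1'').exists_coord
  obtain ⟨κ₃, hκ₃, e3⟩ :=
    (key hdd hw' hw'' (hx.symm.trans hx') (hx ▸ hs) h1' h1'').exists_coord
  have ha' : (a' : ℂ) ≠ 0 := by exact_mod_cast h1'.1
  have ha'' : (a'' : ℂ) ≠ 0 := by exact_mod_cast h1''.1
  have e4 := e3 (((a / a' : ℝ) : ℂ) * T.basis c.1 c.2 + (b - b') / a')
  have e5 : ((a' / a'' : ℝ) : ℂ) * (((a / a' : ℝ) : ℂ) * T.basis c.1 c.2 + (b - b') / a')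
      + (b' - b'') / a'' = ((a / a'' : ℝ) : ℂ) * T.basis c.1 c.2 + (b - b'') / a'' := by
    push_cast
    field_simp
    ring
  rw [e5, e1, e2, PlaneTriangle.coord_self] at e4
  nlinarith

/-- If the angles opposite an edge add up to `π`, the two triangles have the same circumcircle. -/
theorem IsGluing.negPower_eq_zero {c d : T.Corner} {σ : ℝ} {τ : ℂ} (h : T.IsGluing c d σ τ)
    (hpi : T.angle c + T.angle d = Real.pi) :
    PlaneTriangle.negPower (T.basis d.1) (σ * T.basis c.1 c.2 + τ) = 0 := by
  obtain ⟨κ, hκ, hc⟩ := h.exists_coord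
  refine PlaneTriangle.negPower_eq_zero (T.basis d.1) d.2 ?_ ?_
  · rw [hc, PlaneTriangle.coord_self]; linarith
  · rw [h.angle_apex]; exact hpi

end Triangulation

end HalfDilationStructure

/-! ### Triangulations of type `{2,2,4,4}` -/

/-- The sphere remains connected when a finite nonempty set is removed. -/
theorem isPreconnected_compl_sphere {F : Set (Metric.sphere (0 : EuclideanSpace ℝ (Fin 3)) 1)}
    (hF : F.Finite) (hne : F.Nonempty) : IsPreconnected Fᶜ := by
  obtain ⟨v, hv⟩ := hne
  have hv1 : ‖(v : EuclideanSpace ℝ (Fin 3))‖ = 1 := norm_eq_of_mem_sphere v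
  set φ := stereographic hv1 with hφ
  have hfact : Fact (Module.finrank ℝ (EuclideanSpace ℝ (Fin 3)) = 2 + 1) :=
    ⟨by rw [finrank_euclideanSpace_fin]⟩
  have hv0 : (v : EuclideanSpace ℝ (Fin 3)) ≠ 0 := by
    intro h
    rw [h, norm_zero] at hv1
    exact zero_ne_one hv1
  have hrank : 1 < Module.rank ℝ (ℝ ∙ (v : EuclideanSpace ℝ (Fin 3)))ᗮ := by
    rw [← Module.finrank_eq_rank, Submodule.finrank_orthogonal_span_singleton (n := 2) hv0]
    norm_num
  -- Stereographic projection from one of the points identifies the complement with that of a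
  -- finite set in the plane.
  have h2 : Fᶜ = φ.symm '' (φ '' (F \ {v}))ᶜ := by
    ext x
    have hsrc : ∀ y, y ∈ φ.source ↔ y ≠ v := fun y => by
      rw [hφ, stereographic_source]; rfl
    constructor
    · intro hx
      have hxs : x ∈ φ.source := (hsrc x).2 fun h => hx (h ▸ hv)
      refine ⟨φ x, ?_, φ.left_inv hxs⟩
      rintro ⟨y, ⟨hy, hyv⟩, hyx⟩
      rw [φ.injOn ((hsrc y).2 hyv) hxs hyx] at hy
      exact hx hy
    · rintro ⟨y, hy, rfl⟩ hx
      have hyt : y ∈ φ.target := by rw [hφ, stereographic_target]; trivial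
      exact hy ⟨φ.symm y, ⟨hx, (hsrc _).1 (φ.map_target hyt)⟩, φ.right_inv hyt⟩
  have h3 := (((hF.subset Set.sdiff_subset).image φ).countable.isConnected_compl_of_one_lt_rank
    hrank).isPreconnected (s := (φ '' (F \ {v}))ᶜ)
  rw [h2]
  refine h3.image _ (φ.symm.continuousOn.mono fun y _ => ?_)
  rw [φ.symm_source, hφ, stereographic_target]
  trivial

namespace HalfDilationStructure

variable {X : Type*} [TopologicalSpace X] {S : HalfDilationStructure X}

theorem IsPillowcase.t2Space (hS : S.IsPillowcase) : T2Space X := by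
  obtain ⟨⟨h⟩, -⟩ := hS
  exact h.symm.t2Space

theorem IsPillowcase.isPreconnected (hS : S.IsPillowcase) : IsPreconnected {x | x ∉ S.sing} := by
  obtain ⟨⟨h⟩, hc⟩ := hS
  have hne : S.sing.Nonempty := Finset.card_pos.1 (by rw [hc]; norm_num)
  have h1 := isPreconnected_compl_sphere (S.sing.finite_toSet.image h)
    ((Finset.coe_nonempty.2 hne).image h)
  have h2 : {x | x ∉ S.sing} = h.symm '' (h '' (S.sing : Set X))ᶜ := by
    rw [← Set.image_compl_eq h.bijective, Set.image_image]
    simp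
    rfl
  rw [h2]
  exact h1.image _ h.symm.continuous.continuousOn

namespace Triangulation

variable {T : S.Triangulation}

theorem angle_add_lt_pi {c d : T.Corner} (h : c.1 = d.1) (hne : c ≠ d) :
    T.angle c + T.angle d < Real.pi := by
  obtain ⟨i, j⟩ := c
  obtain ⟨i', j'⟩ := d
  obtain rfl : i = i' := h
  have h0 := T.angle_pos (i, 0)
  have h1 := T.angle_pos (i, 1)
  have h2 := T.angle_pos (i, 2)
  have h3 := T.angle_sum i
  have hj : j ≠ j' := fun h => hne (by rw [h])
  fin_cases j <;> fin_cases j' <;> first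
    | exact absurd rfl hj
    | (simp only [Fin.zero_eta, Fin.mk_one, Fin.reduceFinMk]; linarith)

/-- The two corners at a singularity of valence two lie in different triangles, because their angles
add up to `π`. -/
theorem exists_corners_of_valence_eq_two [T2Space X] (hn : S.sing.card = T.n) {p : X}
    (hp : p ∈ S.sing) (hv : T.valence p = 2) : ∃ c c' : T.Corner, c.1 ≠ c'.1 ∧
      T.angle c + T.angle c' = Real.pi ∧ ∀ f, T.vertex f = p ↔ f = c ∨ f = c' := by
  classical
  obtain ⟨c, c', hne, h⟩ := Set.ncard_eq_two.1 hv
  have hiff : ∀ f, T.vertex f = p ↔ f = c ∨ f = c' := fun f => Set.ext_iff.1 h f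
  have hsum := T.sum_angle_eq_pi hn hp
  have h2 : (Finset.univ.filter fun f : T.Corner => T.vertex f = p) = {c, c'} := by
    ext f
    simp [hiff]
  rw [h2, Finset.sum_pair hne] at hsum
  exact ⟨c, c', fun h => (angle_add_lt_pi h hne).ne hsum, hsum, hiff⟩

theorem vertex_mem_edge {c f : T.Corner} (h1 : c.1 = f.1) (h2 : c ≠ f) :
    T.vertex c ∈ T.edge f := by
  obtain ⟨i, j⟩ := c
  obtain ⟨i', j'⟩ := f
  obtain rfl : i = i' := h1
  refine (T.mem_edge_sing_iff.2 ?_).1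
  rcases PlaneTriangle.fin3_cases j' j with rfl | rfl | rfl
  · exact absurd rfl h2
  · exact Or.inl rfl
  · exact Or.inr rfl

theorem exists_corner_of_mem_edge {f : T.Corner} {p : X} (hp : p ∈ S.sing) (h : p ∈ T.edge f) :
    ∃ c : T.Corner, c.1 = f.1 ∧ c ≠ f ∧ T.vertex c = p := by
  rcases T.mem_edge_sing_iff.1 ⟨h, hp⟩ with e | e
  · exact ⟨(f.1, f.2 + 1), rfl, fun h => PlaneTriangle.fin3_add_one_ne f.2 (Prod.ext_iff.1 h).2,
      e.symm⟩
  · exact ⟨(f.1, f.2 + 2), rfl, fun h => PlaneTriangle.fin3_add_two_ne f.2 (Prod.ext_iff.1 h).2,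
      e.symm⟩

/-- In a Delaunay `{2,2,4,4}`-triangulation the two singularities with two triangles lie opposite
an edge with angle sum `π`, and no triangle contains both of them.  The four triangles at these
singularities are all triangles, and are glued in pairs along the edges opposite to them; the sum of
the four angles is `2π`. -/
theorem IsType2244.exists_cocircular (hT : T.IsType2244) (hS : S.IsPillowcase)
    (hD : T.IsDelaunay) : ∃ c d : T.Corner, T.AreOpposite c d ∧ c.1 ≠ d.1 ∧
      T.angle c + T.angle d = Real.pi ∧
      ∀ f g : T.Corner, T.vertex f = T.vertex c → T.vertex g = T.vertex d → f.1 ≠ g.1 := by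
  classical
  have := hS.t2Space
  -- Twelve corners, hence four triangles.
  have hn4 : T.n = 4 := by
    have h1 : ∑ p ∈ S.sing, T.valence p = 12 := by
      rw [Finset.sum, hT]; rfl
    have h2 : ∑ p ∈ S.sing, T.valence p = Fintype.card T.Corner := by
      rw [← Finset.card_univ, Finset.card_eq_sum_card_fiberwise (f := T.vertex) (t := S.sing)
        fun c _ => T.vertex_mem_sing c]
      refine Finset.sum_congr rfl fun p _ => ?_
      rw [valence, Set.ncard_eq_toFinset_card']
      congr 1
      ext; simp
    rw [h2, Fintype.card_prod, Fintype.card_fin, Fintype.card_fin] at h1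
    omega
  have hn : S.sing.card = T.n := hS.2.trans hn4.symm
  obtain ⟨p, q, hpq, hp, hq, hvp, hvq⟩ : ∃ p q, p ≠ q ∧ p ∈ S.sing ∧ q ∈ S.sing ∧
      T.valence p = 2 ∧ T.valence q = 2 := by
    have h1 : Multiset.count 2 (S.sing.val.map T.valence) = 2 := by
      rw [hT]; decide
    rw [Multiset.count_map] at h1
    have h2 : (S.sing.filter fun p => 2 = T.valence p).card = 2 := h1
    obtain ⟨p, q, hpq, h3⟩ := Finset.card_eq_two.1 h2
    have hp : p ∈ S.sing.filter fun p => 2 = T.valence p := by rw [h3]; simp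
    have hq : q ∈ S.sing.filter fun p => 2 = T.valence p := by rw [h3]; simp
    rw [Finset.mem_filter] at hp hq
    exact ⟨p, q, hpq, hp.1, hq.1, hp.2.symm, hq.2.symm⟩
  obtain ⟨c₁, c₂, hc, hcsum, hcp⟩ := exists_corners_of_valence_eq_two hn hp hvp
  obtain ⟨d₁, d₂, hd, hdsum, hdq⟩ := exists_corners_of_valence_eq_two hn hq hvq
  have hcuniq : ∀ f g : T.Corner, T.vertex f = p → T.vertex g = p → f.1 = g.1 → f = g := by
    intro f g hf hg h
    rcases (hcp f).1 hf with rfl | rfl <;> rcases (hcp g).1 hg with rfl | rfl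
    · rfl
    · exact absurd h hc
    · exact absurd h.symm hc
    · rfl
  have hduniq : ∀ f g : T.Corner, T.vertex f = q → T.vertex g = q → f.1 = g.1 → f = g := by
    intro f g hf hg h
    rcases (hdq f).1 hf with rfl | rfl <;> rcases (hdq g).1 hg with rfl | rfl
    · rfl
    · exact absurd h hd
    · exact absurd h.symm hd
    · rfl
  -- a triangle with both singularities is glued to another one along the edge between them, and
  -- then the angles of the two triangles are too large
  have hno : ∀ f g : T.Corner, T.vertex f = p → T.vertex g = q → f.1 ≠ g.1 := by
    intro f g hf hg hfg
    have hfg2 : f ≠ g := fun h => hpq (by rw [← hf, ← hg, h])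
    obtain ⟨m, hmf, hmg⟩ : ∃ m, m ≠ f.2 ∧ m ≠ g.2 := by
      have : ∀ x y : Fin 3, ∃ m, m ≠ x ∧ m ≠ y := by decide
      exact this _ _
    obtain ⟨e, he⟩ := exists_areOpposite (T := T) (f.1, m)
    have h1 : T.vertex f ∈ T.edge e := he.2 ▸ vertex_mem_edge (f := (f.1, m)) rfl fun h =>
      hmf (Prod.ext_iff.1 h).2.symm
    have h2 : T.vertex g ∈ T.edge e := he.2 ▸ vertex_mem_edge (f := (f.1, m)) hfg.symm fun h =>
      hmg (Prod.ext_iff.1 h).2.symm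
    obtain ⟨f', hf1, hf2, hf3⟩ := exists_corner_of_mem_edge (T.vertex_mem_sing f) h1
    obtain ⟨g', hg1, hg2, hg3⟩ := exists_corner_of_mem_edge (T.vertex_mem_sing g) h2
    by_cases hef : e.1 = f.1
    · have h3 := hcuniq f' f (hf3.trans hf) hf (hf1.trans hef)
      have h4 := hduniq g' g (hg3.trans hg) hg (hg1.trans (hef.trans hfg))
      rw [h3] at hf2
      rw [h4] at hg2
      apply he.1
      refine Prod.ext hef.symm ?_
      have h5 : e.2 ≠ f.2 := fun h => hf2 (Prod.ext hef.symm h.symm)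
      have h6 : e.2 ≠ g.2 := fun h => hg2 (Prod.ext (hef.trans hfg).symm h.symm)
      have h7 : f.2 ≠ g.2 := fun h => hfg2 (Prod.ext hfg h)
      have : ∀ x y m e : Fin 3, x ≠ y → m ≠ x → m ≠ y → e ≠ x → e ≠ y → m = e := by decide
      exact this _ _ _ _ h7 hmf hmg h5 h6
    · have h3 : f ≠ f' := fun h => hef (hf1 ▸ congrArg Prod.fst h.symm)
      have h4 : g ≠ g' := fun h => hef (hg1 ▸ (congrArg Prod.fst h).symm.trans hfg.symm)
      have e1 : T.angle f + T.angle f' = Real.pi := by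
        rcases (hcp f).1 hf with e | e <;> rcases (hcp f').1 (hf3.trans hf) with e' | e'
        · exact absurd (e.trans e'.symm) h3
        · rw [e, e', hcsum]
        · rw [e, e', add_comm, hcsum]
        · exact absurd (e.trans e'.symm) h3
      have e2 : T.angle g + T.angle g' = Real.pi := by
        rcases (hdq g).1 hg with e | e <;> rcases (hdq g').1 (hg3.trans hg) with e' | e'
        · exact absurd (e.trans e'.symm) h4
        · rw [e, e', hdsum]
        · rw [e, e', add_comm, hdsum]
        · exact absurd (e.trans e'.symm) h4
      have e3 := angle_add_lt_pi hfg hfg2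
      have e4 := angle_add_lt_pi (hf1.trans hg1.symm) fun h : f' = g' => hpq (by
        rw [← hf, ← hf3, ← hg, ← hg3, h])
      linarith
  have hc₁ : T.vertex c₁ = p := (hcp _).2 (Or.inl rfl)
  have hc₂ : T.vertex c₂ = p := (hcp _).2 (Or.inr rfl)
  have hd₁ : T.vertex d₁ = q := (hdq _).2 (Or.inl rfl)
  have hd₂ : T.vertex d₂ = q := (hdq _).2 (Or.inr rfl)
  -- hence the four triangles are different, and there are no others
  have hall : ∀ i, i = c₁.1 ∨ i = c₂.1 ∨ i = d₁.1 ∨ i = d₂.1 := by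
    have h1 : ({c₁.1, c₂.1, d₁.1, d₂.1} : Finset (Fin T.n)).card = 4 := by
      rw [Finset.card_insert_of_notMem, Finset.card_insert_of_notMem, Finset.card_pair hd]
      · simp [hno c₂ d₁ hc₂ hd₁, hno c₂ d₂ hc₂ hd₂]
      · simp [hc, hno c₁ d₁ hc₁ hd₁, hno c₁ d₂ hc₁ hd₂]
    have h2 : ({c₁.1, c₂.1, d₁.1, d₂.1} : Finset (Fin T.n)) = Finset.univ :=
      Finset.eq_univ_of_card _ (by rw [h1, Fintype.card_fin, hn4])
    intro i
    have := Finset.mem_univ i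
    rw [← h2] at this
    simpa using this
  -- The edge opposite a corner at `p` or `q` has no end at `p` or `q`, so the corner on its other
  -- side is at `p` or `q` again.
  have hopp : ∀ c f : T.Corner, (T.vertex c = p ∨ T.vertex c = q) → T.AreOpposite c f →
      (T.vertex f = p ∨ T.vertex f = q) := by
    intro c f hcv hcf
    obtain ⟨g, hg1, hg⟩ : ∃ g : T.Corner, g.1 = f.1 ∧ (T.vertex g = p ∨ T.vertex g = q) := by
      rcases hall f.1 with e | e | e | e
      · exact ⟨c₁, e.symm, Or.inl hc₁⟩
      · exact ⟨c₂, e.symm, Or.inl hc₂⟩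
      · exact ⟨d₁, e.symm, Or.inr hd₁⟩
      · exact ⟨d₂, e.symm, Or.inr hd₂⟩
    by_cases hgf : g = f
    · rw [← hgf]; exact hg
    exfalso
    have h1 := vertex_mem_edge hg1 hgf
    rw [← hcf.2] at h1
    obtain ⟨c', h2, h3, h4⟩ := exists_corner_of_mem_edge (T.vertex_mem_sing g) h1
    rcases hcv with e1 | e1 <;> rcases hg with e2 | e2
    · exact h3 (hcuniq _ _ (h4.trans e2) e1 h2)
    · exact hno _ _ e1 (h4.trans e2) h2.symm
    · exact hno _ _ (h4.trans e2) e1 h2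
    · exact h3 (hduniq _ _ (h4.trans e2) e1 h2)
  -- if the two triangles at `p` were glued to each other, they would be closed under gluing
  have hcc : ¬ T.AreOpposite c₁ c₂ := by
    intro hcc
    have hclosed : ∀ e f : T.Corner, T.AreOpposite e f → (e.1 = c₁.1 ∨ e.1 = c₂.1) →
        (f.1 = c₁.1 ∨ f.1 = c₂.1) := by
      intro e f hef he
      have key : ∀ c c' : T.Corner, T.AreOpposite c c' → T.vertex c = p →
          (c'.1 = c₁.1 ∨ c'.1 = c₂.1) → e.1 = c.1 → (f.1 = c₁.1 ∨ f.1 = c₂.1) := by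
        intro c c' hcc' hcv hc' hec
        by_cases h : e = c
        · rw [h] at hef
          rw [hef.unique hcc']
          exact hc'
        · have h1 := vertex_mem_edge hec.symm (Ne.symm h)
          rw [hef.2] at h1
          obtain ⟨g, h2, h3, h4⟩ := exists_corner_of_mem_edge (T.vertex_mem_sing c) h1
          rw [← h2]
          rcases (hcp g).1 (h4.trans hcv) with h | h
          · exact Or.inl (by rw [h])
          · exact Or.inr (by rw [h])
      rcases he with he | he
      · exact key c₁ c₂ hcc hc₁ (Or.inr rfl) he
      · exact key c₂ c₁ hcc.symm hc₂ (Or.inl rfl) he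
    have hcl : ∀ i, IsClosed (T.face i) := fun i =>
      ((T.isCompact_tri i).image_of_continuousOn (T.continuousOn_tri i)).isClosed
    have hreg : ∀ i, ∃ x ∈ T.face i, x ∉ S.sing := by
      intro i
      obtain ⟨w, hw⟩ : (interior (T.tri i)).Nonempty :=
        interior_convexHull_nonempty_iff_affineSpan_eq_top.2 (T.basis i).tot
      exact ⟨_, ⟨w, interior_subset hw, rfl⟩, T.notMem_sing (interior_subset hw)
        (PlaneTriangle.notMem_range_of_mem_interior _ hw)⟩
    obtain ⟨x₁, hx₁, hx₁'⟩ := hreg c₁.1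
    obtain ⟨x₂, hx₂, hx₂'⟩ := hreg d₁.1
    -- The regular points are connected, so some regular point lies in a triangle at `p` and in a
    -- triangle at `q`; these two triangles are glued along an edge.
    obtain ⟨x, hxs, hxU, hxV⟩ := isPreconnected_closed_iff.1 hS.isPreconnected
      (T.face c₁.1 ∪ T.face c₂.1) (T.face d₁.1 ∪ T.face d₂.1) ((hcl _).union (hcl _))
      ((hcl _).union (hcl _)) (fun x _ => by
        obtain ⟨i, hi⟩ := T.cover x
        rcases hall i with rfl | rfl | rfl | rfl
        · exact Or.inl (Or.inl hi)
        · exact Or.inl (Or.inr hi)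
        · exact Or.inr (Or.inl hi)
        · exact Or.inr (Or.inr hi)) ⟨x₁, hx₁', Or.inl hx₁⟩ ⟨x₂, hx₂', Or.inl hx₂⟩
    obtain ⟨i, hi, w, hw, hwx⟩ : ∃ i, (i = c₁.1 ∨ i = c₂.1) ∧ x ∈ T.face i := by
      rcases hxU with h | h
      · exact ⟨_, Or.inl rfl, h⟩
      · exact ⟨_, Or.inr rfl, h⟩
    obtain ⟨j, hj, w', hw', hwx'⟩ : ∃ i, (i = d₁.1 ∨ i = d₂.1) ∧ x ∈ T.face i := by
      rcases hxV with h | h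
      · exact ⟨_, Or.inl rfl, h⟩
      · exact ⟨_, Or.inr rfl, h⟩
    have hij : ∀ i j, (i = c₁.1 ∨ i = c₂.1) → (j = d₁.1 ∨ j = d₂.1) → i ≠ j := by
      rintro i j (rfl | rfl) (rfl | rfl)
      · exact hno _ _ hc₁ hd₁
      · exact hno _ _ hc₁ hd₂
      · exact hno _ _ hc₂ hd₁
      · exact hno _ _ hc₂ hd₂
    have hs : T.map i w ∉ S.sing := hwx ▸ hxs
    have hxx : T.map i w = T.map j w' := hwx.trans hwx'.symm
    obtain ⟨φ, hφ, hsrc⟩ := S.exists_chart _ hs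
    obtain ⟨a, b, h⟩ := T.exists_localForm hw hs hφ hsrc
    obtain ⟨a', b', h'⟩ := T.exists_localForm (i := j) hw' (hxx ▸ hs) hφ (hxx ▸ hsrc)
    obtain ⟨k, l, -, -, -, ho⟩ := isGluing_of_localForm
      (fun e => absurd e (hij i j hi hj)) hw hw' hxx hs hφ h h'
    exact hij j j (hclosed _ _ ho hi) hj rfl
  have hpartner : ∀ c c' : T.Corner, T.vertex c = p → (∀ f, T.vertex f = p → f = c ∨ f = c') →
      ¬ T.AreOpposite c c' → ∃ d, T.AreOpposite c d ∧ T.vertex d = q := by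
    intro c c' hcv hcp' hn
    obtain ⟨d, hd⟩ := exists_areOpposite (T := T) c
    rcases hopp c d (Or.inl hcv) hd with h | h
    · rcases hcp' d h with rfl | rfl
      · exact absurd rfl hd.1
      · exact absurd hd hn
    · exact ⟨d, hd, h⟩
  obtain ⟨e₁, he₁, he₁q⟩ := hpartner c₁ c₂ hc₁ (fun f hf => (hcp f).1 hf) hcc
  obtain ⟨e₂, he₂, he₂q⟩ := hpartner c₂ c₁ hc₂ (fun f hf => ((hcp f).1 hf).symm)
    fun h => hcc h.symm
  have he : e₁ ≠ e₂ := by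
    intro h
    rw [← h] at he₂
    exact hc (congrArg Prod.fst (he₁.symm.unique he₂.symm))
  have hesum : T.angle e₁ + T.angle e₂ = Real.pi := by
    rcases (hdq e₁).1 he₁q with e | e <;> rcases (hdq e₂).1 he₂q with e' | e'
    · exact absurd (e.trans e'.symm) he
    · rw [e, e', hdsum]
    · rw [e, e', add_comm, hdsum]
    · exact absurd (e.trans e'.symm) he
  -- Two sums that are at most `π` and add up to `2π`.
  refine ⟨c₁, e₁, he₁, hno _ _ hc₁ he₁q, ?_, ?_⟩
  · have h1 := hD _ _ he₁
    have h2 := hD _ _ he₂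
    linarith
  · rw [hc₁, he₁q]
    exact hno

end Triangulation

end HalfDilationStructure

/-! ### Two triangles with the same circumcircle -/

namespace PlaneTriangle

/-- Points with affine coordinate functions are affinely independent. -/
theorem affineIndependent_of_dual {P : Fin 3 → ℂ} {f : Fin 3 → ℂ → ℝ}
    (hf : ∀ j, IsRealAffine (f j)) (h : ∀ j l, f j (P l) = if l = j then 1 else 0) :
    AffineIndependent ℝ P := by
  rw [affineIndependent_iff]
  intro s w hw hP j hj
  obtain ⟨x, y, r, hxy⟩ := hf j
  have h1 : ∑ e ∈ s, w e * f j (P e) = w j := by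
    simp only [h, mul_ite, mul_one, mul_zero, Finset.sum_ite_eq', if_pos hj]
  have h2 : ∑ e ∈ s, w e * f j (P e) = x * (∑ e ∈ s, w e • P e).re
      + y * (∑ e ∈ s, w e • P e).im + r * ∑ e ∈ s, w e := by
    rw [Complex.re_sum, Complex.im_sum, Finset.mul_sum, Finset.mul_sum, Finset.mul_sum,
      ← Finset.sum_add_distrib, ← Finset.sum_add_distrib]
    refine Finset.sum_congr rfl fun e _ => ?_
    rw [hxy]
    simp only [Complex.smul_re, Complex.smul_im, smul_eq_mul]
    ring
  rw [← h1, h2, hw, hP]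
  simp

variable (b : AffineBasis (Fin 3) ℝ ℂ)

/-- The coordinate functions of the triangle in which the vertex `m` is replaced by `q`. -/
noncomputable def replaceCoord (m : Fin 3) (q : ℂ) (j : Fin 3) (z : ℂ) : ℝ :=
  if j = m then b.coord m z / b.coord m q
  else b.coord j z - b.coord j q / b.coord m q * b.coord m z

theorem isRealAffine_replaceCoord (m : Fin 3) (q : ℂ) (j : Fin 3) :
    IsRealAffine (replaceCoord b m q j) := by
  by_cases h : j = m
  · have : replaceCoord b m q j = fun z => (b.coord m q)⁻¹ * b.coord m z := by
      funext z
      rw [replaceCoord, if_pos h, div_eq_inv_mul]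
    rw [this]
    exact (isRealAffine_coord b m).const_mul _
  · have : replaceCoord b m q j
        = fun z => b.coord j z - b.coord j q / b.coord m q * b.coord m z := by
      funext z
      rw [replaceCoord, if_neg h]
    rw [this]
    exact (isRealAffine_coord b j).sub ((isRealAffine_coord b m).const_mul _)

theorem replaceCoord_update {m : Fin 3} {q : ℂ} (h : b.coord m q ≠ 0) (j l : Fin 3) :
    replaceCoord b m q j (Function.update b m q l) = if l = j then 1 else 0 := by
  by_cases hl : l = m
  · subst hl
    rw [Function.update_self, replaceCoord]
    by_cases hj : j = l
    · rw [if_pos hj, if_pos hj.symm, div_self h]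
    · rw [if_neg hj, if_neg (Ne.symm hj)]
      field_simp
      ring
  · rw [Function.update_of_ne hl, replaceCoord, coord_vertex_ne b (Ne.symm hl)]
    by_cases hj : j = m
    · rw [if_pos hj, if_neg (fun e => hl (e.trans hj)), zero_div]
    · rw [if_neg hj, mul_zero, sub_zero]
      by_cases hlj : l = j
      · rw [if_pos hlj, hlj, coord_self]
      · rw [if_neg hlj, coord_vertex_ne b (Ne.symm hlj)]

/-- The triangle in which the vertex `m` is replaced by `q`. -/
noncomputable def replaceVertex (m : Fin 3) (q : ℂ) (h : b.coord m q ≠ 0) :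
    AffineBasis (Fin 3) ℝ ℂ where
  toFun := Function.update b m q
  ind' := affineIndependent_of_dual (isRealAffine_replaceCoord b m q) (replaceCoord_update b h)
  tot' := by
    rw [(affineIndependent_of_dual (isRealAffine_replaceCoord b m q)
      (replaceCoord_update b h)).affineSpan_eq_top_iff_card_eq_finrank_add_one]
    simp [Complex.finrank_real_complex]

theorem coe_replaceVertex {m : Fin 3} {q : ℂ} (h : b.coord m q ≠ 0) :
    ⇑(replaceVertex b m q h) = Function.update b m q := rfl

theorem coord_replaceVertex {m : Fin 3} {q : ℂ} (h : b.coord m q ≠ 0) (j : Fin 3) (z : ℂ) :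
    (replaceVertex b m q h).coord j z = replaceCoord b m q j z := by
  rw [(isRealAffine_replaceCoord b m q j).apply_eq_sum (replaceVertex b m q h) z,
    Finset.sum_eq_single j]
  · rw [coe_replaceVertex, replaceCoord_update b h, if_pos rfl, mul_one]
  · intro l _ hl
    rw [coe_replaceVertex, replaceCoord_update b h, if_neg hl, mul_zero]
  · simp

theorem univ_eq_of_ne {k l m : Fin 3} (hl : l ≠ k) (hm : m ≠ k) (hlm : l ≠ m) :
    (Finset.univ : Finset (Fin 3)) = {k, l, m} := by
  revert k l m
  decide

theorem forall_fin_three {p : Fin 3 → Prop} {k l m : Fin 3} (hl : l ≠ k) (hm : m ≠ k)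
    (hlm : l ≠ m) : (∀ j, p j) ↔ p k ∧ p l ∧ p m := by
  have h : ∀ j, j = k ∨ j = l ∨ j = m := fun j => by
    have := Finset.mem_univ j
    rw [univ_eq_of_ne hl hm hlm] at this
    simpa using this
  constructor
  · exact fun h => ⟨h _, h _, h _⟩
  · rintro ⟨h1, h2, h3⟩ j
    rcases h j with rfl | rfl | rfl <;> assumption

theorem add_one_add_two_cases {j x y : Fin 3} (hx : x ≠ j) (hy : y ≠ j) (hxy : x ≠ y) :
    (x = j + 1 ∧ y = j + 2) ∨ (x = j + 2 ∧ y = j + 1) := by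
  revert j x y
  decide

theorem angle_add_one_add_two (P : Fin 3 → ℂ) (z : ℂ) {j x y : Fin 3} (hx : x ≠ j) (hy : y ≠ j)
    (hxy : x ≠ y) : EuclideanGeometry.angle (P (j + 1)) z (P (j + 2))
      = EuclideanGeometry.angle (P x) z (P y) := by
  rcases add_one_add_two_cases hx hy hxy with ⟨rfl, rfl⟩ | ⟨rfl, rfl⟩
  · rfl
  · exact EuclideanGeometry.angle_comm _ _ _

theorem segment_add_one_add_two (P : Fin 3 → ℂ) {j x y : Fin 3} (hx : x ≠ j) (hy : y ≠ j)
    (hxy : x ≠ y) : segment ℝ (P (j + 1)) (P (j + 2)) = segment ℝ (P x) (P y) := by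
  rcases add_one_add_two_cases hx hy hxy with ⟨rfl, rfl⟩ | ⟨rfl, rfl⟩
  · rfl
  · exact segment_symm ℝ _ _

theorem image_segment_halfDilation (s : ℝ) (t x y : ℂ) :
    (fun z : ℂ => (s : ℂ) * z + t) '' segment ℝ x y
      = segment ℝ ((s : ℂ) * x + t) ((s : ℂ) * y + t) := by
  rw [segment_eq_image, segment_eq_image, Set.image_image]
  refine Set.image_congr fun r _ => ?_
  simp only [Complex.real_smul]
  push_cast
  ring

/-- The power with respect to the circumcircle, with any point `o` taken as the origin. -/
theorem negPower_eq_sub (o z : ℂ) : negPower b z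
    = ∑ j, b.coord j z * Complex.normSq (b j - o) - Complex.normSq (z - o) := by
  have h1 := coord_sum b 0 z
  have h2 := eq_combo b 0 z
  have hre := congrArg Complex.re h2
  have him := congrArg Complex.im h2
  simp only [Complex.add_re, Complex.add_im, Complex.re_ofReal_mul, Complex.im_ofReal_mul]
    at hre him
  rw [negPower, Fin.sum_univ_three, Fin.sum_univ_three]
  simp only [Complex.normSq_apply, Complex.sub_re, Complex.sub_im]
  simp only [zero_add, Fin.isValue] at h1 hre him
  have h3 : b.coord 0 z = 1 - b.coord 1 z - b.coord 2 z := by linarith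
  rw [h3] at hre him ⊢
  linear_combination (-2 * o.re) * hre - 2 * o.im * him

/-- A point of the circumcircle that is separated from the vertex `k` by the opposite side lies in
the angle at `k`. -/
theorem coord_pos_of_negPower_eq_zero {k l m : Fin 3} (hl : l ≠ k) (hm : m ≠ k) (hlm : l ≠ m)
    {q : ℂ} (hk : b.coord k q < 0) (h : negPower b q = 0) : 0 < b.coord l q := by
  by_contra hcon
  push Not at hcon
  rw [negPower_eq_sub b (b m), univ_eq_of_ne hl hm hlm,
    Finset.sum_insert (by simp [hl.symm, hm.symm]), Finset.sum_pair hlm, sub_self,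
    Complex.normSq_zero, mul_zero, add_zero] at h
  have h1 : 0 < Complex.normSq (b k - b m) :=
    Complex.normSq_pos.2 (sub_ne_zero.2 (vertex_ne b hm.symm))
  have h2 := mul_neg_of_neg_of_pos hk h1
  have h3 := mul_nonpos_of_nonpos_of_nonneg hcon (Complex.normSq_nonneg (b l - b m))
  have h4 := Complex.normSq_nonneg (q - b m)
  linarith

end PlaneTriangle

theorem IsRealAffine.frequently_ne_zero {f : ℂ → ℝ} (hf : IsRealAffine f) (h : ∃ z, f z ≠ 0)
    (w : ℂ) : ∃ᶠ z in 𝓝 w, f z ≠ 0 := by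
  intro hcon
  obtain ⟨z, hz⟩ := h
  have h1 : ∀ᶠ z in 𝓝 w, f z = 0 := hcon.mono fun z hz => not_not.1 hz
  exact hz (hf.eq_zero_of_nonneg_near h1.self_of_nhds (h1.mono fun z hz => hz.ge) z)

theorem sub_div_mul_nonneg_iff {x y xq yq : ℝ} (hx : xq < 0) :
    0 ≤ y - yq / xq * x ↔ xq * y ≤ yq * x := by
  have h : y - yq / xq * x = (yq * x - xq * y) / (-xq) := by
    have : xq ≠ 0 := hx.ne
    field_simp
    ring
  rw [h, div_nonneg_iff]
  constructor
  · rintro (⟨h1, h2⟩ | ⟨h1, h2⟩) <;> linarith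
  · intro h1
    left
    constructor <;> linarith

namespace HalfDilationStructure

variable {X : Type*} [TopologicalSpace X] {S : HalfDilationStructure X}

theorem _root_.LocalForm.isHalfDilationAt {φ : OpenPartialHomeomorph X ℂ} (hφ : φ ∈ S.atlas)
    {D : Set ℂ} {f : ℂ → X} {w : ℂ} (hw : w ∈ D) {a : ℝ} {b : ℂ} (h : LocalForm φ D f w a b) :
    IsHalfDilationAt S.atlas (fun z : {z : ℂ // z ∈ D} => f z) ⟨w, hw⟩ := by
  refine ⟨φ, hφ, h.2.1, fun z => a * z + b, ⟨a, b, h.1, fun z => rfl⟩, ?_⟩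
  exact (eventually_nhds_subtype_iff D ⟨w, hw⟩
    (fun z => f z ∈ φ.source ∧ φ (f z) = (a : ℂ) * z + b)).2 h.2.2

theorem _root_.LocalForm.mono {φ : OpenPartialHomeomorph X ℂ} {D D' : Set ℂ} {f : ℂ → X} {w : ℂ}
    {a : ℝ} {b : ℂ} (h : LocalForm φ D f w a b) (hD : D' ⊆ D) : LocalForm φ D' f w a b :=
  ⟨h.1, h.2.1, h.2.2.filter_mono (nhdsWithin_mono w hD)⟩

/-- The conditions on a single triangle of a triangulation: the plane triangle with the vertices
`P j` is mapped to the surface by `f`. -/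
structure IsTriangle (S : HalfDilationStructure X) (P : Fin 3 → ℂ) (f : ℂ → X) : Prop where
  affineIndependent : AffineIndependent ℝ P
  continuousOn : ContinuousOn f (convexHull ℝ (Set.range P))
  injOn_interior : Set.InjOn f (interior (convexHull ℝ (Set.range P)))
  isHalfDilationAt : ∀ z : {z : ℂ // z ∈ convexHull ℝ (Set.range P)}, (z : ℂ) ∉ Set.range P →
    IsHalfDilationAt S.atlas (fun w : {z : ℂ // z ∈ convexHull ℝ (Set.range P)} => f w) z
  map_vert_mem : ∀ j, f (P j) ∈ S.sing
  map_notMem : ∀ z ∈ convexHull ℝ (Set.range P), z ∉ Set.range P → f z ∉ S.sing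

namespace Triangulation

variable {T : S.Triangulation}

theorem isTriangle (i : Fin T.n) : S.IsTriangle (T.vert i) (T.map i) :=
  ⟨T.affineIndependent i, T.continuousOn i, T.injOn_interior i, T.isHalfDilationAt i,
    T.map_vert_mem i, T.map_notMem i⟩

theorem IsGluing.inverse [T2Space X] {c d : T.Corner} {σ : ℝ} {τ : ℂ} (h : T.IsGluing c d σ τ) :
    T.IsGluing d c σ⁻¹ (-τ / σ) := by
  have hc := PlaneTriangle.combo_mem_openEdge (T.basis c.1) c.2 (t := 1 / 2) (by norm_num)
    (by norm_num)
  refine h.symm (w := _) ?_ hc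
  have hd := PlaneTriangle.combo_mem_openEdge (T.basis d.1) d.2 (t := 1 / 2) (by norm_num)
    (by norm_num)
  convert hd using 1
  push_cast
  rcases h.endpoints with ⟨h1, h2⟩ | ⟨h1, h2⟩ <;> rw [← h1, ← h2] <;> ring

/-- The vertex of the second of two glued triangles, seen in the plane of the first one. -/
noncomputable def gluedApex (T : S.Triangulation) (d : T.Corner) (σ : ℝ) (τ : ℂ) : ℂ :=
  ((σ⁻¹ : ℝ) : ℂ) * T.basis d.1 d.2 + -τ / σ

open Classical in
/-- The parametrization of the union of two glued triangles from the plane of the first one. -/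
noncomputable def gluedMap (T : S.Triangulation) (c d : T.Corner) (σ : ℝ) (τ : ℂ) (z : ℂ) : X :=
  if z ∈ T.tri c.1 then T.map c.1 z else T.map d.1 ((σ : ℂ) * z + τ)

/-- The union of two glued triangles in the plane of the first one. -/
def gluedQuad (T : S.Triangulation) (c d : T.Corner) (σ : ℝ) (τ : ℂ) : Set ℂ :=
  T.tri c.1 ∪ (fun z : ℂ => (σ : ℂ) * z + τ) ⁻¹' T.tri d.1

/-- Two triangles with the same circumcircle that are glued along the edge opposite the corners `c`
and `d`.  The endpoints of the edge are the vertices `l` and `m` of the first triangle, and `l'` and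
`m'` of the second one. -/
structure IsFlippable (T : S.Triangulation) (c d : T.Corner) (σ : ℝ) (τ : ℂ)
    (l m l' m' : Fin 3) : Prop where
  fst_ne : c.1 ≠ d.1
  gluing : T.IsGluing c d σ τ
  angle_add : T.angle c + T.angle d = Real.pi
  hl : l ≠ c.2
  hm : m ≠ c.2
  hlm : l ≠ m
  hl' : l' ≠ d.2
  hm' : m' ≠ d.2
  hlm' : l' ≠ m'
  map_l : (σ : ℂ) * T.basis c.1 l + τ = T.basis d.1 l'
  map_m : (σ : ℂ) * T.basis c.1 m + τ = T.basis d.1 m'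

namespace IsFlippable

variable {c d : T.Corner} {σ : ℝ} {τ : ℂ} {l m l' m' : Fin 3}

theorem swap (F : T.IsFlippable c d σ τ l m l' m') : T.IsFlippable c d σ τ m l m' l' :=
  ⟨F.fst_ne, F.gluing, F.angle_add, F.hm, F.hl, F.hlm.symm, F.hm', F.hl', F.hlm'.symm, F.map_m,
    F.map_l⟩

theorem ofReal_ne_zero (F : T.IsFlippable c d σ τ l m l' m') : (σ : ℂ) ≠ 0 := by
  exact_mod_cast F.gluing.ne_zero

theorem map_apex (F : T.IsFlippable c d σ τ l m l' m') :
    (σ : ℂ) * T.gluedApex d σ τ + τ = T.basis d.1 d.2 := by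
  have := F.ofReal_ne_zero
  rw [gluedApex]
  push_cast
  field_simp
  ring

theorem halfDilation_injective (F : T.IsFlippable c d σ τ l m l' m') {z w : ℂ}
    (h : (σ : ℂ) * z + τ = σ * w + τ) : z = w :=
  mul_left_cancel₀ F.ofReal_ne_zero (add_right_cancel h)

theorem mem_tri_fst_iff (F : T.IsFlippable c d σ τ l m l' m') {z : ℂ} :
    z ∈ T.tri c.1 ↔ 0 ≤ (T.basis c.1).coord c.2 z ∧ 0 ≤ (T.basis c.1).coord l z ∧
      0 ≤ (T.basis c.1).coord m z := by
  rw [tri, PlaneTriangle.mem_iff, PlaneTriangle.forall_fin_three F.hl F.hm F.hlm]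

theorem gluedMap_of_mem_fst {c d : T.Corner} {σ : ℝ} {τ z : ℂ} (hz : z ∈ T.tri c.1) :
    T.gluedMap c d σ τ z = T.map c.1 z := if_pos hz

variable [T2Space X]

theorem coord_apex_neg (F : T.IsFlippable c d σ τ l m l' m') :
    (T.basis c.1).coord c.2 (T.gluedApex d σ τ) < 0 := by
  obtain ⟨κ, hκ, h⟩ := F.gluing.inverse.exists_coord
  rw [gluedApex, h, PlaneTriangle.coord_self]
  linarith

theorem negPower_apex (F : T.IsFlippable c d σ τ l m l' m') :
    PlaneTriangle.negPower (T.basis c.1) (T.gluedApex d σ τ) = 0 :=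
  F.gluing.inverse.negPower_eq_zero ((add_comm _ _).trans F.angle_add)

theorem coord_apex_pos (F : T.IsFlippable c d σ τ l m l' m') :
    0 < (T.basis c.1).coord l (T.gluedApex d σ τ) :=
  PlaneTriangle.coord_pos_of_negPower_eq_zero _ F.hl F.hm F.hlm F.coord_apex_neg F.negPower_apex

/-- The barycentric coordinates of the second triangle, expressed in those of the first one. -/
theorem coord_glued (F : T.IsFlippable c d σ τ l m l' m') (z : ℂ) :
    (T.basis d.1).coord d.2 ((σ : ℂ) * z + τ)
        = (T.basis c.1).coord c.2 z / (T.basis c.1).coord c.2 (T.gluedApex d σ τ) ∧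
    (T.basis d.1).coord l' ((σ : ℂ) * z + τ) = (T.basis c.1).coord l z
        - (T.basis c.1).coord l (T.gluedApex d σ τ)
          / (T.basis c.1).coord c.2 (T.gluedApex d σ τ) * (T.basis c.1).coord c.2 z := by
  have hX := F.coord_apex_neg.ne
  -- Express the point in the triangle on the other side of the edge, seen in the first plane.
  set R := PlaneTriangle.replaceVertex (T.basis c.1) c.2 (T.gluedApex d σ τ) hX with hR
  have hRk : R c.2 = T.gluedApex d σ τ := Function.update_self _ _ _
  have hRl : R l = T.basis c.1 l := Function.update_of_ne F.hl _ _
  have hRm : R m = T.basis c.1 m := Function.update_of_ne F.hm _ _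
  have key : ∀ j, (T.basis d.1).coord j ((σ : ℂ) * z + τ)
      = R.coord c.2 z * (T.basis d.1).coord j (T.basis d.1 d.2)
      + R.coord l z * (T.basis d.1).coord j (T.basis d.1 l')
      + R.coord m z * (T.basis d.1).coord j (T.basis d.1 m') := by
    intro j
    have h := ((PlaneTriangle.isRealAffine_coord (T.basis d.1) j).comp_halfDilation
      σ τ).apply_eq_sum R z
    rw [PlaneTriangle.univ_eq_of_ne F.hl F.hm F.hlm,
      Finset.sum_insert (by simp [F.hl.symm, F.hm.symm]), Finset.sum_pair F.hlm, hRk, hRl, hRm,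
      F.map_apex, F.map_l, F.map_m, ← add_assoc] at h
    exact h
  constructor
  · rw [key, PlaneTriangle.coord_self, PlaneTriangle.coord_vertex_ne _ F.hl'.symm,
      PlaneTriangle.coord_vertex_ne _ F.hm'.symm, hR, PlaneTriangle.coord_replaceVertex,
      PlaneTriangle.replaceCoord, if_pos rfl]
    ring
  · rw [key, PlaneTriangle.coord_self, PlaneTriangle.coord_vertex_ne _ F.hl',
      PlaneTriangle.coord_vertex_ne _ F.hlm', hR, PlaneTriangle.coord_replaceVertex,
      PlaneTriangle.coord_replaceVertex, PlaneTriangle.replaceCoord, PlaneTriangle.replaceCoord,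
      if_pos rfl, if_neg F.hl]
    ring

theorem mem_tri_snd_iff (F : T.IsFlippable c d σ τ l m l' m') {z : ℂ} :
    (σ : ℂ) * z + τ ∈ T.tri d.1 ↔ (T.basis c.1).coord c.2 z ≤ 0 ∧
      (T.basis c.1).coord c.2 (T.gluedApex d σ τ) * (T.basis c.1).coord l z
        ≤ (T.basis c.1).coord l (T.gluedApex d σ τ) * (T.basis c.1).coord c.2 z ∧
      (T.basis c.1).coord c.2 (T.gluedApex d σ τ) * (T.basis c.1).coord m z
        ≤ (T.basis c.1).coord m (T.gluedApex d σ τ) * (T.basis c.1).coord c.2 z := by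
  have hX := F.coord_apex_neg
  rw [tri, PlaneTriangle.mem_iff, PlaneTriangle.forall_fin_three F.hl' F.hm' F.hlm',
    (F.coord_glued z).1, (F.coord_glued z).2, (F.swap.coord_glued z).2,
    sub_div_mul_nonneg_iff hX, sub_div_mul_nonneg_iff hX]
  refine and_congr ?_ Iff.rfl
  constructor
  · intro h
    by_contra hcon
    push Not at hcon
    exact absurd h (not_le.2 (div_neg_of_pos_of_neg hcon hX))
  · intro h
    exact div_nonneg_of_nonpos h hX.le

/-- The triangle obtained by replacing the vertex `m`. -/
noncomputable def newBasis (F : T.IsFlippable c d σ τ l m l' m') : AffineBasis (Fin 3) ℝ ℂ :=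
  PlaneTriangle.replaceVertex (T.basis c.1) m (T.gluedApex d σ τ) F.swap.coord_apex_pos.ne'

theorem coe_newBasis (F : T.IsFlippable c d σ τ l m l' m') :
    ⇑F.newBasis = Function.update (T.vert c.1) m (T.gluedApex d σ τ) := rfl

/-- Sign conditions on the barycentric coordinates of the new triangle, expressed in those of the
first triangle and cleared of denominators.  The relation `r` will be `≤` or `<`. -/
theorem forall_newBasis_iff (F : T.IsFlippable c d σ τ l m l' m') {z : ℂ} {r : ℝ → ℝ → Prop}
    (hr1 : ∀ x y : ℝ, 0 < y → (r 0 (x / y) ↔ r 0 x))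
    (hr2 : ∀ x y xq yq : ℝ, 0 < yq → (r 0 (x - xq / yq * y) ↔ r (xq * y) (yq * x))) :
    (∀ j, r 0 (F.newBasis.coord j z)) ↔ r 0 ((T.basis c.1).coord m z) ∧
      r ((T.basis c.1).coord c.2 (T.gluedApex d σ τ) * (T.basis c.1).coord m z)
        ((T.basis c.1).coord m (T.gluedApex d σ τ) * (T.basis c.1).coord c.2 z) ∧
      r ((T.basis c.1).coord l (T.gluedApex d σ τ) * (T.basis c.1).coord m z)
        ((T.basis c.1).coord m (T.gluedApex d σ τ) * (T.basis c.1).coord l z) := by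
  have hm := F.swap.coord_apex_pos
  rw [PlaneTriangle.forall_fin_three (k := m) F.hm.symm F.hlm F.hl.symm]
  simp only [newBasis, PlaneTriangle.coord_replaceVertex, PlaneTriangle.replaceCoord, if_true,
    if_neg F.hm.symm, if_neg F.hlm, hr1 _ _ hm, hr2 _ _ _ _ hm]

theorem mem_new_iff (F : T.IsFlippable c d σ τ l m l' m') {z : ℂ} :
    z ∈ convexHull ℝ (Set.range F.newBasis) ↔ 0 ≤ (T.basis c.1).coord m z ∧
      (T.basis c.1).coord c.2 (T.gluedApex d σ τ) * (T.basis c.1).coord m z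
        ≤ (T.basis c.1).coord m (T.gluedApex d σ τ) * (T.basis c.1).coord c.2 z ∧
      (T.basis c.1).coord l (T.gluedApex d σ τ) * (T.basis c.1).coord m z
        ≤ (T.basis c.1).coord m (T.gluedApex d σ τ) * (T.basis c.1).coord l z := by
  rw [PlaneTriangle.mem_iff]
  refine F.forall_newBasis_iff (r := fun x y => x ≤ y) (fun x y hy => ?_) fun x y xq yq hy => ?_
  · rw [le_div_iff₀ hy, zero_mul]
  · have h : x - xq / yq * y = (yq * x - xq * y) / yq := by field_simp
    rw [h, le_div_iff₀ hy, zero_mul, sub_nonneg]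

theorem mem_interior_new_iff (F : T.IsFlippable c d σ τ l m l' m') {z : ℂ} :
    z ∈ interior (convexHull ℝ (Set.range F.newBasis)) ↔ 0 < (T.basis c.1).coord m z ∧
      (T.basis c.1).coord c.2 (T.gluedApex d σ τ) * (T.basis c.1).coord m z
        < (T.basis c.1).coord m (T.gluedApex d σ τ) * (T.basis c.1).coord c.2 z ∧
      (T.basis c.1).coord l (T.gluedApex d σ τ) * (T.basis c.1).coord m z
        < (T.basis c.1).coord m (T.gluedApex d σ τ) * (T.basis c.1).coord l z := by
  rw [PlaneTriangle.mem_interior_iff]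
  refine F.forall_newBasis_iff (r := fun x y => x < y) (fun x y hy => ?_) fun x y xq yq hy => ?_
  · rw [lt_div_iff₀ hy, zero_mul]
  · have h : x - xq / yq * y = (yq * x - xq * y) / yq := by field_simp
    rw [h, lt_div_iff₀ hy, zero_mul, sub_pos]

theorem new_subset (F : T.IsFlippable c d σ τ l m l' m') :
    convexHull ℝ (Set.range F.newBasis) ⊆ T.gluedQuad c d σ τ := by
  intro z hz
  obtain ⟨h1, h2, h3⟩ := F.mem_new_iff.1 hz
  have hX := F.coord_apex_neg
  have hY := F.coord_apex_pos
  have hZ := F.swap.coord_apex_pos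
  have hy : 0 ≤ (T.basis c.1).coord l z :=
    nonneg_of_mul_nonneg_right ((mul_nonneg hY.le h1).trans h3) hZ
  rcases le_total 0 ((T.basis c.1).coord c.2 z) with h | h
  · exact Or.inl (F.mem_tri_fst_iff.2 ⟨h, hy, h1⟩)
  · refine Or.inr (F.mem_tri_snd_iff.2 ⟨h, ?_, h2⟩)
    refine le_of_mul_le_mul_left ?_ hZ
    have h4 := mul_le_mul_of_nonpos_left h3 hX.le
    have h5 := mul_le_mul_of_nonneg_left h2 hY.le
    linarith

theorem mem_openEdge (F : T.IsFlippable c d σ τ l m l' m') {z : ℂ} (h1 : z ∈ T.tri c.1)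
    (h2 : (σ : ℂ) * z + τ ∈ T.tri d.1) :
    z ∈ segment ℝ (T.basis c.1 (c.2 + 1)) (T.basis c.1 (c.2 + 2)) :=
  (PlaneTriangle.mem_edge_iff _ _).2
    ⟨h1, le_antisymm (F.mem_tri_snd_iff.1 h2).1 (F.mem_tri_fst_iff.1 h1).1⟩

theorem gluedMap_of_mem_snd (F : T.IsFlippable c d σ τ l m l' m') {z : ℂ}
    (hz : (σ : ℂ) * z + τ ∈ T.tri d.1) :
    T.gluedMap c d σ τ z = T.map d.1 ((σ : ℂ) * z + τ) := by
  by_cases h : z ∈ T.tri c.1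
  · rw [gluedMap_of_mem_fst h]
    exact (F.gluing.map_eq (F.mem_openEdge h hz)).2
  · exact if_neg h

theorem continuousOn_gluedMap (F : T.IsFlippable c d σ τ l m l' m') :
    ContinuousOn (T.gluedMap c d σ τ) (T.gluedQuad c d σ τ) := by
  have hc : Continuous fun z : ℂ => (σ : ℂ) * z + τ := by fun_prop
  refine ContinuousOn.union_of_isClosed ?_ ?_ (T.isCompact_tri c.1).isClosed
    ((T.isCompact_tri d.1).isClosed.preimage hc)
  · exact (T.continuousOn_tri c.1).congr fun z hz => gluedMap_of_mem_fst hz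
  · refine ContinuousOn.congr ?_ fun z hz => F.gluedMap_of_mem_snd hz
    exact (T.continuousOn_tri d.1).comp hc.continuousOn fun z hz => hz

/-- Off the singularities the common parametrization of the two triangles is a half-dilation in
local coordinates. -/
theorem exists_localForm (F : T.IsFlippable c d σ τ l m l' m') {z : ℂ}
    (hz : z ∈ T.gluedQuad c d σ τ) (hs : T.gluedMap c d σ τ z ∉ S.sing) :
    ∃ φ ∈ S.atlas, ∃ a b, LocalForm φ (T.gluedQuad c d σ τ) (T.gluedMap c d σ τ) z a b := by
  have hσ := F.ofReal_ne_zero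
  have hc : Continuous fun z : ℂ => (σ : ℂ) * z + τ := by fun_prop
  -- it suffices to have compatible local forms on the two triangles
  suffices h : ∃ φ ∈ S.atlas, ∃ (a : ℝ) (b : ℂ), a ≠ 0 ∧ T.gluedMap c d σ τ z ∈ φ.source ∧
      (z ∈ T.tri c.1 → LocalForm φ (T.tri c.1) (T.map c.1) z (a * σ) (a * τ + b)) ∧
      ((σ : ℂ) * z + τ ∈ T.tri d.1 →
        LocalForm φ (T.tri d.1) (T.map d.1) ((σ : ℂ) * z + τ) a b) by
    obtain ⟨φ, hφ, a, b, ha, hsrc, h1, h2⟩ := h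
    refine ⟨φ, hφ, a * σ, a * τ + b, mul_ne_zero ha F.gluing.ne_zero, hsrc, ?_⟩
    have e1 : ∀ᶠ y in 𝓝 z, y ∈ T.tri c.1 → T.map c.1 y ∈ φ.source ∧
        φ (T.map c.1 y) = ((a * σ : ℝ) : ℂ) * y + (a * τ + b) := by
      by_cases h : z ∈ T.tri c.1
      · exact eventually_nhdsWithin_iff.1 (h1 h).2.2
      · filter_upwards [(T.isCompact_tri c.1).isClosed.isOpen_compl.mem_nhds h] with y hy hy'
        exact absurd hy' hy
    have e2 : ∀ᶠ y in 𝓝 ((σ : ℂ) * z + τ), y ∈ T.tri d.1 → T.map d.1 y ∈ φ.source ∧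
        φ (T.map d.1 y) = (a : ℂ) * y + b := by
      by_cases h : (σ : ℂ) * z + τ ∈ T.tri d.1
      · exact eventually_nhdsWithin_iff.1 (h2 h).2.2
      · filter_upwards [(T.isCompact_tri d.1).isClosed.isOpen_compl.mem_nhds h] with y hy hy'
        exact absurd hy' hy
    refine eventually_nhdsWithin_iff.2 ?_
    filter_upwards [e1, (hc.tendsto z).eventually e2] with y h3 h4 hy
    rcases hy with hy | hy
    · rw [gluedMap_of_mem_fst hy]
      exact h3 hy
    · rw [F.gluedMap_of_mem_snd hy, (h4 hy).2]
      refine ⟨(h4 hy).1, ?_⟩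
      push_cast
      ring
  obtain ⟨φ, hφ, hsrc⟩ := S.exists_chart _ hs
  by_cases h1 : z ∈ T.tri c.1
  · have hG := gluedMap_of_mem_fst (d := d) (σ := σ) (τ := τ) h1
    rw [hG] at hs hsrc
    by_cases h2 : (σ : ℂ) * z + τ ∈ T.tri d.1
    · have h3 := PlaneTriangle.mem_openEdge_of_coord h1 (T.notMem_range_of_notMem_sing hs)
        ((PlaneTriangle.mem_edge_iff _ _).1 (F.mem_openEdge h1 h2)).2
      obtain ⟨a, b, h4, h5⟩ := (F.gluing.transition z h3).exists_localForm hφ hsrc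
      exact ⟨φ, hφ, a, b, h5.1, hG ▸ hsrc, fun _ => h4, fun _ => h5⟩
    · obtain ⟨a, b, h3⟩ := T.exists_localForm h1 hs hφ hsrc
      refine ⟨φ, hφ, a / σ, b - (a / σ : ℝ) * τ, div_ne_zero h3.1 F.gluing.ne_zero, hG ▸ hsrc,
        fun _ => ?_, fun h => absurd h h2⟩
      convert h3 using 1
      · field_simp [F.gluing.ne_zero]
      · ring
  · have h2 : (σ : ℂ) * z + τ ∈ T.tri d.1 := hz.resolve_left h1
    have hG := F.gluedMap_of_mem_snd h2
    rw [hG] at hs hsrc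
    obtain ⟨a, b, h3⟩ := T.exists_localForm h2 hs hφ hsrc
    exact ⟨φ, hφ, a, b, h3.1, hG ▸ hsrc, fun h => absurd h h1, fun _ => h3⟩

end IsFlippable

end Triangulation

end HalfDilationStructure

/-! ### The flip of an edge -/

namespace HalfDilationStructure

variable {X : Type*} [TopologicalSpace X] {S : HalfDilationStructure X}

namespace Triangulation

variable {T : S.Triangulation}

namespace IsFlippable

variable {c d : T.Corner} {σ : ℝ} {τ : ℂ} {l m l' m' : Fin 3}

/-- The vertices of the plane triangles after the flip. -/
noncomputable def flipVert (_ : T.IsFlippable c d σ τ l m l' m') : Fin T.n → Fin 3 → ℂ :=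
  Function.update (Function.update T.vert c.1 (Function.update (T.vert c.1) m (T.gluedApex d σ τ)))
    d.1 (Function.update (T.vert c.1) l (T.gluedApex d σ τ))

/-- The parametrizations after the flip. -/
noncomputable def flipMap (_ : T.IsFlippable c d σ τ l m l' m') : Fin T.n → ℂ → X :=
  Function.update (Function.update T.map c.1 (T.gluedMap c d σ τ)) d.1 (T.gluedMap c d σ τ)

theorem flipVert_of_ne (F : T.IsFlippable c d σ τ l m l' m') {i : Fin T.n} (hc : i ≠ c.1)
    (hd : i ≠ d.1) : F.flipVert i = T.vert i := by
  rw [flipVert, Function.update_of_ne hd, Function.update_of_ne hc]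

theorem flipMap_fst (F : T.IsFlippable c d σ τ l m l' m') :
    F.flipMap c.1 = T.gluedMap c d σ τ := by
  rw [flipMap, Function.update_of_ne F.fst_ne, Function.update_self]

theorem flipMap_snd (F : T.IsFlippable c d σ τ l m l' m') :
    F.flipMap d.1 = T.gluedMap c d σ τ := by
  rw [flipMap, Function.update_self]

theorem flipMap_of_ne (F : T.IsFlippable c d σ τ l m l' m') {i : Fin T.n} (hc : i ≠ c.1)
    (hd : i ≠ d.1) : F.flipMap i = T.map i := by
  rw [flipMap, Function.update_of_ne hd, Function.update_of_ne hc]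

variable [T2Space X]

theorem newBasis_fst (F : T.IsFlippable c d σ τ l m l' m') : F.newBasis c.2 = T.basis c.1 c.2 :=
  Function.update_of_ne F.hm.symm _ _

theorem newBasis_l (F : T.IsFlippable c d σ τ l m l' m') : F.newBasis l = T.basis c.1 l :=
  Function.update_of_ne F.hlm _ _

theorem newBasis_m (F : T.IsFlippable c d σ τ l m l' m') : F.newBasis m = T.gluedApex d σ τ :=
  Function.update_self _ _ _

theorem injOn_interior_new (F : T.IsFlippable c d σ τ l m l' m') :
    Set.InjOn (T.gluedMap c d σ τ) (interior (convexHull ℝ (Set.range F.newBasis))) := by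
  have hX := F.coord_apex_neg
  have hY := F.coord_apex_pos
  have hZ := F.swap.coord_apex_pos
  have hcoord : ∀ z ∈ interior (convexHull ℝ (Set.range F.newBasis)),
      0 < (T.basis c.1).coord l z ∧ 0 < (T.basis c.1).coord m z := by
    intro z hz
    obtain ⟨h1, -, h3⟩ := F.mem_interior_new_iff.1 hz
    exact ⟨pos_of_mul_pos_right ((mul_pos hY h1).trans h3) hZ.le, h1⟩
  have hfst : ∀ z ∈ interior (convexHull ℝ (Set.range F.newBasis)),
      0 ≤ (T.basis c.1).coord c.2 z → z ∈ T.tri c.1 := fun z hz h =>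
    F.mem_tri_fst_iff.2 ⟨h, (hcoord z hz).1.le, (hcoord z hz).2.le⟩
  have hsnd : ∀ z ∈ interior (convexHull ℝ (Set.range F.newBasis)),
      (T.basis c.1).coord c.2 z < 0 → z ∉ T.tri c.1 ∧ (σ : ℂ) * z + τ ∈ T.tri d.1 := by
    intro z hz h
    have h1 : z ∉ T.tri c.1 := fun h' => absurd (F.mem_tri_fst_iff.1 h').1 (not_le.2 h)
    exact ⟨h1, (F.new_subset (interior_subset hz)).resolve_left h1⟩
  have hint : ∀ z ∈ interior (convexHull ℝ (Set.range F.newBasis)),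
      0 < (T.basis c.1).coord c.2 z → z ∈ interior (T.tri c.1) := by
    intro z hz h
    rw [tri, PlaneTriangle.mem_interior_iff, PlaneTriangle.forall_fin_three F.hl F.hm F.hlm]
    exact ⟨h, hcoord z hz⟩
  have hint' : ∀ z ∈ interior (convexHull ℝ (Set.range F.newBasis)),
      (T.basis c.1).coord c.2 z < 0 → (σ : ℂ) * z + τ ∈ interior (T.tri d.1) := by
    intro z hz h
    obtain ⟨h1, h2, h3⟩ := F.mem_interior_new_iff.1 hz
    rw [tri, PlaneTriangle.mem_interior_iff, PlaneTriangle.forall_fin_three F.hl' F.hm' F.hlm',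
      (F.coord_glued z).1, (F.coord_glued z).2, (F.swap.coord_glued z).2]
    have key : ∀ {x y xq yq : ℝ}, xq < 0 → xq * y < yq * x → 0 < y - yq / xq * x := by
      intro x y xq yq hx hlt
      have e : y - yq / xq * x = (yq * x - xq * y) / (-xq) := by
        have : xq ≠ 0 := hx.ne
        field_simp
        ring
      rw [e]
      exact div_pos (by linarith) (by linarith)
    refine ⟨div_pos_of_neg_of_neg h hX, key hX ?_, key hX h2⟩
    refine lt_of_mul_lt_mul_left ?_ hZ.le
    have h4 := mul_lt_mul_of_neg_left h3 hX
    have h5 := mul_lt_mul_of_pos_left h2 hY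
    linarith
  -- a point off the common edge is determined by its image
  have key : ∀ z ∈ interior (convexHull ℝ (Set.range F.newBasis)),
      ∀ w ∈ interior (convexHull ℝ (Set.range F.newBasis)), (T.basis c.1).coord c.2 z ≠ 0 →
      T.gluedMap c d σ τ z = T.gluedMap c d σ τ w → z = w := by
    intro z hz w hw h0 h
    rcases lt_or_gt_of_ne h0 with hneg | hpos
    · rw [F.gluedMap_of_mem_snd (hsnd z hz hneg).2] at h
      rcases lt_or_ge ((T.basis c.1).coord c.2 w) 0 with hw0 | hw0
      · rw [F.gluedMap_of_mem_snd (hsnd w hw hw0).2] at h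
        exact F.halfDilation_injective
          (eq_of_mem_interior (hint' z hz hneg) (hsnd w hw hw0).2 h).2
      · rw [gluedMap_of_mem_fst (hfst w hw hw0)] at h
        exact absurd (eq_of_mem_interior (hint' z hz hneg) (hfst w hw hw0) h).1 F.fst_ne.symm
    · rw [gluedMap_of_mem_fst (hfst z hz hpos.le)] at h
      rcases lt_or_ge ((T.basis c.1).coord c.2 w) 0 with hw0 | hw0
      · rw [F.gluedMap_of_mem_snd (hsnd w hw hw0).2] at h
        exact absurd (eq_of_mem_interior (hint z hz hpos) (hsnd w hw hw0).2 h).1 F.fst_ne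
      · rw [gluedMap_of_mem_fst (hfst w hw hw0)] at h
        exact (eq_of_mem_interior (hint z hz hpos) (hfst w hw hw0) h).2
  intro z hz w hw h
  by_cases hz0 : (T.basis c.1).coord c.2 z = 0
  · by_cases hw0 : (T.basis c.1).coord c.2 w = 0
    · by_contra hne
      have hzt := hfst z hz hz0.ge
      have hwt := hfst w hw hw0.ge
      rw [gluedMap_of_mem_fst hzt, gluedMap_of_mem_fst hwt] at h
      have hs : T.map c.1 z ∉ S.sing := by
        refine T.notMem_sing hzt ?_
        rintro ⟨j, rfl⟩
        have h1 := hcoord _ hz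
        have : c.2 = j ∨ l ≠ j := by
          by_contra hcon
          push Not at hcon
          obtain ⟨e1, e2⟩ := hcon
          rw [← e2, PlaneTriangle.coord_vertex_ne _ F.hlm.symm] at h1
          exact lt_irrefl _ h1.2
        rcases this with e | e
        · rw [← e, PlaneTriangle.coord_self] at hz0
          exact one_ne_zero hz0
        · rw [PlaneTriangle.coord_vertex_ne _ e] at h1
          exact lt_irrefl _ h1.1
      -- Two points of the edge with the same image would glue the edge to itself.
      obtain ⟨φ, hφ, hsrc⟩ := S.exists_chart _ hs
      obtain ⟨a, b, h1⟩ := T.exists_localForm hzt hs hφ hsrc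
      obtain ⟨a', b', h1'⟩ := T.exists_localForm hwt (h ▸ hs) hφ (h ▸ hsrc)
      obtain ⟨k, k', hk, hk', hgl, -⟩ := isGluing_of_localForm (fun _ => hne) hzt hwt h hs hφ h1 h1'
      rw [← PlaneTriangle.eq_of_mem_openEdge hk hz0,
        ← PlaneTriangle.eq_of_mem_openEdge hk' hw0] at hgl
      exact hgl.ne rfl
    · exact (key w hw z hz hw0 h.symm).symm
  · exact key z hz w hw hz0 h

theorem gluedMap_apex (F : T.IsFlippable c d σ τ l m l' m') :
    T.gluedMap c d σ τ (T.gluedApex d σ τ) = T.vertex d := by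
  rw [F.gluedMap_of_mem_snd, F.map_apex]
  · rfl
  · rw [F.map_apex]
    exact PlaneTriangle.vertex_mem _ _

/-- The triangle that is spanned by the two corners and one endpoint of their common edge. -/
theorem isTriangle_new (F : T.IsFlippable c d σ τ l m l' m') :
    S.IsTriangle (Function.update (T.vert c.1) m (T.gluedApex d σ τ)) (T.gluedMap c d σ τ) := by
  rw [← F.coe_newBasis]
  have hvert : ∀ j, F.newBasis j = T.basis c.1 c.2 ∨ F.newBasis j = T.basis c.1 l ∨
      F.newBasis j = T.gluedApex d σ τ :=
    (PlaneTriangle.forall_fin_three F.hl F.hm F.hlm).2 ⟨Or.inl F.newBasis_fst,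
      Or.inr (Or.inl F.newBasis_l), Or.inr (Or.inr F.newBasis_m)⟩
  have hnot : ∀ z ∈ convexHull ℝ (Set.range F.newBasis), z ∉ Set.range F.newBasis →
      T.gluedMap c d σ τ z ∉ S.sing := by
    intro z hz hv hs
    have hzk : z ≠ T.basis c.1 c.2 := fun h => hv ⟨c.2, F.newBasis_fst.trans h.symm⟩
    have hzl : z ≠ T.basis c.1 l := fun h => hv ⟨l, F.newBasis_l.trans h.symm⟩
    have hzq : z ≠ T.gluedApex d σ τ := fun h => hv ⟨m, F.newBasis_m.trans h.symm⟩
    have hzm : z ≠ T.basis c.1 m := by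
      rintro rfl
      have := (F.mem_new_iff.1 hz).2.2
      rw [PlaneTriangle.coord_self, PlaneTriangle.coord_vertex_ne _ F.hlm] at this
      linarith [F.coord_apex_pos]
    rcases F.new_subset hz with h | h
    · rw [gluedMap_of_mem_fst h] at hs
      obtain ⟨j, hj⟩ := exists_vertex_of_mem_sing h hs
      have h1 : ∀ j, z ≠ T.basis c.1 j :=
        (PlaneTriangle.forall_fin_three F.hl F.hm F.hlm).2 ⟨hzk, hzl, hzm⟩
      exact h1 j hj
    · rw [F.gluedMap_of_mem_snd h] at hs
      obtain ⟨j, hj⟩ := exists_vertex_of_mem_sing h hs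
      have h1 : ∀ j, (σ : ℂ) * z + τ ≠ T.basis d.1 j := by
        refine (PlaneTriangle.forall_fin_three F.hl' F.hm' F.hlm').2 ⟨?_, ?_, ?_⟩
        · rw [← F.map_apex]; exact fun h => hzq (F.halfDilation_injective h)
        · rw [← F.map_l]; exact fun h => hzl (F.halfDilation_injective h)
        · rw [← F.map_m]; exact fun h => hzm (F.halfDilation_injective h)
      exact h1 j hj
  refine ⟨F.newBasis.ind, F.continuousOn_gluedMap.mono F.new_subset, F.injOn_interior_new, ?_, ?_,
    hnot⟩
  · rintro ⟨z, hz⟩ hv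
    obtain ⟨φ, hφ, a, b, h⟩ := F.exists_localForm (F.new_subset hz) (hnot z hz hv)
    exact (h.mono F.new_subset).isHalfDilationAt hφ hz
  · intro j
    rcases hvert j with h | h | h <;> rw [h]
    · rw [gluedMap_of_mem_fst (PlaneTriangle.vertex_mem _ _)]
      exact T.map_vert_mem _ _
    · rw [gluedMap_of_mem_fst (PlaneTriangle.vertex_mem _ _)]
      exact T.map_vert_mem _ _
    · rw [F.gluedMap_apex]
      exact T.vertex_mem_sing d

theorem flipVert_fst (F : T.IsFlippable c d σ τ l m l' m') : F.flipVert c.1 = F.newBasis := by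
  rw [flipVert, Function.update_of_ne F.fst_ne, Function.update_self, coe_newBasis]

theorem flipVert_snd (F : T.IsFlippable c d σ τ l m l' m') : F.flipVert d.1 = F.swap.newBasis := by
  rw [flipVert, Function.update_self, coe_newBasis]

theorem isTriangle_flip (F : T.IsFlippable c d σ τ l m l' m') (i : Fin T.n) :
    S.IsTriangle (F.flipVert i) (F.flipMap i) := by
  by_cases hc : i = c.1
  · rw [hc, F.flipVert_fst, F.flipMap_fst]
    exact F.isTriangle_new
  by_cases hd : i = d.1
  · rw [hd, F.flipVert_snd, F.flipMap_snd]
    exact F.swap.isTriangle_new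
  rw [F.flipVert_of_ne hc hd, F.flipMap_of_ne hc hd]
  exact T.isTriangle i

/-- A point over an interior point of a triangle of `T`, seen in the union of the two triangles. -/
theorem eq_of_gluedMap_eq (F : T.IsFlippable c d σ τ l m l' m') {j : Fin T.n} {w z : ℂ}
    (hw : w ∈ interior (T.tri j)) (hz : z ∈ T.gluedQuad c d σ τ)
    (h : T.map j w = T.gluedMap c d σ τ z) : (j = c.1 ∧ w = z) ∨ (j = d.1 ∧ w = σ * z + τ) := by
  rcases hz with hz | hz
  · rw [gluedMap_of_mem_fst hz] at h
    exact Or.inl (eq_of_mem_interior hw hz h)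
  · rw [F.gluedMap_of_mem_snd hz] at h
    exact Or.inr (eq_of_mem_interior hw hz h)

/-- Almost every point lies in the interior of a triangle of `T` and off the new diagonal, and so in
only one triangle after the flip. -/
theorem disjoint_interior_flip (F : T.IsFlippable c d σ τ l m l' m') {i i' : Fin T.n}
    (hii : i ≠ i') :
    Disjoint (interior (F.flipMap i '' convexHull ℝ (Set.range (F.flipVert i))))
      (interior (F.flipMap i' '' convexHull ℝ (Set.range (F.flipVert i')))) := by
  -- the affine function that vanishes on the diagonal
  set δ : ℂ → ℝ := fun z => (T.basis c.1).coord l (T.gluedApex d σ τ) * (T.basis c.1).coord m z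
    - (T.basis c.1).coord m (T.gluedApex d σ τ) * (T.basis c.1).coord l z with hδ
  have hδa : IsRealAffine δ := ((PlaneTriangle.isRealAffine_coord _ m).const_mul _).sub
    ((PlaneTriangle.isRealAffine_coord _ l).const_mul _)
  have hδm : δ (T.basis c.1 m) ≠ 0 := by
    simp only [hδ]
    rw [PlaneTriangle.coord_self, PlaneTriangle.coord_vertex_ne _ F.hlm, mul_zero, sub_zero,
      mul_one]
    exact F.coord_apex_pos.ne'
  rw [Set.disjoint_left]
  intro x hx hx'
  set O := interior (F.flipMap i '' convexHull ℝ (Set.range (F.flipVert i))) ∩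
    interior (F.flipMap i' '' convexHull ℝ (Set.range (F.flipVert i'))) with hO
  have hOo : IsOpen O := isOpen_interior.inter isOpen_interior
  -- Move the common point to one over an interior point of a triangle of `T`, and then off the
  -- diagonal.
  obtain ⟨j, w₀, hw₀, hx₀⟩ := T.cover x
  have hcont := (T.continuousOn_tri j w₀ hw₀).eventually (hOo.mem_nhds (hx₀.symm ▸ ⟨hx, hx'⟩))
  have hcl : w₀ ∈ closure (interior (T.tri j)) := by
    rw [tri, PlaneTriangle.closure_interior]; exact hw₀
  obtain ⟨w₁, hw₁, hw₁O⟩ := ((mem_closure_iff_frequently.1 hcl).and_eventually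
    (eventually_nhdsWithin_iff.1 hcont)).exists
  have hcont₁ := (T.continuousOn_tri j w₁ (interior_subset hw₁)).eventually
    (hOo.mem_nhds (hw₁O (interior_subset hw₁)))
  obtain ⟨w, hgen, hw, hwO⟩ : ∃ w, (∀ z, (j = c.1 ∧ w = z) ∨ (j = d.1 ∧ w = σ * z + τ) → δ z ≠ 0) ∧
      w ∈ interior (T.tri j) ∧ T.map j w ∈ O := by
    have hev : ∀ᶠ w in 𝓝 w₁, w ∈ interior (T.tri j) ∧ T.map j w ∈ O := by
      filter_upwards [eventually_nhdsWithin_iff.1 hcont₁, isOpen_interior.mem_nhds hw₁] with y h1 h2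
      exact ⟨h2, h1 (interior_subset h2)⟩
    by_cases hd : j = d.1
    · have h1 := (hδa.comp_halfDilation σ⁻¹ (-τ / σ)).frequently_ne_zero
        ⟨σ * T.basis c.1 m + τ, ?_⟩ w₁
      · obtain ⟨w, h2, h3⟩ := (h1.and_eventually hev).exists
        refine ⟨w, ?_, h3⟩
        rintro z (⟨e1, -⟩ | ⟨-, rfl⟩)
        · exact absurd (e1.symm.trans hd) F.fst_ne
        · convert h2 using 2
          have := F.ofReal_ne_zero
          push_cast
          field_simp
          ring
      · convert hδm using 2
        have := F.ofReal_ne_zero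
        push_cast
        field_simp
        ring
    · obtain ⟨w, h2, h3⟩ := ((hδa.frequently_ne_zero ⟨_, hδm⟩ w₁).and_eventually hev).exists
      refine ⟨w, ?_, h3⟩
      rintro z (⟨-, rfl⟩ | ⟨e1, -⟩)
      · exact h2
      · exact absurd e1 hd
  -- The sign of `δ` tells which of the two new triangles contains the point.
  have hface : ∀ i, T.map j w ∈ F.flipMap i '' convexHull ℝ (Set.range (F.flipVert i)) →
      (i = c.1 ∧ ∃ z, δ z ≤ 0 ∧ ((j = c.1 ∧ w = z) ∨ (j = d.1 ∧ w = σ * z + τ))) ∨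
      (i = d.1 ∧ ∃ z, 0 ≤ δ z ∧ ((j = c.1 ∧ w = z) ∨ (j = d.1 ∧ w = σ * z + τ))) ∨
      (i ≠ c.1 ∧ i ≠ d.1 ∧ j = i) := by
    rintro i ⟨z, hz, he⟩
    by_cases hc : i = c.1
    · rw [hc, F.flipVert_fst] at hz
      rw [hc, F.flipMap_fst] at he
      exact Or.inl ⟨hc, z, sub_nonpos.2 (F.mem_new_iff.1 hz).2.2,
        F.eq_of_gluedMap_eq hw (F.new_subset hz) he.symm⟩
    by_cases hd : i = d.1
    · rw [hd, F.flipVert_snd] at hz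
      rw [hd, F.flipMap_snd] at he
      exact Or.inr (Or.inl ⟨hd, z, sub_nonneg.2 (F.swap.mem_new_iff.1 hz).2.2,
        F.eq_of_gluedMap_eq hw (F.swap.new_subset hz) he.symm⟩)
    · rw [F.flipVert_of_ne hc hd] at hz
      rw [F.flipMap_of_ne hc hd] at he
      exact Or.inr (Or.inr ⟨hc, hd, (eq_of_mem_interior hw hz he.symm).1⟩)
  have hcd : ∀ z z', δ z ≤ 0 → 0 ≤ δ z' → ((j = c.1 ∧ w = z) ∨ (j = d.1 ∧ w = σ * z + τ)) →
      ((j = c.1 ∧ w = z') ∨ (j = d.1 ∧ w = σ * z' + τ)) → False := by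
    intro z z' h1 h2 h3 h4
    have h5 := hgen z h3
    have h6 : z = z' := by
      rcases h3 with ⟨e1, e2⟩ | ⟨e1, e2⟩ <;> rcases h4 with ⟨e3, e4⟩ | ⟨e3, e4⟩
      · exact e2.symm.trans e4
      · exact absurd (e1.symm.trans e3) F.fst_ne
      · exact absurd (e3.symm.trans e1) F.fst_ne
      · exact F.halfDilation_injective (e2.symm.trans e4)
    rw [← h6] at h2
    exact h5 (le_antisymm h1 h2)
  have hjc : ∀ {z}, ((j = c.1 ∧ w = z) ∨ (j = d.1 ∧ w = σ * z + τ)) → j = c.1 ∨ j = d.1 :=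
    fun h => h.imp And.left And.left
  rcases hface i (interior_subset hwO.1) with ⟨e, z, h1, h2⟩ | ⟨e, z, h1, h2⟩ | ⟨e1, e2, e3⟩ <;>
  rcases hface i' (interior_subset hwO.2) with ⟨e', z', h1', h2'⟩ | ⟨e', z', h1', h2'⟩ |
    ⟨e1', e2', e3'⟩
  · exact hii (e.trans e'.symm)
  · exact hcd z z' h1 h1' h2 h2'
  · rw [← e3'] at e1' e2'; exact (hjc h2).elim e1' e2'
  · exact hcd z' z h1' h1 h2' h2
  · exact hii (e.trans e'.symm)
  · rw [← e3'] at e1' e2'; exact (hjc h2).elim e1' e2'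
  · rw [← e3] at e1 e2; exact (hjc h2').elim e1 e2
  · rw [← e3] at e1 e2; exact (hjc h2').elim e1 e2
  · exact hii (e3.symm.trans e3')

theorem gluedMap_mem_flip (F : T.IsFlippable c d σ τ l m l' m') {z : ℂ}
    (hz : z ∈ T.gluedQuad c d σ τ) :
    ∃ i, T.gluedMap c d σ τ z ∈ F.flipMap i '' convexHull ℝ (Set.range (F.flipVert i)) := by
  have hX := F.coord_apex_neg
  have hY := F.coord_apex_pos
  have hZ := F.swap.coord_apex_pos
  -- The union of the two triangles, as the quadrilateral cut out by its four sides.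
  have h : 0 ≤ (T.basis c.1).coord l z ∧ 0 ≤ (T.basis c.1).coord m z ∧
      (T.basis c.1).coord c.2 (T.gluedApex d σ τ) * (T.basis c.1).coord l z
        ≤ (T.basis c.1).coord l (T.gluedApex d σ τ) * (T.basis c.1).coord c.2 z ∧
      (T.basis c.1).coord c.2 (T.gluedApex d σ τ) * (T.basis c.1).coord m z
        ≤ (T.basis c.1).coord m (T.gluedApex d σ τ) * (T.basis c.1).coord c.2 z := by
    rcases hz with hz | hz
    · obtain ⟨h1, h2, h3⟩ := F.mem_tri_fst_iff.1 hz
      exact ⟨h2, h3, (mul_nonpos_of_nonpos_of_nonneg hX.le h2).trans (mul_nonneg hY.le h1),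
        (mul_nonpos_of_nonpos_of_nonneg hX.le h3).trans (mul_nonneg hZ.le h1)⟩
    · obtain ⟨h1, h2, h3⟩ := F.mem_tri_snd_iff.1 hz
      refine ⟨?_, ?_, h2, h3⟩
      · by_contra hcon
        push Not at hcon
        have := mul_pos_of_neg_of_neg hX hcon
        have := mul_nonpos_of_nonneg_of_nonpos hY.le h1
        linarith
      · by_contra hcon
        push Not at hcon
        have := mul_pos_of_neg_of_neg hX hcon
        have := mul_nonpos_of_nonneg_of_nonpos hZ.le h1
        linarith
  obtain ⟨hl, hm, h1, h2⟩ := h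
  rcases le_total ((T.basis c.1).coord l (T.gluedApex d σ τ) * (T.basis c.1).coord m z)
    ((T.basis c.1).coord m (T.gluedApex d σ τ) * (T.basis c.1).coord l z) with h | h
  · refine ⟨c.1, z, ?_, by rw [F.flipMap_fst]⟩
    rw [F.flipVert_fst]
    exact F.mem_new_iff.2 ⟨hm, h2, h⟩
  · refine ⟨d.1, z, ?_, by rw [F.flipMap_snd]⟩
    rw [F.flipVert_snd]
    exact F.swap.mem_new_iff.2 ⟨hl, h1, h⟩

theorem cover_flip (F : T.IsFlippable c d σ τ l m l' m') (x : X) :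
    ∃ i, x ∈ F.flipMap i '' convexHull ℝ (Set.range (F.flipVert i)) := by
  obtain ⟨i, w, hw, rfl⟩ := T.cover x
  by_cases hc : i = c.1
  · subst hc
    rw [← gluedMap_of_mem_fst (d := d) (σ := σ) (τ := τ) hw]
    exact F.gluedMap_mem_flip (Or.inl hw)
  by_cases hd : i = d.1
  · subst hd
    have e : (σ : ℂ) * ((w - τ) / σ) + τ = w := by
      have := F.ofReal_ne_zero
      field_simp
      ring
    have h1 : (σ : ℂ) * ((w - τ) / σ) + τ ∈ T.tri d.1 := e.symm ▸ hw
    have h2 := F.gluedMap_mem_flip (Or.inr h1)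
    rwa [F.gluedMap_of_mem_snd h1, e] at h2
  · refine ⟨i, w, ?_, by rw [F.flipMap_of_ne hc hd]⟩
    rw [F.flipVert_of_ne hc hd]
    exact hw

/-- The flip: the common edge of two triangles with the same circumcircle is replaced by the other
diagonal of their union. -/
@[reducible]
noncomputable def flip (F : T.IsFlippable c d σ τ l m l' m') : S.Triangulation where
  n := T.n
  vert := F.flipVert
  map := F.flipMap
  affineIndependent i := (F.isTriangle_flip i).affineIndependent
  continuousOn i := (F.isTriangle_flip i).continuousOn
  injOn_interior i := (F.isTriangle_flip i).injOn_interior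
  isHalfDilationAt i := (F.isTriangle_flip i).isHalfDilationAt
  map_vert_mem i := (F.isTriangle_flip i).map_vert_mem
  map_notMem i := (F.isTriangle_flip i).map_notMem
  disjoint_interior _ _ h := F.disjoint_interior_flip h
  cover := F.cover_flip

end IsFlippable

end Triangulation

end HalfDilationStructure

/-! ### The flip of a Delaunay triangulation -/

namespace PlaneTriangle

/-- Inscribed angles over the side `x y`. -/
theorem angle_eq_of_negPower_eq_zero_of_ne (b : AffineBasis (Fin 3) ℝ ℂ) {j x y : Fin 3}
    (hx : x ≠ j) (hy : y ≠ j) (hxy : x ≠ y) {p : ℂ} (hp : 0 < b.coord j p)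
    (h : negPower b p = 0) :
    EuclideanGeometry.angle (b x) p (b y) = EuclideanGeometry.angle (b x) (b j) (b y) := by
  rw [← angle_add_one_add_two b p hx hy hxy, ← angle_add_one_add_two b (b j) hx hy hxy]
  exact angle_eq_of_negPower_eq_zero b j hp h

end PlaneTriangle

namespace HalfDilationStructure

variable {X : Type*} [TopologicalSpace X] {S : HalfDilationStructure X}

namespace Triangulation

variable {T : S.Triangulation}

theorem angle_eq_of_ne (i : Fin T.n) {j x y : Fin 3} (hx : x ≠ j) (hy : y ≠ j) (hxy : x ≠ y) :
    T.angle (i, j) = EuclideanGeometry.angle (T.vert i x) (T.vert i j) (T.vert i y) :=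
  PlaneTriangle.angle_add_one_add_two (T.vert i) _ hx hy hxy

theorem edge_eq_of_ne (i : Fin T.n) {j x y : Fin 3} (hx : x ≠ j) (hy : y ≠ j) (hxy : x ≠ y) :
    T.edge (i, j) = T.map i '' segment ℝ (T.vert i x) (T.vert i y) := by
  rw [edge, PlaneTriangle.segment_add_one_add_two (T.vert i) hx hy hxy]

theorem angle_sum_of_ne (T : S.Triangulation) (i : Fin T.n) {k l m : Fin 3} (hl : l ≠ k)
    (hm : m ≠ k) (hlm : l ≠ m) : T.angle (i, k) + T.angle (i, l) + T.angle (i, m) = Real.pi := by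
  have h := T.angle_sum i
  have h2 : ∑ j, T.angle (i, j) = Real.pi := by rw [Fin.sum_univ_three]; exact h
  rw [PlaneTriangle.univ_eq_of_ne hl hm hlm, Finset.sum_insert (by simp [hl.symm, hm.symm]),
    Finset.sum_pair hlm] at h2
  linarith

namespace IsFlippable

variable {c d : T.Corner} {σ : ℝ} {τ : ℂ} {l m l' m' : Fin 3} [T2Space X]

/-- The corner of the new triangle at the new vertex. -/
theorem new_corner_apex (F : T.IsFlippable c d σ τ l m l' m') :
    EuclideanGeometry.angle (F.newBasis c.2) (F.newBasis m) (F.newBasis l) = T.angle (c.1, m) ∧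
    T.gluedMap c d σ τ '' segment ℝ (F.newBasis c.2) (F.newBasis l) = T.edge (c.1, m) := by
  rw [F.newBasis_fst, F.newBasis_l, F.newBasis_m]
  constructor
  · rw [angle_eq_of_ne c.1 F.hm.symm F.hlm F.hl.symm]
    exact PlaneTriangle.angle_eq_of_negPower_eq_zero_of_ne (T.basis c.1) F.hm.symm F.hlm F.hl.symm
      F.swap.coord_apex_pos F.negPower_apex
  · rw [edge_eq_of_ne c.1 F.hm.symm F.hlm F.hl.symm]
    refine Set.image_congr fun z hz => gluedMap_of_mem_fst ?_
    exact (convex_convexHull ℝ _).segment_subset (PlaneTriangle.vertex_mem _ _)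
      (PlaneTriangle.vertex_mem _ _) hz

/-- The corner of the new triangle at the corner `c`. -/
theorem new_corner_fst (F : T.IsFlippable c d σ τ l m l' m') :
    EuclideanGeometry.angle (F.newBasis l) (F.newBasis c.2) (F.newBasis m) = T.angle (d.1, m') ∧
    T.gluedMap c d σ τ '' segment ℝ (F.newBasis l) (F.newBasis m) = T.edge (d.1, m') := by
  rw [F.newBasis_fst, F.newBasis_l, F.newBasis_m]
  constructor
  · have hpos : 0 < (T.basis d.1).coord m' ((σ : ℂ) * T.basis c.1 c.2 + τ) := by
      rw [(F.swap.coord_glued _).2, PlaneTriangle.coord_self,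
        PlaneTriangle.coord_vertex_ne _ F.hm, mul_one, zero_sub, ← neg_div_neg_eq, neg_div,
        neg_neg]
      exact div_pos F.swap.coord_apex_pos (neg_pos.2 F.coord_apex_neg)
    have h := PlaneTriangle.angle_eq_of_negPower_eq_zero_of_ne (T.basis d.1) F.hlm' F.hm'.symm
      F.hl' hpos (F.gluing.negPower_eq_zero F.angle_add)
    rw [angle_eq_of_ne d.1 F.hlm' F.hm'.symm F.hl', ← coe_basis, ← h, ← F.map_l, ← F.map_apex,
      PlaneTriangle.angle_halfDilation F.gluing.ne_zero]
  · rw [edge_eq_of_ne d.1 F.hlm' F.hm'.symm F.hl', ← coe_basis, ← F.map_l, ← F.map_apex,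
      ← PlaneTriangle.image_segment_halfDilation, Set.image_image]
    refine Set.image_congr fun z hz => F.gluedMap_of_mem_snd ?_
    have h1 : (σ : ℂ) * z + τ ∈ segment ℝ (T.basis d.1 l') (T.basis d.1 d.2) := by
      rw [← F.map_l, ← F.map_apex, ← PlaneTriangle.image_segment_halfDilation]
      exact ⟨z, hz, rfl⟩
    exact (convex_convexHull ℝ _).segment_subset (PlaneTriangle.vertex_mem _ _)
      (PlaneTriangle.vertex_mem _ _) h1

/-- Except at the ends of the diagonal that is removed, each corner after the flip corresponds to a
corner before the flip with the same angle and the same opposite edge. -/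
theorem exists_corner_flip (F : T.IsFlippable c d σ τ l m l' m') (e : T.Corner)
    (h1 : e ≠ (c.1, l)) (h2 : e ≠ (d.1, m)) : ∃ f : T.Corner,
      ((e = (c.1, c.2) ∧ f = (d.1, m')) ∨ (e = (d.1, c.2) ∧ f = (d.1, l')) ∨
        (e = (c.1, m) ∧ f = (c.1, m)) ∨ (e = (d.1, l) ∧ f = (c.1, l)) ∨
        (e.1 ≠ c.1 ∧ e.1 ≠ d.1 ∧ f = e)) ∧
      F.flip.angle e = T.angle f ∧ F.flip.edge e = T.edge f := by
  obtain ⟨i, j⟩ := e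
  have hj : ∀ j, j = c.2 ∨ j = l ∨ j = m := (PlaneTriangle.forall_fin_three F.hl F.hm F.hlm).2
    ⟨Or.inl rfl, Or.inr (Or.inl rfl), Or.inr (Or.inr rfl)⟩
  by_cases hc : i = c.1
  · subst hc
    have hv : F.flip.vert c.1 = F.newBasis := F.flipVert_fst
    have hm : F.flip.map c.1 = T.gluedMap c d σ τ := F.flipMap_fst
    rcases hj j with rfl | rfl | rfl
    · refine ⟨_, Or.inl ⟨rfl, rfl⟩, ?_, ?_⟩
      · rw [angle_eq_of_ne (T := F.flip) c.1 F.hl F.hm F.hlm, hv]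
        exact F.new_corner_fst.1
      · rw [edge_eq_of_ne (T := F.flip) c.1 F.hl F.hm F.hlm, hv, hm]
        exact F.new_corner_fst.2
    · exact absurd rfl h1
    · refine ⟨_, Or.inr (Or.inr (Or.inl ⟨rfl, rfl⟩)), ?_, ?_⟩
      · rw [angle_eq_of_ne (T := F.flip) c.1 F.hm.symm F.hlm F.hl.symm, hv]
        exact F.new_corner_apex.1
      · rw [edge_eq_of_ne (T := F.flip) c.1 F.hm.symm F.hlm F.hl.symm, hv, hm]
        exact F.new_corner_apex.2
  by_cases hd : i = d.1
  · subst hd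
    have hv : F.flip.vert d.1 = F.swap.newBasis := F.flipVert_snd
    have hm : F.flip.map d.1 = T.gluedMap c d σ τ := F.flipMap_snd
    rcases hj j with rfl | rfl | rfl
    · refine ⟨_, Or.inr (Or.inl ⟨rfl, rfl⟩), ?_, ?_⟩
      · rw [angle_eq_of_ne (T := F.flip) d.1 F.hm F.hl F.hlm.symm, hv]
        exact F.swap.new_corner_fst.1
      · rw [edge_eq_of_ne (T := F.flip) d.1 F.hm F.hl F.hlm.symm, hv, hm]
        exact F.swap.new_corner_fst.2
    · refine ⟨_, Or.inr (Or.inr (Or.inr (Or.inl ⟨rfl, rfl⟩))), ?_, ?_⟩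
      · rw [angle_eq_of_ne (T := F.flip) d.1 F.hl.symm F.hlm.symm F.hm.symm, hv]
        exact F.swap.new_corner_apex.1
      · rw [edge_eq_of_ne (T := F.flip) d.1 F.hl.symm F.hlm.symm F.hm.symm, hv, hm]
        exact F.swap.new_corner_apex.2
    · exact absurd rfl h2
  · have hv : F.flip.vert i = T.vert i := F.flipVert_of_ne hc hd
    have hm : F.flip.map i = T.map i := F.flipMap_of_ne hc hd
    refine ⟨(i, j), Or.inr (Or.inr (Or.inr (Or.inr ⟨hc, hd, rfl⟩))), ?_, ?_⟩
    · rw [angle, angle, hv]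
    · rw [edge, edge, hv, hm]

/-- The angles opposite the new diagonal add up to `π`, because the four triangles involved have
total angle `2π` before and after the flip. -/
theorem angle_add_flip (F : T.IsFlippable c d σ τ l m l' m') :
    F.flip.angle (c.1, l) + F.flip.angle (d.1, m) = Real.pi := by
  have hcd := F.fst_ne
  have hk : F.flip.angle (c.1, c.2) = T.angle (d.1, m') := by
    rw [angle_eq_of_ne (T := F.flip) c.1 F.hl F.hm F.hlm, show F.flip.vert c.1 = F.newBasis from
      F.flipVert_fst]
    exact F.new_corner_fst.1
  have hm : F.flip.angle (c.1, m) = T.angle (c.1, m) := by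
    rw [angle_eq_of_ne (T := F.flip) c.1 F.hm.symm F.hlm F.hl.symm,
      show F.flip.vert c.1 = F.newBasis from F.flipVert_fst]
    exact F.new_corner_apex.1
  have hk' : F.flip.angle (d.1, c.2) = T.angle (d.1, l') := by
    rw [angle_eq_of_ne (T := F.flip) d.1 F.hm F.hl F.hlm.symm,
      show F.flip.vert d.1 = F.swap.newBasis from F.flipVert_snd]
    exact F.swap.new_corner_fst.1
  have hl : F.flip.angle (d.1, l) = T.angle (c.1, l) := by
    rw [angle_eq_of_ne (T := F.flip) d.1 F.hl.symm F.hlm.symm F.hm.symm,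
      show F.flip.vert d.1 = F.swap.newBasis from F.flipVert_snd]
    exact F.swap.new_corner_apex.1
  have s1 := angle_sum_of_ne F.flip c.1 F.hl F.hm F.hlm
  have s2 := angle_sum_of_ne F.flip d.1 F.hl F.hm F.hlm
  have s3 := angle_sum_of_ne T c.1 F.hl F.hm F.hlm
  have s4 := angle_sum_of_ne T d.1 F.hl' F.hm' F.hlm'
  have h : T.angle (c.1, c.2) + T.angle (d.1, d.2) = Real.pi := F.angle_add
  linarith

theorem vertex_flip (F : T.IsFlippable c d σ τ l m l' m') :
    F.flip.vertex (c.1, c.2) = T.vertex c ∧ F.flip.vertex (c.1, m) = T.vertex d := by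
  have hv : F.flip.vert c.1 = F.newBasis := F.flipVert_fst
  have hm : F.flip.map c.1 = T.gluedMap c d σ τ := F.flipMap_fst
  rw [vertex, vertex, vertex, hv, hm, F.newBasis_fst, F.newBasis_m, F.gluedMap_apex]
  exact ⟨gluedMap_of_mem_fst (PlaneTriangle.vertex_mem _ _), rfl⟩

theorem vertex_flip_snd (F : T.IsFlippable c d σ τ l m l' m') :
    F.flip.vertex (d.1, c.2) = T.vertex c ∧ F.flip.vertex (d.1, l) = T.vertex d := by
  have hv : F.flip.vert d.1 = F.swap.newBasis := F.flipVert_snd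
  have hm : F.flip.map d.1 = T.gluedMap c d σ τ := F.flipMap_snd
  rw [vertex, vertex, vertex, hv, hm, F.swap.newBasis_fst, F.swap.newBasis_m, F.gluedMap_apex]
  exact ⟨gluedMap_of_mem_fst (PlaneTriangle.vertex_mem _ _), rfl⟩

/-- If no triangle of a Delaunay triangulation contains both ends of the new diagonal, the flipped
triangulation is again Delaunay, and it is a different collection of triangles. -/
theorem isDelaunay_flip (F : T.IsFlippable c d σ τ l m l' m') (hD : T.IsDelaunay)
    (hno : ∀ f g : T.Corner, T.vertex f = T.vertex c → T.vertex g = T.vertex d → f.1 ≠ g.1) :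
    F.flip.IsDelaunay ∧ F.flip.faces ≠ T.faces := by
  have hcd := F.fst_ne
  constructor
  · -- the new diagonal is not an edge of `T`
    have hdiag : ∀ e f : T.Corner, (e = (c.1, l) ∨ e = (d.1, m)) → F.flip.edge e ≠ T.edge f := by
      intro e f he hef
      have h1 : T.vertex c ∈ F.flip.edge e ∧ T.vertex d ∈ F.flip.edge e := by
        rcases he with rfl | rfl
        · rw [← F.vertex_flip.1, ← F.vertex_flip.2]
          exact ⟨vertex_mem_edge (T := F.flip) rfl fun h => F.hl (Prod.ext_iff.1 h).2.symm,
            vertex_mem_edge (T := F.flip) rfl fun h => F.hlm (Prod.ext_iff.1 h).2.symm⟩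
        · rw [← F.vertex_flip_snd.1, ← F.vertex_flip_snd.2]
          exact ⟨vertex_mem_edge (T := F.flip) rfl fun h => F.hm (Prod.ext_iff.1 h).2.symm,
            vertex_mem_edge (T := F.flip) rfl fun h => F.hlm (Prod.ext_iff.1 h).2⟩
      rw [hef] at h1
      obtain ⟨g, hg, -, hgc⟩ := exists_corner_of_mem_edge (T.vertex_mem_sing c) h1.1
      obtain ⟨g', hg', -, hgd⟩ := exists_corner_of_mem_edge (T.vertex_mem_sing d) h1.2
      exact hno g g' hgc hgd (hg.trans hg'.symm)
    intro e e' hee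
    by_cases he : e = (c.1, l) ∨ e = (d.1, m)
    · by_cases he' : e' = (c.1, l) ∨ e' = (d.1, m)
      · have h := F.angle_add_flip
        rcases he with rfl | rfl <;> rcases he' with rfl | rfl
        · exact absurd rfl hee.1
        · exact h.le
        · rw [add_comm]; exact h.le
        · exact absurd rfl hee.1
      · push Not at he'
        obtain ⟨f, -, -, hf⟩ := F.exists_corner_flip e' he'.1 he'.2
        exact absurd (hee.2.trans hf) (hdiag e f he)
    · by_cases he' : e' = (c.1, l) ∨ e' = (d.1, m)
      · push Not at he
        obtain ⟨f, -, -, hf⟩ := F.exists_corner_flip e he.1 he.2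
        exact absurd (hee.2.symm.trans hf) (hdiag e' f he')
      · push Not at he he'
        obtain ⟨f, hf1, hf2, hf3⟩ := F.exists_corner_flip e he.1 he.2
        obtain ⟨f', hf1', hf2', hf3'⟩ := F.exists_corner_flip e' he'.1 he'.2
        rw [hf2, hf2']
        refine hD f f' ⟨?_, by rw [← hf3, ← hf3', hee.2]⟩
        -- different corners correspond to different corners
        have hlm' := F.hlm'
        have hlm := F.hlm
        intro hff
        apply hee.1
        rcases hf1 with ⟨h1, h2⟩ | ⟨h1, h2⟩ | ⟨h1, h2⟩ | ⟨h1, h2⟩ | ⟨h1, h3, h2⟩ <;>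
        rcases hf1' with ⟨h1', h2'⟩ | ⟨h1', h2'⟩ | ⟨h1', h2'⟩ | ⟨h1', h2'⟩ | ⟨h1', h3', h2'⟩ <;>
        rw [h2, h2'] at hff <;>
        first
          | exact h1.trans h1'.symm
          | exact hff
          | exact absurd (Prod.ext_iff.1 hff).1 hcd
          | exact absurd (Prod.ext_iff.1 hff).1 hcd.symm
          | exact absurd (Prod.ext_iff.1 hff).2 hlm'
          | exact absurd (Prod.ext_iff.1 hff).2 hlm'.symm
          | exact absurd (Prod.ext_iff.1 hff).2 hlm
          | exact absurd (Prod.ext_iff.1 hff).2 hlm.symm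
          | exact absurd (congrArg Prod.fst hff) h1
          | exact absurd (congrArg Prod.fst hff).symm h1'
          | exact absurd (congrArg Prod.fst hff) h3
          | exact absurd (congrArg Prod.fst hff).symm h3'
  · -- A triangle of `T` that is also a triangle after the flip would contain both ends of the new
    -- diagonal.
    intro hf
    have h1 : F.flip.face c.1 ∈ T.faces := hf ▸ ⟨c.1, rfl⟩
    obtain ⟨i, hi⟩ := h1
    have hmem : ∀ j, ∃ g : T.Corner, g.1 = i ∧ T.vertex g = F.flip.vertex (c.1, j) := by
      intro j
      have h2 : F.flip.vertex (c.1, j) ∈ T.face i :=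
        hi ▸ ⟨_, PlaneTriangle.vertex_mem (F.flip.basis c.1) j, rfl⟩
      obtain ⟨w, hw, hwx⟩ := h2
      obtain ⟨q, rfl⟩ := exists_vertex_of_mem_sing (T := T) hw
        (hwx ▸ F.flip.vertex_mem_sing (c.1, j))
      exact ⟨(i, q), rfl, hwx⟩
    obtain ⟨g, hg, hgv⟩ := hmem c.2
    obtain ⟨g', hg', hgv'⟩ := hmem m
    exact hno g g' (hgv.trans F.vertex_flip.1) (hgv'.trans F.vertex_flip.2) (hg.trans hg'.symm)

end IsFlippable

theorem AreOpposite.exists_isFlippable {c d : T.Corner} (h : T.AreOpposite c d) (hne : c.1 ≠ d.1)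
    (hpi : T.angle c + T.angle d = Real.pi) [T2Space X] :
    ∃ σ τ l m l' m', T.IsFlippable c d σ τ l m l' m' := by
  obtain ⟨σ, τ, hgl⟩ := h.exists_isGluing
  have h1 := PlaneTriangle.fin3_add_one_ne
  have h2 := PlaneTriangle.fin3_add_two_ne
  have h3 := PlaneTriangle.fin3_add_one_ne_add_two
  rcases hgl.endpoints with ⟨e1, e2⟩ | ⟨e1, e2⟩
  · exact ⟨σ, τ, _, _, _, _, hne, hgl, hpi, h1 _, h2 _, h3 _, h1 _, h2 _, h3 _, e1, e2⟩
  · exact ⟨σ, τ, _, _, _, _, hne, hgl, hpi, h1 _, h2 _, h3 _, h2 _, h1 _, (h3 _).symm, e1, e2⟩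

/-- A `{2,2,4,4}`-triangulation is not the only Delaunay triangulation: an edge with angle sum `π`
can be flipped. -/
theorem IsType2244.not_isUniqueDelaunay (hT : T.IsType2244) (hS : S.IsPillowcase) :
    ¬ T.IsUniqueDelaunay := by
  rintro ⟨hD, huniq⟩
  have := hS.t2Space
  obtain ⟨c, d, hcd, hne, hpi, hno⟩ := hT.exists_cocircular hS hD
  obtain ⟨σ, τ, l, m, l', m', F⟩ := hcd.exists_isFlippable hne hpi
  obtain ⟨h1, h2⟩ := F.isDelaunay_flip hD hno
  exact h2 (huniq _ h1)

end Triangulation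

end HalfDilationStructure

theorem proposition4p3 {X : Type*} [TopologicalSpace X] (S : HalfDilationStructure X)
    (hS : S.IsPillowcase) :
    -- `t` is the central triangle; its angles are `α', β', γ'`, and `A`, `B`, `C` are the
    -- corners with angles `α, β, γ` opposite the same edges
    (∀ T : S.Triangulation, T.IsTetrahedral → T.IsDelaunay →
      ∀ (t : Fin T.n) (A B C : T.Corner),
        T.AreOpposite A (t, 0) → T.AreOpposite B (t, 1) → T.AreOpposite C (t, 2) →
        T.angle A + T.angle (t, 0) < Real.pi →
        T.angle B + T.angle (t, 1) < Real.pi →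
        T.angle C + T.angle (t, 2) < Real.pi →
        T.IsUniqueDelaunay) ∧
    (∀ T : S.Triangulation, T.IsType2244 → ¬ T.IsUniqueDelaunay) := by
  have := hS.t2Space
  open HalfDilationStructure.Triangulation in
  refine ⟨fun T hT hD t A B C hA hB hC h1 h2 h3 =>
    isUniqueDelaunay_of_forall_lt hD fun c d hcd =>
      hT.angle_add_lt_pi hS.2 (t := t) (fun k => ?_) hcd,
    fun T hT => hT.not_isUniqueDelaunay hS⟩
  fin_cases k
  exacts [⟨A, hA, h1⟩, ⟨B, hB, h2⟩, ⟨C, hC, h3⟩]
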